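/- Let $\gamma>0$. A random vector $X\in\mathbb R^p$ is said to have the spherical generalized Gaussian distribution $\mathcal{GN}_\gamma(0,I_p)$ if, for every unit vector $v\in\mathcal S^{p-1}$, the projection $v^\top X$ has a density on $\mathbb R$ proportional to $\exp(-|t|^\gamma/2)$. Let $p,n\ge 1$ be such that this distribution exists in dimension $p$, let $\sigma>0$ and $\epsilon\in[0,1]$. For $\beta\in\mathbb R^p$ and a conditional distribution (Markov kernel) $Q=(Q_x)_{x\in\mathbb R^p}$ on $\mathbb R$, let $\mathbb P_{\beta,\sigma,Q}$ be the law of $n$ independent pairs $(X_i,y_i)\in\mathbb R^p\times\mathbb R$ with $$X_i\sim\mathcal{GN}_\gamma(0,I_p),\qquad y_i\mid X_i\sim(1-\epsilon)\,\mathcal N(X_i^\top\beta,\sigma^2)+\epsilon\, Q_{X_i}.$$ Put $$r=\sigma\left(\sqrt{\frac pn}+\frac{\epsilon}{(\log(n\epsilon^2/p+e))^{1/\gamma}}\right),\qquad t=\left(\frac{\log(n\epsilon^2/p+e)}{3}\right)^{1/\gamma}.$$ The truncated-depth estimator $\widehat\beta$ is any maximizer over $b\in\mathbb R^p$ of the empirical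 truncated regression depth $$\inf_{v\in\mathcal S^{p-1}}\frac1n\sum_{i=1}^n\mathbf 1\{v^\top X_i(y_i-X_i^\top b)\ge0,\ |v^\top X_i|\ge t\}.$$ (Upper bound.) For every $\alpha\in(0,1)$ there exist $C,c>0$, depending only on $\alpha$ and $\gamma$, such that whenever $\sqrt{p/n}+\epsilon\le c$, a maximizer exists for every data set, and for all $\beta$ and $Q$, with $\mathbb P_{\beta,\sigma,Q}$-probability at least $1-\alpha$, every maximizer $\widehat\beta$ satisfies $\|\widehat\beta-\beta\|_2\le C\,r$. (That is, the exceptional event has outer probability at most $\alpha$.) (Lower bound.) There exists $C'>0$, depending only on $\gamma$, such that for all $p,n,\sigma,\epsilon$ as above, $$\inf_{\widehat\beta}\ \sup_{\beta,Q}\ \mathbb P_{\beta,\sigma,Q}\left(\|\widehat\beta-\beta\|_2\ge C'\,r\right)\ge\frac12,$$ where the infimum is over all measurable estimators $\widehat\beta=\widehat\beta((X_i,y_i)_{i\le n})$. -/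

import Mathlib

open MeasureTheory ProbabilityTheory
open scoped ENNReal

namespace RobustRegression

/-- The probability distribution on `ℝ` whose Lebesgue density is proportional to
`t ↦ exp (-|t| ^ γ / 2)`. -/
noncomputable def generalizedGaussianReal (γ : ℝ) : Measure ℝ :=
  volume.withDensity fun t =>
    ENNReal.ofReal (Real.exp (-|t| ^ γ / 2) / ∫ s : ℝ, Real.exp (-|s| ^ γ / 2))

/-- `μ` is the spherical generalized Gaussian distribution `GN_γ(0, I_p)` : under `μ`, every
one-dimensional projection `vᵀX` along a unit vector `v` has density proportional to
`exp (-|t| ^ γ / 2)`. (For `p ≥ 1` there is at most one such `μ`.) -/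
def IsSphericalGeneralizedGaussian {p : ℕ} (γ : ℝ) (μ : Measure (EuclideanSpace ℝ (Fin p))) :
    Prop :=
  ∀ v : EuclideanSpace ℝ (Fin p), ‖v‖ = 1 →
    μ.map (fun x => inner ℝ v x) = generalizedGaussianReal γ

/-- The conditional law of the response, `x ↦ (1 - ε) N(xᵀβ, σ²) + ε Q_x`. -/
noncomputable def responseKernel {p : ℕ} (β : EuclideanSpace ℝ (Fin p)) (σ ε : ℝ)
    (Q : Kernel (EuclideanSpace ℝ (Fin p)) ℝ) : Kernel (EuclideanSpace ℝ (Fin p)) ℝ where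
  toFun x := ENNReal.ofReal (1 - ε) • gaussianReal (inner ℝ x β) (Real.toNNReal (σ ^ 2))
    + ENNReal.ofReal ε • Q x
  measurable' := by
    have hg : Measurable fun x : EuclideanSpace ℝ (Fin p) =>
        gaussianReal (inner ℝ x β) (Real.toNNReal (σ ^ 2)) :=
      measurable_gaussianReal.comp
        (f := fun x : EuclideanSpace ℝ (Fin p) => (inner ℝ x β, Real.toNNReal (σ ^ 2)))
        (by fun_prop)
    refine Measure.measurable_of_measurable_coe _ fun s hs => ?_
    simp only [Measure.coe_add, Measure.coe_smul, Pi.add_apply, Pi.smul_apply, smul_eq_mul]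
    exact (((Measure.measurable_coe hs).comp hg).const_mul _).add
      ((Q.measurable_coe hs).const_mul _)

/-- The mixture is a genuine conditional distribution, so that `⊗ₘ` below is the usual
composition-product. -/
theorem isMarkovKernel_responseKernel {p : ℕ} (β : EuclideanSpace ℝ (Fin p)) (σ : ℝ) {ε : ℝ}
    (h0 : 0 ≤ ε) (h1 : ε ≤ 1) (Q : Kernel (EuclideanSpace ℝ (Fin p)) ℝ) [IsMarkovKernel Q] :
    IsMarkovKernel (responseKernel β σ ε Q) := by
  refine ⟨fun x => ⟨?_⟩⟩
  change (ENNReal.ofReal (1 - ε) • gaussianReal (inner ℝ x β) (Real.toNNReal (σ ^ 2))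
    + ENNReal.ofReal ε • Q x) Set.univ = 1
  simp only [Measure.coe_add, Measure.coe_smul, Pi.add_apply, Pi.smul_apply, smul_eq_mul,
    measure_univ, mul_one]
  rw [← ENNReal.ofReal_add (by linarith) h0]
  simp

/-- The law of the data `(X_i, y_i)`, `i = 1, …, n`, under adaptive contamination of the responses:
the pairs are i.i.d. with `X_i ∼ μ` and `y_i ∣ X_i ∼ (1 - ε) N(X_iᵀβ, σ²) + ε Q_{X_i}`. -/
noncomputable def adaptiveModel {p : ℕ} (n : ℕ) (μ : Measure (EuclideanSpace ℝ (Fin p)))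
    (β : EuclideanSpace ℝ (Fin p)) (σ ε : ℝ) (Q : Kernel (EuclideanSpace ℝ (Fin p)) ℝ) :
    Measure (Fin n → EuclideanSpace ℝ (Fin p) × ℝ) :=
  Measure.pi fun _ => μ ⊗ₘ responseKernel β σ ε Q

/-- The set of `(x, y)` with `vᵀx (y - xᵀb) ≥ 0` and `|vᵀx| ≥ t`. -/
def depthEvent {p : ℕ} (v b : EuclideanSpace ℝ (Fin p)) (t : ℝ) :
    Set (EuclideanSpace ℝ (Fin p) × ℝ) :=
  {z | 0 ≤ inner ℝ v z.1 * (z.2 - inner ℝ z.1 b) ∧ t ≤ |inner ℝ v z.1|}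

/-- The empirical truncated regression depth
`inf_{‖v‖ = 1} (1/n) ∑ᵢ 1{vᵀX_i (y_i - X_iᵀb) ≥ 0, |vᵀX_i| ≥ t}` of `b`. -/
noncomputable def truncatedDepth {p n : ℕ} (d : Fin n → EuclideanSpace ℝ (Fin p) × ℝ) (t : ℝ)
    (b : EuclideanSpace ℝ (Fin p)) : ℝ :=
  ⨅ v : Metric.sphere (0 : EuclideanSpace ℝ (Fin p)) 1,
    (1 / (n : ℝ)) * ∑ i, (depthEvent (v : EuclideanSpace ℝ (Fin p)) b t).indicator 1 (d i)

/-- `b` maximizes the empirical truncated depth over `ℝᵖ`. -/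
def IsTruncatedDepthEstimate {p n : ℕ} (d : Fin n → EuclideanSpace ℝ (Fin p) × ℝ) (t : ℝ)
    (b : EuclideanSpace ℝ (Fin p)) : Prop :=
  ∀ b' : EuclideanSpace ℝ (Fin p), truncatedDepth d t b' ≤ truncatedDepth d t b

/-- The truncation level `t = (log (n ε² / p + e) / 3) ^ (1 / γ)`. -/
noncomputable def truncationLevel (γ : ℝ) (p n : ℕ) (ε : ℝ) : ℝ :=
  (Real.log ((n : ℝ) * ε ^ 2 / (p : ℝ) + Real.exp 1) / 3) ^ (1 / γ)

/-- The rate `σ (√(p / n) + ε / (log (n ε² / p + e)) ^ (1 / γ))`. -/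
noncomputable def errorRate (γ : ℝ) (p n : ℕ) (σ ε : ℝ) : ℝ :=
  σ * (Real.sqrt ((p : ℝ) / (n : ℝ)) +
    ε / Real.log ((n : ℝ) * ε ^ 2 / (p : ℝ) + Real.exp 1) ^ (1 / γ))

end RobustRegression

/-! Write ρ = √(p/n) and ℓ = log(nε²/p + e), so that t = (ℓ/3)^(1/γ).

Upper bound. On either side of the hyperplane vᵀx = 0, the truncated depth event is an intersection
of two half-spaces in a lifted space. Its empirical frequencies therefore deviate from their
probabilities by O(ρ), uniformly in v and without a logarithm (`measure_exists_deviation_le`: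
symmetrization, then chaining with Dudley's entropy bound). Let h be the probability that vᵀX ≥ t,
the same for every unit v. At the truth β each side has mass at least (1 - ε)h/2. At β + θv a
residual on that side must exceed θt, so the mass drops to about ((1 - ε)(1/2 - cθt/σ) + ε)h. The
contamination acts conditionally on x, so it costs ε relative to h, while truncation raises the
signal from θ/σ to θt/σ; this is the logarithmic gain. The price is that ρ must be small compared
with the tail h. This holds because h ≥ c·exp(-ℓ/2) and ρ ≤ (ε + 2ρ)exp(-ℓ/2). The gap is then
positive once θt/σ exceeds a large multiple of ρ + ε, which a θ of the order of the rate ensures;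
`norm_sub_le_of_empiricalFreq_bounds` turns the gap into an error bound.

Lower bound. When |xᵀβ| ≤ εσ/4 the contamination can give the response a fixed reference law, a
normal density tilted by exp(ε|y|/(4σ)). For larger means it acts as if the mean were clamped, and
the conditional second moment of the likelihood ratio is at most exp((excess/σ)²)
(`lintegral_contaminatedPDF_sq_div_le`). If ‖β‖ is at most a small multiple κ of the rate, the
squared excess has mean O(κ²p/n): either it comes from the ρ part of the rate, or |vᵀx| is so far in
the tail that exp(|vᵀx|^γ/4) ≥ exp(ℓ) ≥ ε²/ρ² (`clampMean_excess_sq_le`). Summed over the sample,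
the excess is at most p with probability 3/4. Testing between 48^p separated parameters then fails
(`exists_pi_withDensity_le_half`). The second moment is truncated because the expectation of the
exponential of the squared excess need not be finite. -/

namespace RobustRegression

/-! ### Growth functions of half-spaces and packing numbers -/

open Finset in
theorem sum_choose_Iic_le (d m : ℕ) {θ : ℝ} (h0 : 0 < θ) (h1 : θ ≤ 1) :
    ((∑ k ∈ Iic d, m.choose k : ℕ) : ℝ) ≤ θ⁻¹ ^ d * Real.exp (θ * m) := by
  have hθ : 0 < θ ^ d := by positivity
  rw [inv_pow, inv_mul_eq_div, le_div_iff₀ hθ]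
  push_cast
  -- Since θ ≤ 1, θ^d ≤ θ^k for k ≤ d, and the weighted sum is part of a binomial expansion. Keeping
  -- θ free, rather than optimizing it, avoids distinguishing m ≤ d from m > d.
  calc (∑ k ∈ Iic d, (m.choose k : ℝ)) * θ ^ d
      ≤ ∑ k ∈ Iic d, (m.choose k : ℝ) * θ ^ k := by
        rw [sum_mul]
        refine sum_le_sum fun k hk => ?_
        exact mul_le_mul_of_nonneg_left (pow_le_pow_of_le_one h0.le h1 (mem_Iic.1 hk))
          (by positivity)
    _ ≤ ∑ k ∈ range (m + 1), (m.choose k : ℝ) * θ ^ k := by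
        have : ∑ k ∈ Iic d, (m.choose k : ℝ) * θ ^ k
            = ∑ k ∈ (Iic d).filter (fun k => k < m + 1), (m.choose k : ℝ) * θ ^ k := by
          refine (sum_filter_of_ne fun k _ hne => ?_).symm
          by_contra hlt
          exact hne (by rw [Nat.choose_eq_zero_of_lt (by omega)]; simp)
        rw [this]
        refine sum_le_sum_of_subset_of_nonneg (fun k hk => ?_) fun _ _ _ => by positivity
        simp only [mem_filter] at hk
        exact mem_range.2 hk.2
    _ = (θ + 1) ^ m := by
        rw [add_pow]
        exact sum_congr rfl fun k _ => by simp; ring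
    _ ≤ Real.exp θ ^ m := pow_le_pow_left₀ (by positivity) (Real.add_one_le_exp θ) m
    _ = Real.exp (θ * m) := by rw [mul_comm, Real.exp_nat_mul]

/-- A family of traces of linear half-spaces on finitely many vectors cannot shatter more points
than the dimension. -/
theorem vcDim_halfspace_le {V α : Type*} [AddCommGroup V] [Module ℝ V] [Module.Finite ℝ V]
    [DecidableEq α] (a : α → V) (𝒜 : Finset (Finset α))
    (h𝒜 : ∀ A ∈ 𝒜, ∃ f : Module.Dual ℝ V, ∀ i, i ∈ A ↔ 0 ≤ f (a i)) :
    𝒜.vcDim ≤ Module.finrank ℝ V := by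
  refine Finset.sup_le fun s hs => ?_
  rw [Finset.mem_shatterer] at hs
  by_contra hlt
  have hli : ¬ LinearIndependent ℝ (fun i : s => a i) := fun h => by
    have := h.fintype_card_le_finrank
    simp only [Fintype.card_coe] at this
    omega
  -- The dependence needs a negative coefficient: the half-spaces are closed, so `f` has a strict
  -- sign only where it is negative.
  obtain ⟨g, hg, hne⟩ : ∃ g : s → ℝ, ∑ i, g i • a i = 0 ∧ ∃ i, g i < 0 := by
    obtain ⟨g, hg, i, hi⟩ := Fintype.not_linearIndependent_iff.1 hli
    rcases lt_or_gt_of_ne hi with h | h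
    · exact ⟨g, hg, i, h⟩
    · exact ⟨fun i => -g i, by simpa only [neg_smul, Finset.sum_neg_distrib, neg_eq_zero] using hg, i,
        by simpa using h⟩
  obtain ⟨i₀, hi₀⟩ := hne
  -- A half-space cutting out the nonnegative coefficients makes every term of `∑ g i * f (a i) = 0`
  -- nonnegative, and the term at `i₀` positive.
  obtain ⟨A, hA, hAs⟩ := hs (t := s.filter fun i => ∃ h : i ∈ s, 0 ≤ g ⟨i, h⟩)
    (Finset.filter_subset _ _)
  obtain ⟨f, hf⟩ := h𝒜 A hA
  have hmem : ∀ i : s, 0 ≤ f (a i) ↔ 0 ≤ g i := fun i => by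
    rw [← hf]
    have : (i : α) ∈ s ∩ A ↔ (i : α) ∈ s.filter fun i => ∃ h : i ∈ s, 0 ≤ g ⟨i, h⟩ := by rw [hAs]
    simpa using this
  have hsum : ∑ i, g i * f (a i) = 0 := by
    have := congrArg f hg
    simpa using this
  have hnn : ∀ i ∈ Finset.univ, 0 ≤ g i * f (a i) := fun i _ => by
    rcases le_or_gt 0 (g i) with h | h
    · exact mul_nonneg h ((hmem i).2 h)
    · exact mul_nonneg_of_nonpos_of_nonpos h.le
        (le_of_lt (not_le.1 fun h' => absurd ((hmem i).1 h') (not_le.2 h)))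
  have hzero := (Finset.sum_eq_zero_iff_of_nonneg hnn).1 hsum i₀ (Finset.mem_univ _)
  have : f (a i₀) < 0 := not_le.1 fun h' => absurd ((hmem i₀).1 h') (not_le.2 hi₀)
  nlinarith

theorem card_halfspace_trace_le {V : Type*} [AddCommGroup V] [Module ℝ V]
    [Module.Finite ℝ V] {m : ℕ} (a : Fin m → V) (𝒜 : Finset (Finset (Fin m)))
    (h𝒜 : ∀ A ∈ 𝒜, ∃ f : Module.Dual ℝ V, ∀ i, i ∈ A ↔ 0 ≤ f (a i)) :
    𝒜.card ≤ ∑ k ∈ Finset.Iic (Module.finrank ℝ V), m.choose k := by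
  refine (Finset.card_le_card_shatterer 𝒜).trans (Finset.card_shatterer_le_sum_vcDim.trans ?_)
  rw [Fintype.card_fin]
  exact Finset.sum_le_sum_of_subset (Finset.Iic_subset_Iic.2 (vcDim_halfspace_le a 𝒜 h𝒜))

/-- `𝒮` has the growth function of intersections of two classes of Vapnik-Chervonenkis
dimension `D`, also after resampling its points. -/
def HasQuadraticGrowth {n : ℕ} (D : ℕ) (𝒮 : Finset (Finset (Fin n))) : Prop :=
  ∀ (m : ℕ) (ω : Fin m → Fin n),
    (𝒮.image fun A => Finset.univ.filter fun l => ω l ∈ A).card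
      ≤ (∑ k ∈ Finset.Iic D, m.choose k) ^ 2

-- A trace of an intersection is the intersection of one trace from each class, so the Sauer-Shelah
-- bounds multiply.
open Finset in
theorem hasQuadraticGrowth_of_halfspaces {V W : Type*} [AddCommGroup V] [Module ℝ V]
    [Module.Finite ℝ V] [AddCommGroup W] [Module ℝ W] [Module.Finite ℝ W] {n D : ℕ}
    (hV : Module.finrank ℝ V ≤ D) (hW : Module.finrank ℝ W ≤ D)
    (a : Fin n → V) (b : Fin n → W) (𝒮 : Finset (Finset (Fin n)))
    (h𝒮 : ∀ A ∈ 𝒮, ∃ (f : Module.Dual ℝ V) (g : Module.Dual ℝ W),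
      ∀ i, i ∈ A ↔ 0 ≤ f (a i) ∧ 0 ≤ g (b i)) :
    HasQuadraticGrowth D 𝒮 := by
  classical
  intro m ω
  let ℬ : Finset (Finset (Fin m)) :=
    univ.filter fun B => ∃ f : Module.Dual ℝ V, ∀ l, l ∈ B ↔ 0 ≤ f (a (ω l))
  let 𝒞 : Finset (Finset (Fin m)) :=
    univ.filter fun B => ∃ f : Module.Dual ℝ W, ∀ l, l ∈ B ↔ 0 ≤ f (b (ω l))
  have hℬ : ℬ.card ≤ ∑ k ∈ Iic D, m.choose k :=
    (card_halfspace_trace_le (a ∘ ω) ℬ fun A hA => (mem_filter.1 hA).2).trans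
      (sum_le_sum_of_subset (Iic_subset_Iic.2 hV))
  have h𝒞 : 𝒞.card ≤ ∑ k ∈ Iic D, m.choose k :=
    (card_halfspace_trace_le (b ∘ ω) 𝒞 fun A hA => (mem_filter.1 hA).2).trans
      (sum_le_sum_of_subset (Iic_subset_Iic.2 hW))
  have hsub : (𝒮.image fun A => univ.filter fun l => ω l ∈ A) ⊆ image₂ (· ∩ ·) ℬ 𝒞 := by
    intro B hB
    obtain ⟨A, hA, rfl⟩ := mem_image.1 hB
    obtain ⟨f, g, hfg⟩ := h𝒮 A hA
    refine mem_image₂.2 ⟨univ.filter fun l => 0 ≤ f (a (ω l)), ?_,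
      univ.filter fun l => 0 ≤ g (b (ω l)), ?_, ?_⟩
    · exact mem_filter.2 ⟨mem_univ _, f, fun l => by simp⟩
    · exact mem_filter.2 ⟨mem_univ _, g, fun l => by simp⟩
    · ext l
      simp [hfg]
  calc _ ≤ _ := card_le_card hsub
    _ ≤ ℬ.card * 𝒞.card := card_image₂_le _ _ _
    _ ≤ _ := by rw [sq]; exact Nat.mul_le_mul hℬ h𝒞

open Finset in
/-- Dudley's bound on the packing numbers of a class of polynomial growth. -/
theorem log_card_le_of_separated {n D : ℕ} {𝒮 : Finset (Finset (Fin n))}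
    (h𝒮 : HasQuadraticGrowth D 𝒮) {η : ℝ} (h0 : 0 < η) (h1 : η ≤ 1) {T : Finset (Finset (Fin n))}
    (hT : T ⊆ 𝒮) (hsep : ∀ A ∈ T, ∀ B ∈ T, A ≠ B → η * n < (symmDiff A B).card) :
    Real.log T.card ≤ 4 * D * Real.log (8 / η) + 1 := by
  have hlog : 0 ≤ Real.log (8 / η) := Real.log_nonneg (by rw [le_div_iff₀ h0]; linarith)
  rcases Nat.lt_or_ge T.card 2 with hlt | hN
  · have : Real.log T.card = 0 := by interval_cases T.card <;> simp
    rw [this]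
    positivity
  set N : ℕ := T.card with hNdef
  set ℓ := Real.log N with hℓ
  have hNpos : (0 : ℝ) < N := by positivity
  have hℓ0 : 0 ≤ ℓ := Real.log_nonneg (by exact_mod_cast (by omega : 1 ≤ N))
  have hexpℓ : Real.exp ℓ = N := Real.exp_log hNpos
  -- A random index falls outside a given symmetric difference with probability at most exp(-η).
  -- With ηm ≥ 2 log N, all m draws do so with probability at most N⁻², and there are only N² - N
  -- ordered pairs.
  set m := ⌈2 * ℓ / η⌉₊ with hm
  have hm1 : 2 * ℓ ≤ η * m := by
    have := Nat.le_ceil (2 * ℓ / η)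
    rw [div_le_iff₀ h0] at this
    linarith
  have hm2 : η * m ≤ 2 * ℓ + η := by
    have := (Nat.ceil_lt_add_one (a := 2 * ℓ / η) (by positivity)).le
    have h2 := mul_le_mul_of_nonneg_left this h0.le
    calc η * m ≤ η * (2 * ℓ / η + 1) := h2
      _ = _ := by field_simp
  obtain ⟨A₀, hA₀, B₀, hB₀, hne₀⟩ := one_lt_card.1 hN
  have hn : 0 < n := by
    rcases Nat.eq_zero_or_pos n with rfl | h
    · exact absurd (Subsingleton.elim A₀ B₀) hne₀
    · exact h
  -- some choice of `m` indices separates all the members of `T`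
  obtain ⟨ω, hω⟩ : ∃ ω : Fin m → Fin n, ∀ A ∈ T, ∀ B ∈ T, A ≠ B → ∃ l, ω l ∈ symmDiff A B := by
    by_contra hcon
    push Not at hcon
    have hcover : (univ : Finset (Fin m → Fin n)) ⊆ T.offDiag.biUnion fun q =>
        Fintype.piFinset fun _ : Fin m => (symmDiff q.1 q.2)ᶜ := by
      intro ω _
      obtain ⟨A, hA, B, hB, hne, hl⟩ := hcon ω
      refine mem_biUnion.2 ⟨(A, B), mem_offDiag.2 ⟨hA, hB, hne⟩, ?_⟩
      exact Fintype.mem_piFinset.2 fun l => mem_compl.2 (hl l)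
    have hcard := (card_le_card hcover).trans card_biUnion_le
    -- The union bound in counting form: at most n^m / N² index maps miss a given pair.
    have hterm : ∀ q ∈ T.offDiag, ((Fintype.piFinset fun _ : Fin m =>
        (symmDiff q.1 q.2)ᶜ).card : ℝ) ≤ (n : ℝ) ^ m / (N : ℝ) ^ 2 := by
      intro q hq
      obtain ⟨hA, hB, hne⟩ := mem_offDiag.1 hq
      have hq := hsep _ hA _ hB hne
      rw [Fintype.card_piFinset, prod_const, card_univ, Fintype.card_fin, Nat.cast_pow,
        card_compl, Fintype.card_fin, Nat.cast_sub (by simpa using card_le_univ (symmDiff q.1 q.2))]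
      have hle : (n : ℝ) - (symmDiff q.1 q.2).card ≤ n * Real.exp (-η) := by
        have := Real.add_one_le_exp (-η)
        have := mul_le_mul_of_nonneg_left this (Nat.cast_nonneg (α := ℝ) n)
        linarith
      have hnn : (0 : ℝ) ≤ n - (symmDiff q.1 q.2).card := by
        rw [sub_nonneg]
        exact_mod_cast (by simpa using card_le_univ (symmDiff q.1 q.2))
      refine (pow_le_pow_left₀ hnn hle m).trans ?_
      rw [mul_pow, div_eq_mul_inv]
      refine mul_le_mul_of_nonneg_left ?_ (by positivity)
      rw [← Real.exp_nat_mul, ← hexpℓ, ← Real.exp_nat_mul, ← Real.exp_neg]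
      refine Real.exp_le_exp.2 ?_
      push_cast
      linarith
    have hreal : (n : ℝ) ^ m ≤ ((N : ℝ) * N - N) * ((n : ℝ) ^ m / (N : ℝ) ^ 2) := by
      have h2 : (((univ : Finset (Fin m → Fin n)).card : ℕ) : ℝ) ≤
          ∑ q ∈ T.offDiag, ((Fintype.piFinset fun _ : Fin m => (symmDiff q.1 q.2)ᶜ).card : ℝ) := by
        exact_mod_cast hcard
      have h3 := h2.trans (sum_le_sum hterm)
      rw [sum_const, nsmul_eq_mul, offDiag_card, Nat.cast_sub (Nat.le_mul_self _)] at h3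
      simpa using h3
    have : ((N : ℝ) * N - N) * ((n : ℝ) ^ m / (N : ℝ) ^ 2) = (n : ℝ) ^ m - (n : ℝ) ^ m / N := by
      field_simp
    rw [this] at hreal
    have : 0 < (n : ℝ) ^ m / N := by positivity
    linarith
  have hinj : Set.InjOn (fun A : Finset (Fin n) => (univ : Finset (Fin m)).filter fun l => ω l ∈ A)
      T := by
    intro A hA B hB hAB
    by_contra hne
    obtain ⟨l, hl⟩ := hω A hA B hB hne
    have := congrArg (l ∈ ·) hAB
    simp only [mem_filter, mem_univ, true_and, eq_iff_iff] at this
    rw [mem_symmDiff] at hl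
    tauto
  have hcount : N ≤ (∑ k ∈ Iic D, m.choose k) ^ 2 := by
    rw [hNdef, ← card_image_of_injOn hinj]
    exact (card_le_card (image_subset_image hT)).trans (h𝒮 m ω)
  -- With θ = η/8 the squared growth bound contributes ηm/4 ≤ ℓ/2 + η/4 to the logarithm, so half of
  -- `ℓ` is absorbed on the left.
  have hθ0 : 0 < η / 8 := by positivity
  have hcr : (N : ℝ) ≤ ((8 / η) ^ D * Real.exp (η / 8 * m)) ^ 2 := by
    have h3 := sum_choose_Iic_le D m hθ0 (by linarith)
    rw [inv_div] at h3
    calc (N : ℝ) ≤ ((∑ k ∈ Iic D, m.choose k : ℕ) : ℝ) ^ 2 := by exact_mod_cast hcount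
      _ ≤ _ := pow_le_pow_left₀ (by positivity) h3 2
  have hfin := Real.log_le_log hNpos hcr
  rw [Real.log_pow, Real.log_mul (by positivity) (by positivity), Real.log_pow, Real.log_exp]
    at hfin
  push_cast at hfin
  rw [← hℓ] at hfin
  nlinarith

/-! ### Rademacher sums and chaining -/

/-- The sign encoded by a boolean. -/
def boolSign (b : Bool) : ℝ := if b then 1 else -1

theorem sum_exp_boolSign_le {n : ℕ} (a : Fin n → ℝ) (c : ℝ) :
    ∑ s : Fin n → Bool, Real.exp (c * ∑ i, boolSign (s i) * a i)
      ≤ 2 ^ n * Real.exp (c ^ 2 * (∑ i, a i ^ 2) / 2) := by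
  have h1 : ∀ s : Fin n → Bool, Real.exp (c * ∑ i, boolSign (s i) * a i)
      = ∏ i, Real.exp (c * (boolSign (s i) * a i)) := fun s => by
    rw [Finset.mul_sum, Real.exp_sum]
  have h2 := Finset.prod_univ_sum (fun _ : Fin n => (Finset.univ : Finset Bool))
    (fun i b => Real.exp (c * (boolSign b * a i)))
  rw [Fintype.piFinset_univ] at h2
  simp_rw [h1]
  rw [← h2]
  calc ∏ i, ∑ b, Real.exp (c * (boolSign b * a i))
      ≤ ∏ i, (2 * Real.exp ((c * a i) ^ 2 / 2)) := by
        refine Finset.prod_le_prod (fun i _ => by positivity) fun i _ => ?_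
        have := Real.cosh_le_exp_half_sq (c * a i)
        rw [Real.cosh_eq] at this
        simp only [Fintype.sum_bool, boolSign]
        simp only [if_true, one_mul, Bool.false_eq_true, if_false, neg_one_mul, mul_neg]
        linarith
    _ = _ := by
        rw [Finset.prod_mul_distrib, Finset.prod_const, Finset.card_univ, Fintype.card_fin,
          ← Real.exp_sum]
        congr 2
        rw [Finset.mul_sum, Finset.sum_div]
        exact Finset.sum_congr rfl fun i _ => by ring

/-- Maximal inequality for finitely many Rademacher sums. -/
theorem exists_rademacher_max_le {n : ℕ} (T : Finset (Fin n → ℝ)) (hT : T.Nonempty) {V c : ℝ}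
    (hV : ∀ a ∈ T, ∑ i, a i ^ 2 ≤ V) (hc : 0 < c) :
    ∃ F : (Fin n → Bool) → ℝ, (∀ s, ∀ a ∈ T, |∑ i, boolSign (s i) * a i| ≤ F s) ∧
      ∑ s, F s ≤ 2 ^ n * (Real.log (2 * T.card) / c + c * V / 2) := by
  have hTc : (0 : ℝ) < 2 * T.card := by
    have := hT.card_pos
    positivity
  -- The average over signs of the sum of all the exponentials is at most exp(d). The tangent
  -- inequality 1 + x ≤ exp(x) at x = c|Z| - d then replaces Jensen's inequality and gives an
  -- explicit majorant in place of a maximum.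
  set d := Real.log (2 * T.card) + c ^ 2 * V / 2 with hd
  let Z : (Fin n → Bool) → (Fin n → ℝ) → ℝ := fun s a => ∑ i, boolSign (s i) * a i
  refine ⟨fun s => (d - 1 + Real.exp (-d) *
    ∑ a ∈ T, (Real.exp (c * Z s a) + Real.exp (-c * Z s a))) / c, fun s a ha => ?_, ?_⟩
  · rw [le_div_iff₀ hc]
    have hle : Real.exp (c * |Z s a|)
        ≤ ∑ a ∈ T, (Real.exp (c * Z s a) + Real.exp (-c * Z s a)) := by
      refine le_trans ?_ (Finset.single_le_sum
        (f := fun a => Real.exp (c * Z s a) + Real.exp (-c * Z s a))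
        (fun _ _ => by positivity) ha)
      have h1 := Real.exp_pos (c * Z s a)
      have h2 := Real.exp_pos (-c * Z s a)
      rcases abs_cases (Z s a) with ⟨h, _⟩ | ⟨h, _⟩
      · rw [h]; linarith
      · rw [h, mul_neg, ← neg_mul]; linarith
    have hexp := Real.add_one_le_exp (c * |Z s a| - d)
    rw [sub_eq_add_neg, Real.exp_add, mul_comm (Real.exp _)] at hexp
    have := mul_le_mul_of_nonneg_left hle (Real.exp_pos (-d)).le
    change |Z s a| * c ≤ _
    linarith
  · have hsum : ∑ s, ∑ a ∈ T, (Real.exp (c * Z s a) + Real.exp (-c * Z s a))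
        ≤ 2 ^ n * Real.exp d := by
      rw [Finset.sum_comm]
      calc _ ≤ ∑ a ∈ T, 2 * (2 ^ n * Real.exp (c ^ 2 * V / 2)) := by
            refine Finset.sum_le_sum fun a ha => ?_
            rw [Finset.sum_add_distrib, two_mul]
            have hmono : (2 : ℝ) ^ n * Real.exp (c ^ 2 * (∑ i, a i ^ 2) / 2)
                ≤ 2 ^ n * Real.exp (c ^ 2 * V / 2) := by
              gcongr
              exact hV a ha
            refine add_le_add ((sum_exp_boolSign_le a c).trans hmono)
              ((sum_exp_boolSign_le a (-c)).trans ?_)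
            rwa [neg_sq]
        _ = _ := by
            rw [Finset.sum_const, nsmul_eq_mul, hd, Real.exp_add, Real.exp_log hTc]
            ring
    rw [← Finset.sum_div, Finset.sum_add_distrib, ← Finset.mul_sum, Finset.sum_const,
      Finset.card_univ, Fintype.card_pi_const, Fintype.card_bool, nsmul_eq_mul, div_le_iff₀ hc]
    have := mul_le_mul_of_nonneg_left hsum (Real.exp_pos (-d)).le
    have he : Real.exp (-d) * (2 ^ n * Real.exp d) = 2 ^ n := by
      rw [mul_left_comm, ← Real.exp_add]; simp
    rw [he] at this
    push_cast
    have hrhs : 2 ^ n * (Real.log (2 * T.card) / c + c * V / 2) * c = 2 ^ n * d := by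
      rw [hd]; field_simp
    rw [hrhs]
    linarith

-- A separated subfamily of maximal cardinality is a net: a set far from all its members could be
-- added to it.
open Finset in
theorem exists_net {n D : ℕ} {𝒮 : Finset (Finset (Fin n))} (h𝒮 : HasQuadraticGrowth D 𝒮)
    {η : ℝ} (h0 : 0 < η) (h1 : η ≤ 1) :
    ∃ R ⊆ 𝒮, Real.log R.card ≤ 4 * D * Real.log (8 / η) + 1 ∧
      ∀ A ∈ 𝒮, ∃ B ∈ R, ((symmDiff A B).card : ℝ) ≤ η * n := by
  classical
  let 𝒯 : Finset (Finset (Finset (Fin n))) := 𝒮.powerset.filter fun T =>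
    ∀ A ∈ T, ∀ B ∈ T, A ≠ B → η * n < (symmDiff A B).card
  have hne : 𝒯.Nonempty := ⟨∅, by simp [𝒯]⟩
  obtain ⟨R, hR, hmax⟩ := exists_max_image 𝒯 card hne
  obtain ⟨hR𝒮, hsep⟩ := mem_filter.1 hR
  rw [mem_powerset] at hR𝒮
  refine ⟨R, hR𝒮, log_card_le_of_separated h𝒮 h0 h1 hR𝒮 hsep, fun A hA => ?_⟩
  by_contra hcon
  push Not at hcon
  have hAR : A ∉ R := fun h => by
    have := hcon A h
    rw [symmDiff_self] at this
    simp only [bot_eq_empty, card_empty, Nat.cast_zero] at this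
    have : 0 ≤ η * n := by positivity
    linarith
  have hins : insert A R ∈ 𝒯 := by
    refine mem_filter.2 ⟨mem_powerset.2 (insert_subset hA hR𝒮), fun B hB C hC hBC => ?_⟩
    rcases mem_insert.1 hB with rfl | hB' <;> rcases mem_insert.1 hC with rfl | hC'
    · exact absurd rfl hBC
    · exact hcon C hC'
    · rw [symmDiff_comm]; exact hcon B hB'
    · exact hsep B hB' C hC' hBC
  have := hmax _ hins
  rw [card_insert_of_notMem hAR] at this
  omega

theorem log_eight_div_quarter_pow (k : ℕ) :
    Real.log (8 / (1 / 4) ^ k) ≤ (3 + 2 * k) * 0.694 := by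
  have h : (8 : ℝ) / (1 / 4) ^ k = 2 ^ (3 + 2 * k) := by
    rw [pow_add, pow_mul, one_div, inv_pow, div_inv_eq_mul]; norm_num
  rw [h, Real.log_pow]
  push_cast
  have := Real.log_two_lt_d9
  gcongr
  linarith

open Finset in
/-- Chaining bound for the Rademacher process indexed by a class of sets of polynomial growth. -/
theorem exists_rademacher_chaining {n D : ℕ} (hn : 0 < n) (hD : 0 < D)
    {𝒮 : Finset (Finset (Fin n))} (hne : 𝒮.Nonempty) (h𝒮 : HasQuadraticGrowth D 𝒮) :
    ∃ F : (Fin n → Bool) → ℝ, (∀ s, ∀ A ∈ 𝒮, |∑ i ∈ A, boolSign (s i)| ≤ F s) ∧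
      ∑ s, F s ≤ 2 ^ n * (63 * Real.sqrt (n * D)) := by
  classical
  have hη : ∀ k : ℕ, (0 : ℝ) < (1 / 4) ^ k ∧ ((1 : ℝ) / 4) ^ k ≤ 1 := fun k =>
    ⟨by positivity, pow_le_one₀ (by norm_num) (by norm_num)⟩
  choose R hR𝒮 hRlog hRnet using fun k : ℕ => exists_net h𝒮 (hη k).1 (hη k).2
  have hπ : ∀ k A, ∃ B, A ∈ 𝒮 → B ∈ R k ∧ ((symmDiff A B).card : ℝ) ≤ (1 / 4) ^ k * n := by
    intro k A
    by_cases hA : A ∈ 𝒮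
    · obtain ⟨B, hB⟩ := hRnet k A hA
      exact ⟨B, fun _ => hB⟩
    · exact ⟨∅, fun h => absurd h hA⟩
  choose π hπ using hπ
  have hRne : ∀ k, (R k).Nonempty := fun k => by
    obtain ⟨A, hA⟩ := hne
    exact ⟨_, (hπ k A hA).1⟩
  let ind : Finset (Fin n) → Fin n → ℝ := fun A i => if i ∈ A then 1 else 0
  have hind : ∀ (s : Fin n → Bool) (A : Finset (Fin n)),
      ∑ i, boolSign (s i) * ind A i = ∑ i ∈ A, boolSign (s i) := fun s A => by
    simp [ind]
  have hD1 : (1 : ℝ) ≤ D := by exact_mod_cast hD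
  set q := Real.sqrt (n * D) with hq
  have hqpos : 0 < q := Real.sqrt_pos.2 (by positivity)
  have hqq : q * q = n * D := Real.mul_self_sqrt (by positivity)
  have hlog2 := Real.log_two_lt_d9
  have hlogR : ∀ k, Real.log (R k).card ≤ D * (4 * ((3 + 2 * k) * 0.694) + 1) := fun k => by
    refine (hRlog k).trans ?_
    have := mul_le_mul_of_nonneg_left (log_eight_div_quarter_pow k)
      (by positivity : (0 : ℝ) ≤ 4 * D)
    nlinarith
  -- The constant telescopes: 17(k+3)/2^k - 17(k+4)/2^(k+1) = 17(k+2)/2^(k+1), which is the cost of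
  -- the link from level k to level k + 1. Level 0 has 63 - 51 = 12 available and needs 11.5.
  have key : ∀ K : ℕ, ∃ F : (Fin n → Bool) → ℝ,
      (∀ s, ∀ A ∈ 𝒮, |∑ i ∈ π K A, boolSign (s i)| ≤ F s) ∧
      ∑ s, F s ≤ 2 ^ n * (q * (63 - 17 * (K + 3) / 2 ^ K)) := by
    intro K
    induction K with
    | zero =>
      have hc : 0 < q / n := by positivity
      obtain ⟨F, hF, hsum⟩ := exists_rademacher_max_le ((R 0).image ind) ((hRne 0).image ind)
        (V := n) (c := q / n) (fun a ha => by
          obtain ⟨A, _, rfl⟩ := mem_image.1 ha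
          calc ∑ i, ind A i ^ 2 ≤ ∑ i : Fin n, (1 : ℝ) :=
                sum_le_sum fun i _ => by simp only [ind]; split_ifs <;> norm_num
            _ = n := by simp) hc
      refine ⟨F, fun s A hA => ?_, hsum.trans ?_⟩
      · rw [← hind]
        exact hF s _ (mem_image_of_mem _ (hπ 0 A hA).1)
      · refine mul_le_mul_of_nonneg_left ?_ (by positivity)
        have hcard : (0 : ℝ) < ((R 0).image ind).card := by
          exact_mod_cast ((hRne 0).image ind).card_pos
        have h1 : Real.log (2 * ((R 0).image ind).card) ≤ 11 * D := by
          rw [Real.log_mul (by norm_num) hcard.ne']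
          have h2 : Real.log ((R 0).image ind).card ≤ Real.log (R 0).card :=
            Real.log_le_log hcard (by exact_mod_cast card_image_le)
          have h3 := hlogR 0
          norm_num at h3
          linarith
        have h2 : Real.log (2 * ((R 0).image ind).card) / (q / n) ≤ 11 * q := by
          rw [div_le_iff₀ hc]
          calc _ ≤ 11 * (D : ℝ) := h1
            _ = 11 * (q * q) / n := by rw [hqq]; field_simp
            _ = _ := by ring
        have h3 : q / n * n / 2 = q / 2 := by field_simp
        rw [h3]
        norm_num
        linarith
    | succ k ih =>
      obtain ⟨F, hF, hsum⟩ := ih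
      let link : Finset (Fin n) → Fin n → ℝ := fun A i => ind (π (k + 1) A) i - ind (π k A) i
      -- This parameter balances entropy against variance: as nD = q², both terms are of order
      -- q/2^(k+1), up to the factor k + 1 from the entropy. The variance factor 5 · 4^-(k+1) below
      -- is 4^-(k+1) + 4^-k, from the triangle inequality through `A`.
      have hc : 0 < 2 ^ (k + 1) * q / n := by positivity
      obtain ⟨G, hG, hGsum⟩ := exists_rademacher_max_le (𝒮.image link) (hne.image link)
        (V := 5 * (1 / 4) ^ (k + 1) * n) (c := 2 ^ (k + 1) * q / n) (fun a ha => by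
          obtain ⟨A, hA, rfl⟩ := mem_image.1 ha
          have h1 : ∑ i, link A i ^ 2 = ((symmDiff (π (k + 1) A) (π k A)).card : ℝ) := by
            rw [card_eq_sum_ones, Nat.cast_sum, ← sum_filter_add_sum_filter_not univ
              (fun i => i ∈ symmDiff (π (k + 1) A) (π k A)), filter_mem_eq_inter, univ_inter,
              sum_eq_zero (s := univ.filter _), add_zero]
            · refine sum_congr rfl fun i hi => ?_
              rw [mem_symmDiff] at hi
              simp only [link, ind]
              rcases hi with ⟨h, h'⟩ | ⟨h, h'⟩ <;> simp [h, h']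
            · intro i hi
              have hi := (mem_filter.1 hi).2
              rw [mem_symmDiff] at hi
              simp only [link, ind]
              by_cases h : i ∈ π (k + 1) A <;> by_cases h' : i ∈ π k A <;> simp_all
          have h2 : ((symmDiff (π (k + 1) A) (π k A)).card : ℝ)
              ≤ (symmDiff A (π (k + 1) A)).card + (symmDiff A (π k A)).card := by
            rw [symmDiff_comm A (π (k + 1) A)]
            exact_mod_cast (card_le_card (symmDiff_triangle _ A _)).trans (card_union_le _ _)
          have h3 := (hπ (k + 1) A hA).2
          have h4 := (hπ k A hA).2
          rw [h1]
          have h5 : ((1 : ℝ) / 4) ^ k * n = 4 * (1 / 4) ^ (k + 1) * n := by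
            rw [pow_succ]; ring
          rw [h5] at h4
          linarith) hc
      refine ⟨F + G, fun s A hA => ?_, ?_⟩
      · have h1 := hF s A hA
        have h2 := hG s _ (mem_image_of_mem link hA)
        have h3 : ∑ i, boolSign (s i) * link A i
            = ∑ i ∈ π (k + 1) A, boolSign (s i) - ∑ i ∈ π k A, boolSign (s i) := by
          simp only [link, mul_sub, sum_sub_distrib, hind]
        rw [h3] at h2
        have h4 := abs_sub_abs_le_abs_sub (∑ i ∈ π (k + 1) A, boolSign (s i))
          (∑ i ∈ π k A, boolSign (s i))
        simp only [Pi.add_apply]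
        linarith
      · simp only [Pi.add_apply, sum_add_distrib]
        have hGle : Real.log (2 * (𝒮.image link).card) / (2 ^ (k + 1) * q / n)
            + 2 ^ (k + 1) * q / n * (5 * (1 / 4) ^ (k + 1) * n) / 2
            ≤ q * (17 * (k + 2) / 2 ^ (k + 1)) := by
          have hcard : (0 : ℝ) < (𝒮.image link).card := by
            exact_mod_cast (hne.image link).card_pos
          have hcle : (𝒮.image link).card ≤ (R (k + 1)).card * (R k).card := by
            refine (card_le_card (t := image₂ (fun B C i => ind B i - ind C i)
              (R (k + 1)) (R k)) ?_).trans (card_image₂_le _ _ _)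
            intro a ha
            obtain ⟨A, hA, rfl⟩ := mem_image.1 ha
            exact mem_image₂.2 ⟨_, (hπ (k + 1) A hA).1, _, (hπ k A hA).1, rfl⟩
          have hR1 : (0 : ℝ) < (R (k + 1)).card := by exact_mod_cast (hRne _).card_pos
          have hR2 : (0 : ℝ) < (R k).card := by exact_mod_cast (hRne _).card_pos
          have h1 : Real.log (2 * (𝒮.image link).card) ≤ D * (31 + 12 * k) := by
            rw [Real.log_mul (by norm_num) hcard.ne']
            have h2 : Real.log (𝒮.image link).card
                ≤ Real.log (R (k + 1)).card + Real.log (R k).card := by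
              rw [← Real.log_mul hR1.ne' hR2.ne']
              exact Real.log_le_log hcard (by exact_mod_cast hcle)
            have h3 := hlogR k
            have h4 := hlogR (k + 1)
            push_cast at h4
            nlinarith
          have h2 : Real.log (2 * (𝒮.image link).card) / (2 ^ (k + 1) * q / n)
              ≤ q * ((31 + 12 * k) / 2 ^ (k + 1)) := by
            rw [div_le_iff₀ hc]
            calc _ ≤ D * (31 + 12 * (k : ℝ)) := h1
              _ = (q * q) / n * (31 + 12 * k) := by rw [hqq]; field_simp
              _ = _ := by field_simp
          have h3 : 2 ^ (k + 1) * q / n * (5 * (1 / 4) ^ (k + 1) * n) / 2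
              = q * ((5 / 2) / 2 ^ (k + 1)) := by
            have : ((1 : ℝ) / 4) ^ (k + 1) = 1 / (2 ^ (k + 1) * 2 ^ (k + 1)) := by
              rw [← mul_pow, one_div, inv_pow]; norm_num
            rw [this]
            field_simp
          rw [h3]
          calc _ ≤ q * ((31 + 12 * k) / 2 ^ (k + 1)) + q * ((5 / 2) / 2 ^ (k + 1)) := by
                gcongr
            _ = q * ((31 + 12 * k + 5 / 2) / 2 ^ (k + 1)) := by ring
            _ ≤ _ := by
                gcongr
                have : (0 : ℝ) ≤ k := by positivity
                linarith
        have hG2 := hGsum.trans (mul_le_mul_of_nonneg_left hGle (by positivity))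
        refine (add_le_add hsum hG2).trans (le_of_eq ?_)
        push_cast
        rw [pow_succ]
        field_simp
        ring
  obtain ⟨F, hF, hsum⟩ := key n
  refine ⟨F, fun s A hA => ?_, hsum.trans ?_⟩
  -- At level `n` the net is exact: the symmetric difference has fewer than one element, since n <
  -- 4^n.
  · have h1 := (hπ n A hA).2
    have h2 : ((1 : ℝ) / 4) ^ n * n < 1 := by
      rw [one_div, inv_pow, inv_mul_lt_iff₀ (by positivity), mul_one]
      exact_mod_cast Nat.lt_pow_self (by norm_num)
    have h3 : (symmDiff A (π n A)).card = 0 := by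
      have : ((symmDiff A (π n A)).card : ℝ) < 1 := h1.trans_lt h2
      exact_mod_cast Nat.lt_one_iff.1 (by exact_mod_cast this)
    rw [card_eq_zero, ← bot_eq_empty, symmDiff_eq_bot] at h3
    have := hF s A hA
    rwa [← h3] at this
  · rw [mul_comm 63 q]
    have : (0 : ℝ) ≤ 17 * (n + 3) / 2 ^ n := by positivity
    gcongr
    linarith

/-! ### Symmetrization and uniform deviations -/

section Symmetrization

variable {Ω J : Type*} [MeasurableSpace Ω] [Countable J] {n : ℕ}

/-- The centering is the mean over an independent copy of the sample; that integral comes out of the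
norm and of the supremum as an upper bound. -/
theorem lintegral_iSup_deviation_le_ghost (P : Measure Ω) [IsProbabilityMeasure P]
    {A : J → Set Ω} (hA : ∀ j, MeasurableSet (A j)) :
    ∫⁻ x, ⨆ j, ‖∑ i, (A j).indicator (1 : Ω → ℝ) (x i) - n * P.real (A j)‖ₑ
        ∂(Measure.pi fun _ : Fin n => P)
      ≤ ∫⁻ z : Fin n → Ω × Ω, ⨆ j, ‖∑ i, ((A j).indicator (1 : Ω → ℝ) (z i).1
          - (A j).indicator (1 : Ω → ℝ) (z i).2)‖ₑ ∂(Measure.pi fun _ : Fin n => P.prod P) := by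
  have hmeas : ∀ j, Measurable ((A j).indicator (1 : Ω → ℝ)) := fun j =>
    measurable_one.indicator (hA j)
  have hpres := measurePreserving_arrowProdEquivProdArrow Ω Ω (Fin n) (fun _ => P) (fun _ => P)
  have hG : Measurable fun w : (Fin n → Ω) × (Fin n → Ω) =>
      ⨆ j, ‖∑ i, ((A j).indicator (1 : Ω → ℝ) (w.1 i)
          - (A j).indicator (1 : Ω → ℝ) (w.2 i))‖ₑ := by
    refine Measurable.iSup fun j => Measurable.enorm ?_
    refine Finset.measurable_sum _ fun i _ => ?_
    exact ((hmeas j).comp (by fun_prop)).sub ((hmeas j).comp (by fun_prop))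
  have h1 := hpres.lintegral_comp hG
  rw [lintegral_prod _ hG.aemeasurable] at h1
  refine le_trans (lintegral_mono fun x => iSup_le fun j => ?_) h1.ge
  have hi : ∀ i : Fin n, Integrable (fun x' : Fin n → Ω => (A j).indicator (1 : Ω → ℝ) (x' i))
      (Measure.pi fun _ : Fin n => P) := fun i =>
    (measurePreserving_eval (fun _ : Fin n => P) i).integrable_comp_of_integrable
      ((integrable_const (1 : ℝ)).indicator (hA j))
  have hint : Integrable (fun x' : Fin n → Ω => ∑ i, (A j).indicator (1 : Ω → ℝ) (x' i))
      (Measure.pi fun _ : Fin n => P) := integrable_finsetSum _ fun i _ => hi i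
  have hval : ∫ x' : Fin n → Ω, ∑ i, (A j).indicator (1 : Ω → ℝ) (x' i)
      ∂(Measure.pi fun _ : Fin n => P) = n * P.real (A j) := by
    rw [integral_finsetSum _ fun i _ => hi i]
    have : ∀ i : Fin n, ∫ x' : Fin n → Ω, (A j).indicator (1 : Ω → ℝ) (x' i)
        ∂(Measure.pi fun _ : Fin n => P) = P.real (A j) := fun i => by
      have h := integral_map (μ := Measure.pi fun _ : Fin n => P) (φ := Function.eval i)
        (measurable_pi_apply i).aemeasurable (f := (A j).indicator (1 : Ω → ℝ))
        (hmeas j).aestronglyMeasurable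
      rw [(measurePreserving_eval (fun _ : Fin n => P) i).map_eq,
        integral_indicator_one (hA j)] at h
      exact h.symm
    simp [this]
  calc ‖∑ i, (A j).indicator (1 : Ω → ℝ) (x i) - n * P.real (A j)‖ₑ
      = ‖∫ x' : Fin n → Ω, (∑ i, ((A j).indicator (1 : Ω → ℝ) (x i)
          - (A j).indicator (1 : Ω → ℝ) (x' i))) ∂(Measure.pi fun _ : Fin n => P)‖ₑ := by
        simp only [Finset.sum_sub_distrib]
        rw [integral_sub (integrable_const _) hint, hval]
        simp
    _ ≤ ∫⁻ x' : Fin n → Ω, ‖∑ i, ((A j).indicator (1 : Ω → ℝ) (x i)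
          - (A j).indicator (1 : Ω → ℝ) (x' i))‖ₑ ∂(Measure.pi fun _ : Fin n => P) :=
        enorm_integral_le_lintegral_enorm _
    _ ≤ _ := lintegral_mono fun x' => le_iSup (fun j => ‖∑ i, ((A j).indicator (1 : Ω → ℝ) (x i)
          - (A j).indicator (1 : Ω → ℝ) (x' i))‖ₑ) j

/-- Swapping the two members of the pairs with negative sign preserves the joint law and inserts the
signs; the triangle inequality then separates the two samples. The signs are fixed here and averaged
only later. -/
theorem lintegral_iSup_ghost_le (P : Measure Ω) [IsProbabilityMeasure P]
    {A : J → Set Ω} (hA : ∀ j, MeasurableSet (A j)) (s : Fin n → Bool) :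
    ∫⁻ z : Fin n → Ω × Ω, ⨆ j, ‖∑ i, ((A j).indicator (1 : Ω → ℝ) (z i).1
          - (A j).indicator (1 : Ω → ℝ) (z i).2)‖ₑ ∂(Measure.pi fun _ : Fin n => P.prod P)
      ≤ 2 * ∫⁻ x : Fin n → Ω, ⨆ j, ‖∑ i, boolSign (s i) * (A j).indicator (1 : Ω → ℝ) (x i)‖ₑ
        ∂(Measure.pi fun _ : Fin n => P) := by
  have hmeas : ∀ j, Measurable ((A j).indicator (1 : Ω → ℝ)) := fun j =>
    measurable_one.indicator (hA j)
  have hswap : MeasurePreserving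
      (fun (z : Fin n → Ω × Ω) i => if s i then z i else (z i).swap)
      (Measure.pi fun _ : Fin n => P.prod P) (Measure.pi fun _ : Fin n => P.prod P) := by
    refine measurePreserving_pi (f := fun i (w : Ω × Ω) => if s i then w else w.swap)
      _ _ fun i => ?_
    cases s i
    · simpa using Measure.measurePreserving_swap
    · exact MeasurePreserving.id (P.prod P)
  have hM2 : Measurable fun z : Fin n → Ω × Ω => ⨆ j, ‖∑ i, ((A j).indicator (1 : Ω → ℝ) (z i).1
          - (A j).indicator (1 : Ω → ℝ) (z i).2)‖ₑ := by
    refine Measurable.iSup fun j => Measurable.enorm ?_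
    refine Finset.measurable_sum _ fun i _ => ?_
    exact ((hmeas j).comp (by fun_prop)).sub ((hmeas j).comp (by fun_prop))
  have hR : Measurable fun x : Fin n → Ω =>
      ⨆ j, ‖∑ i, boolSign (s i) * (A j).indicator (1 : Ω → ℝ) (x i)‖ₑ := by
    refine Measurable.iSup fun j => Measurable.enorm ?_
    refine Finset.measurable_sum _ fun i _ => ?_
    exact ((hmeas j).comp (by fun_prop)).const_mul _
  have hfst : MeasurePreserving (fun (z : Fin n → Ω × Ω) i => (z i).1)
      (Measure.pi fun _ : Fin n => P.prod P) (Measure.pi fun _ : Fin n => P) :=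
    measurePreserving_pi (f := fun _ => Prod.fst) _ _ fun _ => measurePreserving_fst
  have hsnd : MeasurePreserving (fun (z : Fin n → Ω × Ω) i => (z i).2)
      (Measure.pi fun _ : Fin n => P.prod P) (Measure.pi fun _ : Fin n => P) :=
    measurePreserving_pi (f := fun _ => Prod.snd) _ _ fun _ => measurePreserving_snd
  rw [← hswap.lintegral_comp hM2]
  have hle : ∀ z : Fin n → Ω × Ω,
      (⨆ j, ‖∑ i, ((A j).indicator (1 : Ω → ℝ) (if s i then z i else (z i).swap).1
          - (A j).indicator (1 : Ω → ℝ) (if s i then z i else (z i).swap).2)‖ₑ)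
      ≤ (⨆ j, ‖∑ i, boolSign (s i) * (A j).indicator (1 : Ω → ℝ) (z i).1‖ₑ)
        + ⨆ j, ‖∑ i, boolSign (s i) * (A j).indicator (1 : Ω → ℝ) (z i).2‖ₑ := fun z => by
    refine iSup_le fun j => ?_
    have : ∑ i, ((A j).indicator (1 : Ω → ℝ) (if s i then z i else (z i).swap).1
          - (A j).indicator (1 : Ω → ℝ) (if s i then z i else (z i).swap).2)
        = ∑ i, boolSign (s i) * (A j).indicator (1 : Ω → ℝ) (z i).1
          - ∑ i, boolSign (s i) * (A j).indicator (1 : Ω → ℝ) (z i).2 := by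
      rw [← Finset.sum_sub_distrib]
      refine Finset.sum_congr rfl fun i _ => ?_
      cases s i <;> simp [boolSign]; ring
    rw [this]
    exact (enorm_sub_le).trans (add_le_add
      (le_iSup (fun j => ‖∑ i, boolSign (s i) * (A j).indicator (1 : Ω → ℝ) (z i).1‖ₑ) j)
      (le_iSup (fun j => ‖∑ i, boolSign (s i) * (A j).indicator (1 : Ω → ℝ) (z i).2‖ₑ) j))
  refine (lintegral_mono hle).trans ?_
  have h1 := hfst.lintegral_comp hR
  have h2 := hsnd.lintegral_comp hR
  refine (lintegral_add_left (hR.comp hfst.measurable) _).le.trans ?_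
  rw [two_mul]
  exact add_le_add h1.le h2.le

/-- Expected uniform deviation of the empirical measure over a class of polynomial growth. -/
theorem lintegral_iSup_deviation_le (P : Measure Ω) [IsProbabilityMeasure P]
    {A : J → Set Ω} (hA : ∀ j, MeasurableSet (A j)) {D : ℕ} (hn : 0 < n) (hD : 0 < D)
    (hgrow : ∀ (x : Fin n → Ω) (𝒮 : Finset (Finset (Fin n))),
      (∀ S ∈ 𝒮, ∃ j, ∀ i, i ∈ S ↔ x i ∈ A j) → HasQuadraticGrowth D 𝒮) :
    ∫⁻ x, ⨆ j, ‖∑ i, (A j).indicator (1 : Ω → ℝ) (x i) - n * P.real (A j)‖ₑ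
        ∂(Measure.pi fun _ : Fin n => P)
      ≤ ENNReal.ofReal (126 * Real.sqrt (n * D)) := by
  classical
  set I := ∫⁻ x, ⨆ j, ‖∑ i, (A j).indicator (1 : Ω → ℝ) (x i) - n * P.real (A j)‖ₑ
        ∂(Measure.pi fun _ : Fin n => P)
  let R : (Fin n → Bool) → (Fin n → Ω) → ℝ≥0∞ := fun s x =>
    ⨆ j, ‖∑ i, boolSign (s i) * (A j).indicator (1 : Ω → ℝ) (x i)‖ₑ
  have hR : ∀ s, Measurable (R s) := fun s => by
    refine Measurable.iSup fun j => Measurable.enorm ?_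
    refine Finset.measurable_sum _ fun i _ => ?_
    exact ((measurable_one.indicator (hA j)).comp (by fun_prop)).const_mul _
  -- The bound holds for each sign vector, so it may be summed over all 2^n of them; chaining is
  -- then applied at each fixed sample.
  have hs : ∀ s, I ≤ 2 * ∫⁻ x, R s x ∂(Measure.pi fun _ : Fin n => P) := fun s =>
    (lintegral_iSup_deviation_le_ghost P hA).trans (lintegral_iSup_ghost_le P hA s)
  have hpt : ∀ x, ∑ s, R s x ≤ ENNReal.ofReal (2 ^ n * (63 * Real.sqrt (n * D))) := fun x => by
    rcases isEmpty_or_nonempty J with hJ | ⟨⟨j₀⟩⟩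
    · simp [R]
    let 𝒮 : Finset (Finset (Fin n)) := Finset.univ.filter fun S => ∃ j, ∀ i, i ∈ S ↔ x i ∈ A j
    have hmem : ∀ j, (Finset.univ.filter fun i => x i ∈ A j) ∈ 𝒮 := fun j =>
      Finset.mem_filter.2 ⟨Finset.mem_univ _, j, fun i => by simp⟩
    obtain ⟨F, hF, hsum⟩ := exists_rademacher_chaining hn hD ⟨_, hmem j₀⟩
      (hgrow x 𝒮 fun S hS => (Finset.mem_filter.1 hS).2)
    calc ∑ s, R s x ≤ ∑ s, ENNReal.ofReal (F s) := by
          refine Finset.sum_le_sum fun s _ => iSup_le fun j => ?_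
          rw [Real.enorm_eq_ofReal_abs]
          refine ENNReal.ofReal_le_ofReal ?_
          have := hF s _ (hmem j)
          rw [Finset.sum_filter] at this
          simpa [Set.indicator_apply] using this
      _ = ENNReal.ofReal (∑ s, F s) := by
          rw [ENNReal.ofReal_sum_of_nonneg]
          exact fun s _ => (abs_nonneg _).trans (hF s _ (hmem j₀))
      _ ≤ _ := ENNReal.ofReal_le_ofReal hsum
  have htot : (2 : ℝ≥0∞) ^ n * I ≤ 2 ^ n * ENNReal.ofReal (126 * Real.sqrt (n * D)) := by
    calc (2 : ℝ≥0∞) ^ n * I = ∑ _s : Fin n → Bool, I := by simp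
      _ ≤ ∑ s, 2 * ∫⁻ x, R s x ∂(Measure.pi fun _ : Fin n => P) :=
          Finset.sum_le_sum fun s _ => hs s
      _ = 2 * ∫⁻ x, ∑ s, R s x ∂(Measure.pi fun _ : Fin n => P) := by
          rw [lintegral_finsetSum _ fun s _ => hR s, Finset.mul_sum]
      _ ≤ 2 * ∫⁻ _x, ENNReal.ofReal (2 ^ n * (63 * Real.sqrt (n * D)))
            ∂(Measure.pi fun _ : Fin n => P) := by
          gcongr with x
          exact hpt x
      _ = _ := by
          rw [lintegral_const, measure_univ, mul_one, ENNReal.ofReal_mul (by positivity),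
            ENNReal.ofReal_pow (by norm_num), ENNReal.ofReal_ofNat, mul_left_comm,
            (by norm_num : (126 : ℝ) = 2 * 63), mul_assoc 2 (63 : ℝ),
            ENNReal.ofReal_mul (p := 2) (by norm_num), ENNReal.ofReal_ofNat]
  rwa [ENNReal.mul_le_mul_iff_right (by simp) (by simp)] at htot

/-- Uniform deviation inequality for the empirical measure over a countable class of polynomial
growth, without logarithmic factors. -/
theorem measure_exists_deviation_le (P : Measure Ω) [IsProbabilityMeasure P]
    {A : J → Set Ω} (hA : ∀ j, MeasurableSet (A j)) {D : ℕ} (hn : 0 < n) (hD : 0 < D)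
    (hgrow : ∀ (x : Fin n → Ω) (𝒮 : Finset (Finset (Fin n))),
      (∀ S ∈ 𝒮, ∃ j, ∀ i, i ∈ S ↔ x i ∈ A j) → HasQuadraticGrowth D 𝒮)
    {δ : ℝ} (hδ : 0 < δ) :
    (Measure.pi fun _ : Fin n => P)
      {x | ∃ j, δ < |1 / (n : ℝ) * ∑ i, (A j).indicator (1 : Ω → ℝ) (x i) - P.real (A j)|}
      ≤ ENNReal.ofReal (126 * Real.sqrt (D / n) / δ) := by
  have hn' : (0 : ℝ) < n := by exact_mod_cast hn
  set M : (Fin n → Ω) → ℝ≥0∞ := fun x =>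
    ⨆ j, ‖∑ i, (A j).indicator (1 : Ω → ℝ) (x i) - n * P.real (A j)‖ₑ with hMdef
  have hM : Measurable M := by
    refine Measurable.iSup fun j => Measurable.enorm ?_
    refine (Finset.measurable_sum _ fun i _ => ?_).sub_const _
    exact (measurable_one.indicator (hA j)).comp (by fun_prop)
  have hsub : {x | ∃ j, δ < |1 / (n : ℝ) * ∑ i, (A j).indicator (1 : Ω → ℝ) (x i)
      - P.real (A j)|} ⊆ {x | ENNReal.ofReal (n * δ) ≤ M x} := by
    rintro x ⟨j, hj⟩
    refine le_trans ?_ (le_iSup (fun j => ‖∑ i, (A j).indicator (1 : Ω → ℝ) (x i)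
      - n * P.real (A j)‖ₑ) j)
    rw [Real.enorm_eq_ofReal_abs]
    refine ENNReal.ofReal_le_ofReal ?_
    have : ∑ i, (A j).indicator (1 : Ω → ℝ) (x i) - n * P.real (A j)
        = n * (1 / (n : ℝ) * ∑ i, (A j).indicator (1 : Ω → ℝ) (x i) - P.real (A j)) := by
      field_simp
    rw [this, abs_mul, abs_of_pos hn']
    exact mul_le_mul_of_nonneg_left hj.le hn'.le
  have hpos : (0 : ℝ) < n * δ := by positivity
  refine (measure_mono hsub).trans ((meas_ge_le_lintegral_div hM.aemeasurable
    (ENNReal.ofReal_pos.2 hpos).ne' ENNReal.ofReal_ne_top).trans ?_)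
  refine (ENNReal.div_le_div_right (lintegral_iSup_deviation_le P hA hn hD hgrow) _).trans ?_
  rw [← ENNReal.ofReal_div_of_pos hpos]
  refine ENNReal.ofReal_le_ofReal (le_of_eq ?_)
  have : Real.sqrt (n * D) = n * Real.sqrt (D / n) := by
    rw [show (n : ℝ) * D = n ^ 2 * (D / n) by field_simp, Real.sqrt_mul (by positivity),
      Real.sqrt_sq hn'.le]
  rw [this]
  field_simp

end Symmetrization

/-! ### Existence of a maximizer -/

section Existence

variable {p n : ℕ}

theorem exists_sum_indicator_eq_natCast {Ω : Type*} (A : Set Ω) (d : Fin n → Ω) :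
    ∃ k : Fin (n + 1), ∑ i, A.indicator (1 : Ω → ℝ) (d i) = (k : ℕ) := by
  classical
  refine ⟨⟨(Finset.univ.filter fun i => d i ∈ A).card, ?_⟩, ?_⟩
  · exact Nat.lt_succ_of_le ((Finset.card_le_univ _).trans (by simp))
  · simp [Set.indicator_apply]

/-- Frequencies take only the values k/n, so each infimum is attained and the depth has finite
range; no continuity or compactness is needed. -/
theorem exists_isTruncatedDepthEstimate (hp : 0 < p) (d : Fin n → EuclideanSpace ℝ (Fin p) × ℝ)
    (t : ℝ) : ∃ b, IsTruncatedDepthEstimate d t b := by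
  have : Nonempty (Fin p) := ⟨⟨0, hp⟩⟩
  have : Nonempty (Metric.sphere (0 : EuclideanSpace ℝ (Fin p)) 1) :=
    (NormedSpace.sphere_nonempty.2 zero_le_one).to_subtype
  let F : Set ℝ := Set.range fun k : Fin (n + 1) => 1 / (n : ℝ) * (k : ℕ)
  have hF : F.Finite := Set.finite_range _
  have hmem : ∀ b, truncatedDepth d t b ∈ F := fun b => by
    have hsub : (Set.range fun v : Metric.sphere (0 : EuclideanSpace ℝ (Fin p)) 1 =>
        (1 / (n : ℝ)) * ∑ i, (depthEvent (v : EuclideanSpace ℝ (Fin p)) b t).indicator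
          (1 : EuclideanSpace ℝ (Fin p) × ℝ → ℝ) (d i)) ⊆ F := by
      rintro _ ⟨v, rfl⟩
      obtain ⟨k, hk⟩ := exists_sum_indicator_eq_natCast
        (depthEvent (v : EuclideanSpace ℝ (Fin p)) b t) d
      exact ⟨k, by simp only [hk]⟩
    exact hsub ((Set.range_nonempty _).csInf_mem (hF.subset hsub))
  have hfin : (Set.range (truncatedDepth d t)).Finite :=
    hF.subset (Set.range_subset_iff.2 hmem)
  obtain ⟨_, ⟨b, rfl⟩, hmax⟩ := Set.exists_max_image _ id hfin (Set.range_nonempty _)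
  exact ⟨b, fun b' => hmax _ ⟨b', rfl⟩⟩

end Existence

/-! ### Normal tails -/

section Gaussian

theorem gaussianReal_residual (m : ℝ) (v : NNReal) {s : ℝ} (hs : s = 1 ∨ s = -1) (a : ℝ) :
    gaussianReal m v {y | a ≤ s * (y - m)} = gaussianReal 0 v (Set.Ici a) := by
  have hmap : (gaussianReal m v).map (fun y => s * (y - m)) = gaussianReal 0 v := by
    have h1 := gaussianReal_map_sub_const (μ := m) (v := v) m
    have h2 := gaussianReal_map_const_mul (μ := m - m) (v := v) s
    rw [← h1, Measure.map_map (by fun_prop) (by fun_prop)] at h2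
    have h3 : NNReal.mk (s ^ 2) (sq_nonneg s) = 1 := by
      ext
      rcases hs with rfl | rfl <;> simp
    simpa [h3, Function.comp_def] using h2
  rw [← hmap, Measure.map_apply (by fun_prop) measurableSet_Ici]
  rfl

theorem gaussianReal_zero_Iic_neg (v : NNReal) (a : ℝ) :
    gaussianReal 0 v (Set.Iic (-a)) = gaussianReal 0 v (Set.Ici a) := by
  have h := gaussianReal_residual 0 v (s := -1) (Or.inr rfl) a
  rw [← h]
  congr 1
  ext y
  simp only [Set.mem_Iic, Set.mem_ofPred_eq]
  constructor <;> intro h <;> linarith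

theorem half_le_gaussianReal_Ici_zero (v : NNReal) :
    (1 / 2 : ℝ) ≤ (gaussianReal 0 v).real (Set.Ici 0) := by
  have h1 : (gaussianReal 0 v).real (Set.Iic 0) = (gaussianReal 0 v).real (Set.Ici 0) := by
    have := gaussianReal_zero_Iic_neg v 0
    rw [neg_zero] at this
    simp [measureReal_def, this]
  have h2 := measureReal_union_le (μ := gaussianReal 0 v) (Set.Iic (0 : ℝ)) (Set.Ici 0)
  rw [Set.Iic_union_Ici, probReal_univ] at h2
  linarith

/-- The central interval (-σw, σw), w = min(u, 1), has mass at least 2w/5, because the density there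
is at least (1/(3σ)) · (3/5). By symmetry the two outer tails share what remains. -/
theorem gaussianReal_Ici_le {σ u : ℝ} (hσ : 0 < σ) (hu : 0 < u) :
    (gaussianReal 0 (Real.toNNReal (σ ^ 2))).real (Set.Ici (σ * u)) ≤ 1 / 2 - min u 1 / 5 := by
  set N := gaussianReal 0 (Real.toNNReal (σ ^ 2)) with hN
  set w := min u 1 with hw
  have hw0 : 0 ≤ w := le_min hu.le zero_le_one
  have hw1 : w ≤ 1 := min_le_right _ _
  have hwu : w ≤ u := min_le_left _ _
  have hv : Real.toNNReal (σ ^ 2) ≠ 0 := by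
    rw [ne_eq, Real.toNNReal_eq_zero, not_le]; positivity
  have hmid : 2 * w / 5 ≤ N.real (Set.Ioo (-(σ * w)) (σ * w)) := by
    rw [measureReal_def, hN, gaussianReal_apply_eq_integral _ hv, ENNReal.toReal_ofReal
      (integral_nonneg fun x => gaussianPDFReal_nonneg _ _ _)]
    have hc : ∀ x ∈ Set.Ioo (-(σ * w)) (σ * w),
        1 / (5 * σ) ≤ gaussianPDFReal 0 (Real.toNNReal (σ ^ 2)) x := by
      intro x hx
      rw [gaussianPDFReal, Real.coe_toNNReal _ (sq_nonneg σ), sub_zero]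
      have hx2 : x ^ 2 ≤ σ ^ 2 := by
        refine sq_le_sq' ?_ ?_
        · nlinarith [hx.1]
        · nlinarith [hx.2]
      have hsq : Real.sqrt (2 * Real.pi * σ ^ 2) ≤ 3 * σ := by
        refine Real.sqrt_le_iff.2 ⟨by positivity, ?_⟩
        have := Real.pi_lt_d2
        nlinarith [sq_nonneg σ]
      have hsqpos : 0 < Real.sqrt (2 * Real.pi * σ ^ 2) := by
        have := Real.pi_pos
        positivity
      have hexp : (3 / 5 : ℝ) ≤ Real.exp (-x ^ 2 / (2 * σ ^ 2)) := by
        have h1 : (-(1 / 2) : ℝ) ≤ -x ^ 2 / (2 * σ ^ 2) := by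
          rw [le_div_iff₀ (by positivity)]
          linarith
        refine le_trans ?_ (Real.exp_le_exp.2 h1)
        have h3 := Real.add_one_le_exp (-(1 / 6) : ℝ)
        have h5 := Real.exp_one_lt_d9
        have h6 : Real.exp (-(1 / 2) : ℝ) ^ 2 * Real.exp 1 = 1 := by
          rw [← Real.exp_nat_mul, ← Real.exp_add]; norm_num
        by_contra hlt
        push Not at hlt
        have h7 := Real.exp_pos (-(1 / 2) : ℝ)
        nlinarith
      calc 1 / (5 * σ) = (3 * σ)⁻¹ * (3 / 5) := by field_simp
        _ ≤ _ := mul_le_mul (inv_anti₀ hsqpos hsq) hexp (by norm_num) (by positivity)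
    have h := setIntegral_mono_on (μ := volume) (s := Set.Ioo (-(σ * w)) (σ * w))
      (f := fun _ => 1 / (5 * σ)) (integrableOn_const (by simp)) (integrable_gaussianPDFReal _ _).integrableOn
      measurableSet_Ioo hc
    rw [setIntegral_const, smul_eq_mul, Real.volume_real_Ioo_of_le (by nlinarith)] at h
    refine le_trans (le_of_eq ?_) h
    field_simp
    ring
  have hsym : N.real (Set.Iic (-(σ * u))) = N.real (Set.Ici (σ * u)) := by
    simp only [measureReal_def, hN, gaussianReal_zero_Iic_neg]
  have hd1 : Disjoint (Set.Iic (-(σ * u))) (Set.Ioo (-(σ * w)) (σ * w)) := by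
    refine Set.disjoint_left.2 fun x hx hx' => ?_
    have : -(σ * u) ≤ -(σ * w) := by nlinarith
    exact absurd hx'.1 (not_lt.2 (le_trans hx this))
  have hd2 : Disjoint (Set.Iic (-(σ * u)) ∪ Set.Ioo (-(σ * w)) (σ * w)) (Set.Ici (σ * u)) := by
    refine Set.disjoint_left.2 fun x hx hx' => ?_
    have h0 : 0 < σ * u := by positivity
    have h1 : σ * w ≤ σ * u := by nlinarith
    have h3 : σ * u ≤ x := hx'
    rcases hx with hx | hx
    · have h2 : x ≤ -(σ * u) := hx
      linarith
    · have h2 := hx.2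
      linarith
  have := measureReal_mono (μ := N) (Set.subset_univ
    (Set.Iic (-(σ * u)) ∪ Set.Ioo (-(σ * w)) (σ * w) ∪ Set.Ici (σ * u)))
  rw [measureReal_union hd2 measurableSet_Ici, measureReal_union hd1 measurableSet_Ioo,
    probReal_univ, hsym] at this
  linarith

end Gaussian

/-! ### Generalized Gaussian tails -/

section GeneralizedGaussian

variable {γ : ℝ}

theorem integrable_pow_mul_exp_neg_abs_rpow (hγ : 0 < γ) (k : ℕ) {b : ℝ} (hb : 0 < b) :
    Integrable fun s : ℝ => |s| ^ k * Real.exp (-b * |s| ^ γ) := by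
  have h := (integrable_fun_norm_addHaar (volume : Measure ℝ)
    (f := fun y : ℝ => y ^ k * Real.exp (-b * y ^ γ))).2 (by
      simp only [Module.finrank_self, Nat.sub_self, pow_zero, one_smul]
      have := integrableOn_rpow_mul_exp_neg_mul_rpow (p := γ) (s := k) (b := b)
        (by have : (0 : ℝ) ≤ k := by positivity
            linarith) hγ hb
      simpa only [Real.rpow_natCast] using this)
  simpa only [Real.norm_eq_abs] using h

theorem integrable_exp_neg_abs_rpow_div_two (hγ : 0 < γ) :
    Integrable fun s : ℝ => Real.exp (-|s| ^ γ / 2) := by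
  have := integrable_pow_mul_exp_neg_abs_rpow hγ 0 (b := 1 / 2) (by norm_num)
  refine this.congr (Filter.Eventually.of_forall fun s => ?_)
  simp only [pow_zero, one_mul]
  congr 1
  ring

theorem integral_exp_neg_abs_rpow_pos (hγ : 0 < γ) :
    0 < ∫ s : ℝ, Real.exp (-|s| ^ γ / 2) :=
  integral_exp_pos (integrable_exp_neg_abs_rpow_div_two hγ)

theorem isProbabilityMeasure_generalizedGaussianReal (hγ : 0 < γ) :
    IsProbabilityMeasure (generalizedGaussianReal γ) := by
  refine ⟨?_⟩
  rw [generalizedGaussianReal, withDensity_apply _ MeasurableSet.univ, Measure.restrict_univ,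
    ← ofReal_integral_eq_lintegral_ofReal
      ((integrable_exp_neg_abs_rpow_div_two hγ).div_const _)
      (Filter.Eventually.of_forall fun s => by
        have := (integral_exp_neg_abs_rpow_pos hγ).le
        positivity),
    integral_div, div_self (integral_exp_neg_abs_rpow_pos hγ).ne', ENNReal.ofReal_one]

/-- The density is at most 1/Z. This pays for the slight lowering of the threshold required when
passing to a countable set of directions. -/
theorem generalizedGaussianReal_Ici_le (hγ : 0 < γ) {a a' : ℝ} (h : a' ≤ a) :
    (generalizedGaussianReal γ).real (Set.Ici a') ≤ (generalizedGaussianReal γ).real (Set.Ici a)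
      + (a - a') / ∫ s : ℝ, Real.exp (-|s| ^ γ / 2) := by
  have := isProbabilityMeasure_generalizedGaussianReal hγ
  have hZ := integral_exp_neg_abs_rpow_pos hγ
  have hsub : Set.Ici a' ⊆ Set.Ici a ∪ Set.Icc a' a := fun x hx => by
    rcases le_total a x with h | h
    · exact Or.inl h
    · exact Or.inr ⟨hx, h⟩
  refine (measureReal_mono hsub).trans ((measureReal_union_le _ _).trans ?_)
  gcongr
  rw [measureReal_def]
  refine ENNReal.toReal_le_of_le_ofReal (div_nonneg (by linarith) hZ.le) ?_
  rw [generalizedGaussianReal, withDensity_apply _ measurableSet_Icc]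
  calc _ ≤ ∫⁻ _t in Set.Icc a' a,
        ENNReal.ofReal (1 / ∫ s : ℝ, Real.exp (-|s| ^ γ / 2)) := by
        refine lintegral_mono fun t => ENNReal.ofReal_le_ofReal ?_
        refine div_le_div_of_nonneg_right (Real.exp_le_one_iff.2 ?_) hZ.le
        have : 0 ≤ |t| ^ γ := by positivity
        linarith
    _ = _ := by
        rw [setLIntegral_const, Real.volume_Icc, ← ENNReal.ofReal_mul (by positivity)]
        congr 1
        ring

/-- On [(ℓ/3)^(1/γ), ℓ^(1/γ)] the density is at least exp(-ℓ/2)/Z, and the length is at least 1 -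
3^(-1/γ); a divisor larger than one keeps this positive. -/
theorem exists_le_generalizedGaussianReal_Ici (hγ : 0 < γ) :
    ∃ c : ℝ, 0 < c ∧ ∀ ℓ : ℝ, 1 ≤ ℓ →
      c * Real.exp (-ℓ / 2) ≤ (generalizedGaussianReal γ).real (Set.Ici ((ℓ / 3) ^ (1 / γ))) := by
  have := isProbabilityMeasure_generalizedGaussianReal hγ
  set Z := ∫ s : ℝ, Real.exp (-|s| ^ γ / 2) with hZdef
  have hZ : 0 < Z := integral_exp_neg_abs_rpow_pos hγ
  have h3 : ((1 : ℝ) / 3) ^ (1 / γ) < 1 :=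
    Real.rpow_lt_one (by norm_num) (by norm_num) (by positivity)
  refine ⟨(1 - (1 / 3 : ℝ) ^ (1 / γ)) / Z, div_pos (by linarith) hZ, fun ℓ hℓ => ?_⟩
  have hℓ0 : (0 : ℝ) ≤ ℓ := by linarith
  set a := (ℓ / 3) ^ (1 / γ) with ha
  set b := ℓ ^ (1 / γ) with hb
  have hab : a = (1 / 3 : ℝ) ^ (1 / γ) * b := by
    rw [ha, hb, ← Real.mul_rpow (by norm_num) hℓ0]
    congr 1
    ring
  have hb1 : 1 ≤ b := Real.one_le_rpow hℓ (by positivity)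
  have hbγ : b ^ γ = ℓ := by
    rw [hb, ← Real.rpow_mul hℓ0, one_div_mul_cancel hγ.ne', Real.rpow_one]
  have ha0 : 0 ≤ a := by positivity
  refine le_trans ?_ (measureReal_mono (Set.Icc_subset_Ici_self (a := b) (b := a)))
  rw [measureReal_def]
  refine (ENNReal.ofReal_le_iff_le_toReal (measure_ne_top _ _)).1 ?_
  rw [generalizedGaussianReal, withDensity_apply _ measurableSet_Icc]
  calc _ ≤ ENNReal.ofReal (Real.exp (-ℓ / 2) / Z) * ENNReal.ofReal (b - a) := by
        rw [← ENNReal.ofReal_mul (by positivity)]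
        refine ENNReal.ofReal_le_ofReal ?_
        have h1 : (1 - (1 / 3 : ℝ) ^ (1 / γ)) ≤ b - a := by
          rw [hab]
          nlinarith
        calc _ = Real.exp (-ℓ / 2) / Z * (1 - (1 / 3 : ℝ) ^ (1 / γ)) := by ring
          _ ≤ _ := by gcongr
    _ = ∫⁻ _t in Set.Icc a b, ENNReal.ofReal (Real.exp (-ℓ / 2) / Z) := by
        rw [setLIntegral_const, Real.volume_Icc]
    _ ≤ _ := by
        refine setLIntegral_mono' measurableSet_Icc fun t ht => ENNReal.ofReal_le_ofReal ?_
        refine div_le_div_of_nonneg_right (Real.exp_le_exp.2 ?_) hZ.le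
        have ht0 : 0 ≤ t := ha0.trans ht.1
        have : |t| ^ γ ≤ ℓ := by
          rw [abs_of_nonneg ht0, ← hbγ]
          exact Real.rpow_le_rpow ht0 ht.2 hγ.le
        linarith

end GeneralizedGaussian

/-! ### The two sides of the depth event and their probabilities -/

section Events

variable {p : ℕ}

/-- The set of `(x, y)` with `wᵀx ≥ τ` and `s (y - xᵀβ) ≥ θ wᵀx`. -/
def orientedEvent (β : EuclideanSpace ℝ (Fin p)) (s τ θ : ℝ) (w : EuclideanSpace ℝ (Fin p)) :
    Set (EuclideanSpace ℝ (Fin p) × ℝ) :=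
  {z | τ ≤ inner ℝ w z.1 ∧ θ * inner ℝ w z.1 ≤ s * (z.2 - inner ℝ z.1 β)}

theorem measurableSet_orientedEvent (β : EuclideanSpace ℝ (Fin p)) (s τ θ : ℝ)
    (w : EuclideanSpace ℝ (Fin p)) : MeasurableSet (orientedEvent β s τ θ w) := by
  have h1 : MeasurableSet {z : EuclideanSpace ℝ (Fin p) × ℝ | τ ≤ inner ℝ w z.1} :=
    measurableSet_le (by fun_prop) (by fun_prop)
  have h2 : MeasurableSet {z : EuclideanSpace ℝ (Fin p) × ℝ |
      θ * inner ℝ w z.1 ≤ s * (z.2 - inner ℝ z.1 β)} :=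
    measurableSet_le (by fun_prop) (by fun_prop)
  exact h1.inter h2

/-- Both constraints are linear in (w, 1) once the data are lifted to ℝᵖ × ℝ, so the two classes
have dimension p + 1. -/
theorem hasQuadraticGrowth_orientedEvent {n : ℕ} {J : Type*} (β : EuclideanSpace ℝ (Fin p))
    (s τ θ : ℝ) (w : J → EuclideanSpace ℝ (Fin p)) (x : Fin n → EuclideanSpace ℝ (Fin p) × ℝ)
    (𝒮 : Finset (Finset (Fin n)))
    (h𝒮 : ∀ S ∈ 𝒮, ∃ j, ∀ i, i ∈ S ↔ x i ∈ orientedEvent β s τ θ (w j)) :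
    HasQuadraticGrowth (p + 1) 𝒮 := by
  have hrank : Module.finrank ℝ (EuclideanSpace ℝ (Fin p) × ℝ) ≤ p + 1 := by
    rw [Module.finrank_prod, finrank_euclideanSpace_fin, Module.finrank_self]
  refine hasQuadraticGrowth_of_halfspaces hrank hrank (fun i => ((x i).1, -τ))
    (fun i => ((-θ) • (x i).1, s * ((x i).2 - inner ℝ (x i).1 β))) 𝒮 fun S hS => ?_
  obtain ⟨j, hj⟩ := h𝒮 S hS
  let f : Module.Dual ℝ (EuclideanSpace ℝ (Fin p) × ℝ) :=
    (innerSL ℝ (w j)).toLinearMap.coprod LinearMap.id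
  refine ⟨f, f, fun i => ?_⟩
  rw [hj]
  simp only [orientedEvent, Set.mem_ofPred_eq, f, LinearMap.coprod_apply,
    ContinuousLinearMap.coe_coe, innerSL_apply_apply, LinearMap.id_apply, inner_smul_right]
  constructor <;> rintro ⟨h1, h2⟩ <;> constructor <;> linarith

/-- As t > 0, the sign of vᵀx is determined on the event, and the product condition can be divided
by it. -/
theorem depthEvent_subset_union {β v : EuclideanSpace ℝ (Fin p)} {t θ : ℝ} (ht : 0 < t) :
    depthEvent v (β + θ • v) t ⊆ orientedEvent β 1 t θ v ∪ orientedEvent β (-1) t θ (-v) := by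
  rintro ⟨x, y⟩ ⟨h1, h2⟩
  simp only [inner_add_right, inner_smul_right] at h1 h2
  rw [real_inner_comm v x] at h1
  simp only [orientedEvent, Set.mem_union, Set.mem_ofPred_eq, inner_neg_left]
  rcases le_abs.1 h2 with h | h
  · left
    refine ⟨h, ?_⟩
    have := nonneg_of_mul_nonneg_right h1 (ht.trans_le h)
    linarith
  · right
    refine ⟨h, ?_⟩
    have h3 : 0 ≤ (-inner ℝ v x) * (-(y - (inner ℝ x β + θ * inner ℝ v x))) := by
      rw [neg_mul_neg]; exact h1
    have := nonneg_of_mul_nonneg_right h3 (ht.trans_le h)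
    linarith

theorem union_subset_depthEvent {β v : EuclideanSpace ℝ (Fin p)} {t : ℝ} (ht : 0 < t) :
    orientedEvent β 1 t 0 v ∪ orientedEvent β (-1) t 0 (-v) ⊆ depthEvent v β t := by
  rintro ⟨x, y⟩ (⟨h1, h2⟩ | ⟨h1, h2⟩)
  · simp only [zero_mul, one_mul] at h1 h2
    exact ⟨mul_nonneg (ht.le.trans h1) h2, h1.trans (le_abs_self _)⟩
  · simp only [zero_mul, inner_neg_left] at h1 h2
    refine ⟨mul_nonneg_of_nonpos_of_nonpos (by linarith) (by linarith), ?_⟩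
    exact h1.trans (neg_le_abs _)

theorem disjoint_orientedEvent {β v : EuclideanSpace ℝ (Fin p)} {s s' t θ : ℝ} (ht : 0 < t) :
    Disjoint (orientedEvent β s t θ v) (orientedEvent β s' t θ (-v)) := by
  refine Set.disjoint_left.2 ?_
  rintro ⟨x, y⟩ ⟨h1, _⟩ ⟨h2, _⟩
  simp only [inner_neg_left] at h1 h2
  linarith

variable {γ σ ε : ℝ} {μ : Measure (EuclideanSpace ℝ (Fin p))}

theorem measure_inner_ge (hμ : IsSphericalGeneralizedGaussian γ μ)
    {w : EuclideanSpace ℝ (Fin p)} (hw : ‖w‖ = 1) (τ : ℝ) :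
    μ {x | τ ≤ inner ℝ w x} = generalizedGaussianReal γ (Set.Ici τ) := by
  rw [← hμ w hw, Measure.map_apply (by fun_prop) measurableSet_Ici]
  rfl

/-- The contamination is discarded; given x, the centered normal noise has the required sign with
probability at least one half. -/
theorem le_measureReal_orientedEvent [IsProbabilityMeasure μ] (hγ : 0 < γ) (hμ : IsSphericalGeneralizedGaussian γ μ)
    (h0 : 0 ≤ ε) (h1 : ε ≤ 1) (β : EuclideanSpace ℝ (Fin p))
    (Q : Kernel (EuclideanSpace ℝ (Fin p)) ℝ) [IsMarkovKernel Q] {s : ℝ} (hs : s = 1 ∨ s = -1)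
    (τ : ℝ) {w : EuclideanSpace ℝ (Fin p)} (hw : ‖w‖ = 1) :
    (1 - ε) / 2 * (generalizedGaussianReal γ).real (Set.Ici τ)
      ≤ (μ ⊗ₘ responseKernel β σ ε Q).real (orientedEvent β s τ 0 w) := by
  have := isMarkovKernel_responseKernel β σ h0 h1 Q
  have := isProbabilityMeasure_generalizedGaussianReal hγ
  rw [measureReal_def, measureReal_def]
  refine (ENNReal.ofReal_le_iff_le_toReal (measure_ne_top _ _)).1 ?_
  rw [ENNReal.ofReal_mul (by linarith), ENNReal.ofReal_toReal (measure_ne_top _ _),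
    ← measure_inner_ge hμ hw τ, Measure.compProd_apply (measurableSet_orientedEvent _ _ _ _ _)]
  have hmeas : MeasurableSet {x : EuclideanSpace ℝ (Fin p) | τ ≤ inner ℝ w x} :=
    measurableSet_le (by fun_prop) (by fun_prop)
  rw [← lintegral_indicator_const hmeas]
  refine lintegral_mono fun x => ?_
  by_cases hx : τ ≤ inner ℝ w x
  · have hx' : x ∈ {x : EuclideanSpace ℝ (Fin p) | τ ≤ inner ℝ w x} := hx
    rw [Set.indicator_of_mem hx']
    have hslice : Prod.mk x ⁻¹' orientedEvent β s τ 0 w = {y | 0 ≤ s * (y - inner ℝ x β)} := by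
      ext y
      simp [orientedEvent, hx]
    rw [hslice]
    change _ ≤ (ENNReal.ofReal (1 - ε) • gaussianReal (inner ℝ x β) (Real.toNNReal (σ ^ 2))
      + ENNReal.ofReal ε • Q x) _
    simp only [Measure.coe_add, Measure.coe_smul, Pi.add_apply, Pi.smul_apply, smul_eq_mul]
    rw [gaussianReal_residual _ _ hs]
    refine le_trans ?_ le_self_add
    rw [div_eq_mul_one_div, ENNReal.ofReal_mul (by linarith)]
    gcongr
    have := half_le_gaussianReal_Ici_zero (Real.toNNReal (σ ^ 2))
    exact (ENNReal.ofReal_le_iff_le_toReal (measure_ne_top _ _)).2 this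
  · have hx' : x ∉ {x : EuclideanSpace ℝ (Fin p) | τ ≤ inner ℝ w x} := hx
    rw [Set.indicator_of_notMem hx']
    exact zero_le

/-- Given wᵀx ≥ τ the residual must be at least θτ, and the contamination contributes at most ε. The
whole bound carries the factor of the tail, so contamination is charged only where the design is
large. -/
theorem measureReal_orientedEvent_le [IsProbabilityMeasure μ] (hγ : 0 < γ) (hμ : IsSphericalGeneralizedGaussian γ μ)
    (h0 : 0 ≤ ε) (h1 : ε ≤ 1) (β : EuclideanSpace ℝ (Fin p))
    (Q : Kernel (EuclideanSpace ℝ (Fin p)) ℝ) [IsMarkovKernel Q] {s : ℝ} (hs : s = 1 ∨ s = -1)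
    {τ θ : ℝ} (hθ : 0 ≤ θ) {w : EuclideanSpace ℝ (Fin p)} (hw : ‖w‖ = 1) :
    (μ ⊗ₘ responseKernel β σ ε Q).real (orientedEvent β s τ θ w)
      ≤ ((1 - ε) * (gaussianReal 0 (Real.toNNReal (σ ^ 2))).real (Set.Ici (θ * τ)) + ε)
        * (generalizedGaussianReal γ).real (Set.Ici τ) := by
  have := isMarkovKernel_responseKernel β σ h0 h1 Q
  have := isProbabilityMeasure_generalizedGaussianReal hγ
  set T := (gaussianReal 0 (Real.toNNReal (σ ^ 2))).real (Set.Ici (θ * τ)) with hT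
  have hT0 : 0 ≤ T := measureReal_nonneg
  have hnn : 0 ≤ (1 - ε) * T + ε := add_nonneg (mul_nonneg (by linarith) hT0) h0
  rw [measureReal_def]
  refine ENNReal.toReal_le_of_le_ofReal (mul_nonneg hnn measureReal_nonneg) ?_
  rw [ENNReal.ofReal_mul hnn, measureReal_def, ENNReal.ofReal_toReal (measure_ne_top _ _),
    ← measure_inner_ge hμ hw τ, Measure.compProd_apply (measurableSet_orientedEvent _ _ _ _ _)]
  have hmeas : MeasurableSet {x : EuclideanSpace ℝ (Fin p) | τ ≤ inner ℝ w x} :=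
    measurableSet_le (by fun_prop) (by fun_prop)
  rw [← lintegral_indicator_const hmeas]
  refine lintegral_mono fun x => ?_
  by_cases hx : τ ≤ inner ℝ w x
  · have hx' : x ∈ {x : EuclideanSpace ℝ (Fin p) | τ ≤ inner ℝ w x} := hx
    rw [Set.indicator_of_mem hx']
    have hslice : Prod.mk x ⁻¹' orientedEvent β s τ θ w
        = {y | θ * inner ℝ w x ≤ s * (y - inner ℝ x β)} := by
      ext y
      simp [orientedEvent, hx]
    rw [hslice]
    change (ENNReal.ofReal (1 - ε) • gaussianReal (inner ℝ x β) (Real.toNNReal (σ ^ 2))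
      + ENNReal.ofReal ε • Q x) _ ≤ _
    simp only [Measure.coe_add, Measure.coe_smul, Pi.add_apply, Pi.smul_apply, smul_eq_mul]
    rw [gaussianReal_residual _ _ hs, ENNReal.ofReal_add (mul_nonneg (by linarith) hT0) h0,
      ENNReal.ofReal_mul (by linarith)]
    refine add_le_add ?_ ?_
    · gcongr
      rw [hT, measureReal_def, ENNReal.ofReal_toReal (measure_ne_top _ _)]
      exact measure_mono (Set.Ici_subset_Ici.2 (mul_le_mul_of_nonneg_left hx hθ))
    · exact (mul_le_mul_right prob_le_one _).trans (mul_one _).le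
  · have hx' : x ∉ {x : EuclideanSpace ℝ (Fin p) | τ ≤ inner ℝ w x} := hx
    rw [Set.indicator_of_notMem hx']
    have hslice : Prod.mk x ⁻¹' orientedEvent β s τ θ w = ∅ := by
      ext y
      simp [orientedEvent, hx]
    simp [hslice]

end Events

/-! ### Empirical frequencies -/

section Empirical

/-- The proportion of the points `d i` lying in `A`. -/
noncomputable def empiricalFreq {Ω : Type*} {n : ℕ} (d : Fin n → Ω) (A : Set Ω) : ℝ :=
  1 / (n : ℝ) * ∑ i, A.indicator (1 : Ω → ℝ) (d i)

theorem empiricalFreq_mono {Ω : Type*} {n : ℕ} {d : Fin n → Ω} {A B : Set Ω}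
    (h : ∀ i, d i ∈ A → d i ∈ B) : empiricalFreq d A ≤ empiricalFreq d B := by
  refine mul_le_mul_of_nonneg_left (Finset.sum_le_sum fun i _ => ?_) (by positivity)
  by_cases hA : d i ∈ A
  · rw [Set.indicator_of_mem hA, Set.indicator_of_mem (h i hA)]
  · rw [Set.indicator_of_notMem hA]
    exact Set.indicator_nonneg (fun _ _ => zero_le_one) _

theorem empiricalFreq_union_le {Ω : Type*} {n : ℕ} (d : Fin n → Ω) (A B : Set Ω) :
    empiricalFreq d (A ∪ B) ≤ empiricalFreq d A + empiricalFreq d B := by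
  rw [empiricalFreq, empiricalFreq, empiricalFreq, ← mul_add, ← Finset.sum_add_distrib]
  refine mul_le_mul_of_nonneg_left (Finset.sum_le_sum fun i _ => ?_) (by positivity)
  by_cases hA : d i ∈ A <;> by_cases hB : d i ∈ B <;> simp [hA, hB]

theorem empiricalFreq_union {Ω : Type*} {n : ℕ} (d : Fin n → Ω) {A B : Set Ω}
    (h : Disjoint A B) :
    empiricalFreq d (A ∪ B) = empiricalFreq d A + empiricalFreq d B := by
  rw [empiricalFreq, empiricalFreq, empiricalFreq, ← mul_add, ← Finset.sum_add_distrib,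
    Set.indicator_union_of_disjoint h]

theorem empiricalFreq_nonneg {Ω : Type*} {n : ℕ} (d : Fin n → Ω) (A : Set Ω) :
    0 ≤ empiricalFreq d A :=
  mul_nonneg (by positivity) (Finset.sum_nonneg fun _ _ =>
    Set.indicator_nonneg (fun _ _ => zero_le_one) _)

end Empirical

/-! ### From a gap in frequencies to an error bound -/

section Deterministic

variable {p n : ℕ} {d : Fin n → EuclideanSpace ℝ (Fin p) × ℝ}

-- With θ = 0 the residual constraint does not involve the direction. A point outside the closed
-- constraint wᵀx ≥ τ stays outside for nearby directions, so a dense direction can only lose sample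
-- points.
open Filter Topology in
theorem exists_dense_orientedEvent_subset {w : ℕ → Metric.sphere (0 : EuclideanSpace ℝ (Fin p)) 1}
    (hw : DenseRange w) (β : EuclideanSpace ℝ (Fin p)) (s τ : ℝ)
    (v : Metric.sphere (0 : EuclideanSpace ℝ (Fin p)) 1) :
    ∃ j, ∀ i, d i ∈ orientedEvent β s τ 0 (w j) → d i ∈ orientedEvent β s τ 0 v := by
  have hev : ∀ᶠ u : Metric.sphere (0 : EuclideanSpace ℝ (Fin p)) 1 in 𝓝 v,
      ∀ i, d i ∈ orientedEvent β s τ 0 u → d i ∈ orientedEvent β s τ 0 v := by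
    rw [eventually_all]
    intro i
    by_cases h : τ ≤ inner ℝ (v : EuclideanSpace ℝ (Fin p)) (d i).1
    · refine Eventually.of_forall fun u hu => ⟨h, ?_⟩
      have := hu.2
      rwa [zero_mul] at this ⊢
    · have hc : Continuous fun u : Metric.sphere (0 : EuclideanSpace ℝ (Fin p)) 1 =>
          inner ℝ (u : EuclideanSpace ℝ (Fin p)) (d i).1 := by fun_prop
      filter_upwards [hc.continuousAt.eventually_lt_const (not_le.1 h)] with u hu hmem
      exact absurd hmem.1 (not_le.2 hu)
  exact hw.mem_nhds hev

-- In this direction closed constraints must survive a perturbation, so strict slack is needed in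
-- both τ and θ; positivity of τ turns the slack in θ into a strict inequality.
open Filter Topology in
theorem exists_dense_subset_orientedEvent {w : ℕ → Metric.sphere (0 : EuclideanSpace ℝ (Fin p)) 1}
    (hw : DenseRange w) (β : EuclideanSpace ℝ (Fin p)) (s : ℝ) {τ τ' θ θ' : ℝ} (hτ : 0 < τ)
    (hτ' : τ' < τ) (hθ : θ' < θ) (v : Metric.sphere (0 : EuclideanSpace ℝ (Fin p)) 1) :
    ∃ j, ∀ i, d i ∈ orientedEvent β s τ θ v → d i ∈ orientedEvent β s τ' θ' (w j) := by
  have hev : ∀ᶠ u : Metric.sphere (0 : EuclideanSpace ℝ (Fin p)) 1 in 𝓝 v,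
      ∀ i, d i ∈ orientedEvent β s τ θ v → d i ∈ orientedEvent β s τ' θ' u := by
    rw [eventually_all]
    intro i
    by_cases h : d i ∈ orientedEvent β s τ θ v
    · obtain ⟨h1, h2⟩ := h
      have hc : Continuous fun u : Metric.sphere (0 : EuclideanSpace ℝ (Fin p)) 1 =>
          inner ℝ (u : EuclideanSpace ℝ (Fin p)) (d i).1 := by fun_prop
      have h3 : θ' * inner ℝ (v : EuclideanSpace ℝ (Fin p)) (d i).1
          < s * ((d i).2 - inner ℝ (d i).1 β) := by
        refine lt_of_lt_of_le ?_ h2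
        exact mul_lt_mul_of_pos_right hθ (hτ.trans_le h1)
      filter_upwards [hc.continuousAt.eventually_const_lt (hτ'.trans_le h1),
        (continuous_const.mul hc).continuousAt.eventually_lt_const h3] with u hu1 hu2 _
      exact ⟨hu1.le, hu2.le⟩
    · exact Eventually.of_forall fun u hu => absurd hu h
  exact hw.mem_nhds hev

/-- Deterministic error bound for the maximizers of the truncated depth, on the event where the
empirical frequencies of the oriented events are controlled. -/
theorem norm_sub_le_of_empiricalFreq_bounds (hp : 0 < p)
    {w : ℕ → Metric.sphere (0 : EuclideanSpace ℝ (Fin p)) 1} (hw : DenseRange w)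
    {β b : EuclideanSpace ℝ (Fin p)} {t t' θ lo hi : ℝ} (ht : 0 < t) (ht' : t' < t) (hθ : 0 ≤ θ)
    (hlo : ∀ s : ℝ, (s = 1 ∨ s = -1) → ∀ j, lo ≤ empiricalFreq d (orientedEvent β s t 0 (w j)))
    (hhi : ∀ s : ℝ, (s = 1 ∨ s = -1) → ∀ j, empiricalFreq d (orientedEvent β s t' θ (w j)) ≤ hi)
    (hgap : hi < lo) (hb : IsTruncatedDepthEstimate d t b) : ‖b - β‖ ≤ θ := by
  have : Nonempty (Fin p) := ⟨⟨0, hp⟩⟩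
  have : Nonempty (Metric.sphere (0 : EuclideanSpace ℝ (Fin p)) 1) :=
    (NormedSpace.sphere_nonempty.2 zero_le_one).to_subtype
  by_contra hlt
  push Not at hlt
  set Δ := ‖b - β‖ with hΔ
  have hΔ0 : 0 < Δ := hθ.trans_lt hlt
  have hlo' : ∀ s : ℝ, (s = 1 ∨ s = -1) →
      ∀ v : Metric.sphere (0 : EuclideanSpace ℝ (Fin p)) 1,
        lo ≤ empiricalFreq d (orientedEvent β s t 0 v) := fun s hs v => by
    obtain ⟨j, hj⟩ := exists_dense_orientedEvent_subset (d := d) hw β s t v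
    exact (hlo s hs j).trans (empiricalFreq_mono hj)
  have hhi' : ∀ s : ℝ, (s = 1 ∨ s = -1) →
      ∀ v : Metric.sphere (0 : EuclideanSpace ℝ (Fin p)) 1,
        empiricalFreq d (orientedEvent β s t Δ v) ≤ hi := fun s hs v => by
    obtain ⟨j, hj⟩ := exists_dense_subset_orientedEvent (d := d) hw β s ht ht' hlt v
    exact (empiricalFreq_mono hj).trans (hhi s hs j)
  have hβ : 2 * lo ≤ truncatedDepth d t β := by
    refine le_ciInf fun v => ?_
    have h1 := hlo' 1 (Or.inl rfl) v
    have h2 := hlo' (-1) (Or.inr rfl) (-v)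
    rw [coe_neg_sphere] at h2
    calc 2 * lo ≤ empiricalFreq d (orientedEvent β 1 t 0 v)
          + empiricalFreq d (orientedEvent β (-1) t 0 (-(v : EuclideanSpace ℝ (Fin p)))) := by
          linarith
      _ = empiricalFreq d (orientedEvent β 1 t 0 v
          ∪ orientedEvent β (-1) t 0 (-(v : EuclideanSpace ℝ (Fin p)))) :=
          (empiricalFreq_union d (disjoint_orientedEvent ht)).symm
      _ ≤ empiricalFreq d (depthEvent v β t) :=
          empiricalFreq_mono fun i hi => union_subset_depthEvent ht hi
  -- The direction of the error exposes `b`: its depth there is at most 2hi, while β has depth at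
  -- least 2lo in all directions.
  let v : Metric.sphere (0 : EuclideanSpace ℝ (Fin p)) 1 :=
    ⟨Δ⁻¹ • (b - β), by
      rw [mem_sphere_zero_iff_norm, norm_smul, norm_inv, Real.norm_of_nonneg hΔ0.le,
        inv_mul_cancel₀ hΔ0.ne']⟩
  have hbv : b = β + Δ • (v : EuclideanSpace ℝ (Fin p)) := by
    simp only [v, smul_smul, mul_inv_cancel₀ hΔ0.ne', one_smul, add_sub_cancel]
  have hbb : truncatedDepth d t b ≤ 2 * hi := by
    refine (ciInf_le ⟨0, ?_⟩ v).trans ?_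
    · rintro _ ⟨u, rfl⟩
      exact empiricalFreq_nonneg d _
    · have h1 := hhi' 1 (Or.inl rfl) v
      have h2 := hhi' (-1) (Or.inr rfl) (-v)
      rw [coe_neg_sphere] at h2
      have h3 : empiricalFreq d (depthEvent v b t)
          ≤ empiricalFreq d (orientedEvent β 1 t Δ v
            ∪ orientedEvent β (-1) t Δ (-(v : EuclideanSpace ℝ (Fin p)))) := by
        refine empiricalFreq_mono fun i hi => ?_
        rw [hbv] at hi
        exact depthEvent_subset_union ht hi
      have h4 := empiricalFreq_union_le d (orientedEvent β 1 t Δ v)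
        (orientedEvent β (-1) t Δ (-(v : EuclideanSpace ℝ (Fin p))))
      change empiricalFreq d (depthEvent v b t) ≤ _
      linarith
  have := hb β
  linarith

end Deterministic

/-! ### Calibration of the upper bound -/

section UpperBound

variable {p n : ℕ}

theorem measure_exists_orientedEvent_deviation_le (hp : 0 < p) (hn : 0 < n)
    (P : Measure (EuclideanSpace ℝ (Fin p) × ℝ)) [IsProbabilityMeasure P]
    (β : EuclideanSpace ℝ (Fin p)) (s τ θ : ℝ) (w : ℕ → EuclideanSpace ℝ (Fin p)) {δ : ℝ}
    (hδ : 0 < δ) :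
    (Measure.pi fun _ : Fin n => P)
      {d | ∃ j, δ < |empiricalFreq d (orientedEvent β s τ θ (w j))
        - P.real (orientedEvent β s τ θ (w j))|}
      ≤ ENNReal.ofReal (252 * Real.sqrt (p / n) / δ) := by
  refine (measure_exists_deviation_le P (fun j => measurableSet_orientedEvent β s τ θ (w j)) hn
    p.succ_pos (hasQuadraticGrowth_orientedEvent β s τ θ w) hδ).trans
    (ENNReal.ofReal_le_ofReal ?_)
  have h : Real.sqrt ((p.succ : ℕ) / n) ≤ 2 * Real.sqrt (p / n) := by
    rw [show (2 : ℝ) = Real.sqrt (2 ^ 2) by rw [Real.sqrt_sq zero_le_two],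
      ← Real.sqrt_mul (by norm_num)]
    refine Real.sqrt_le_sqrt ?_
    rw [← mul_div_assoc]
    gcongr
    have : (1 : ℝ) ≤ p := by exact_mod_cast hp
    push_cast
    linarith
  calc 126 * Real.sqrt ((p.succ : ℕ) / n) / δ ≤ 126 * (2 * Real.sqrt (p / n)) / δ := by gcongr
    _ = _ := by ring

theorem one_le_log_add_exp_one {x : ℝ} (hx : 0 ≤ x) : 1 ≤ Real.log (x + Real.exp 1) := by
  rw [Real.le_log_iff_exp_le (by positivity)]
  linarith

/-- Squared, this is ρ²(nε²/p + e) = ε² + eρ² ≤ (ε + 2ρ)². It is the reason for the logarithm in the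
truncation level: sampling error stays below ε + ρ in units of the tail probability. -/
theorem sqrt_mul_exp_half_log_le {ε : ℝ} (hp : 0 < p) (hn : 0 < n) (hε : 0 ≤ ε) :
    Real.sqrt ((p : ℝ) / n)
      ≤ (ε + 2 * Real.sqrt ((p : ℝ) / n))
        * Real.exp (-Real.log ((n : ℝ) * ε ^ 2 / p + Real.exp 1) / 2) := by
  have hp' : (0 : ℝ) < p := by exact_mod_cast hp
  have hn' : (0 : ℝ) < n := by exact_mod_cast hn
  set ρ := Real.sqrt ((p : ℝ) / n) with hρ
  have hρ0 : 0 < ρ := Real.sqrt_pos.2 (by positivity)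
  have hρ2 : ρ ^ 2 = p / n := Real.sq_sqrt (by positivity)
  set a := (n : ℝ) * ε ^ 2 / p + Real.exp 1 with ha
  have ha0 : 0 < a := by positivity
  have hE : Real.exp (-Real.log a / 2) ^ 2 = 1 / a := by
    rw [← Real.exp_nat_mul]
    push_cast
    rw [show (2 : ℝ) * (-Real.log a / 2) = -Real.log a by ring, Real.exp_neg, Real.exp_log ha0,
      one_div]
  have he := Real.exp_one_lt_d9
  refine (sq_le_sq₀ hρ0.le (by positivity)).1 ?_
  rw [mul_pow, hE, mul_one_div, le_div_iff₀ ha0]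
  have h1 : ρ ^ 2 * a = ε ^ 2 + ρ ^ 2 * Real.exp 1 := by
    rw [ha, mul_add, hρ2]
    field_simp
  rw [h1]
  nlinarith [mul_nonneg hε hρ0.le, sq_nonneg ρ]

/-- The signal lost by the normal part is at least mh/2. It must beat the contamination εh and three
errors δ: two sampling deviations and the shift of the threshold. -/
theorem contamination_gap {ε T h h' δ m y : ℝ} (hε0 : 0 ≤ ε) (hε : ε ≤ 1 / 2) (hT0 : 0 ≤ T)
    (hT : T ≤ 1 / 2 - m) (hm : 0 ≤ m) (hh : 0 < h) (hh' : h' ≤ h + δ) (hδ : 0 ≤ δ)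
    (hδh : δ ≤ y * h) (hgap : 3 * y + ε < m / 2) :
    ((1 - ε) * T + ε) * h' + δ < (1 - ε) / 2 * h - δ := by
  have hB1 : (1 - ε) * T + ε ≤ 1 := by nlinarith
  have hB0 : 0 ≤ (1 - ε) * T + ε := add_nonneg (mul_nonneg (by linarith) hT0) hε0
  have h1 : ((1 - ε) * T + ε) * h' ≤ ((1 - ε) * T + ε) * h + δ := by
    calc _ ≤ ((1 - ε) * T + ε) * (h + δ) := mul_le_mul_of_nonneg_left hh' hB0
      _ ≤ _ := by nlinarith
  have h2 : (1 - ε) * T ≤ (1 - ε) * (1 / 2) - m / 2 := by nlinarith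
  have h6 : ((1 - ε) * T + ε) * h ≤ ((1 - ε) * (1 / 2) - m / 2 + ε) * h :=
    mul_le_mul_of_nonneg_right (by linarith) hh.le
  have h7 := mul_lt_mul_of_pos_right hgap hh
  linarith

theorem truncatedDepth_upper_bound {γ : ℝ} (hγ : 0 < γ) {α : ℝ} (hα : 0 < α) :
    ∃ C c : ℝ, 0 < C ∧ 0 < c ∧
      ∀ (p n : ℕ), 0 < p → 0 < n →
      ∀ (μ : Measure (EuclideanSpace ℝ (Fin p))) [IsProbabilityMeasure μ],
      IsSphericalGeneralizedGaussian γ μ →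
      ∀ σ ε : ℝ, 0 < σ → 0 ≤ ε → ε ≤ 1 → Real.sqrt ((p : ℝ) / (n : ℝ)) + ε ≤ c →
        ∀ (β : EuclideanSpace ℝ (Fin p)) (Q : Kernel (EuclideanSpace ℝ (Fin p)) ℝ)
          [IsMarkovKernel Q],
          adaptiveModel n μ β σ ε Q
            {d | ¬ ∀ b, IsTruncatedDepthEstimate d (truncationLevel γ p n ε) b →
              ‖b - β‖ ≤ C * errorRate γ p n σ ε} ≤ ENNReal.ofReal α := by
  obtain ⟨c₁, hc₁, htail⟩ := exists_le_generalizedGaussianReal_Ici hγ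
  have hνprob := isProbabilityMeasure_generalizedGaussianReal hγ
  set Z := ∫ s : ℝ, Real.exp (-|s| ^ γ / 2) with hZdef
  have hZ : 0 < Z := integral_exp_neg_abs_rpow_pos hγ
  -- 252/K = α/4 for each of the four deviation events. `M` is chosen so that M(ε + ρ)/2 exceeds ε +
  -- 3(K/c₁)(ε + 2ρ).
  set K := 1008 / α with hK
  set M := 2 + 12 * (K / c₁) with hM
  have hM0 : 0 < M := by positivity
  set κ := (3 : ℝ) ^ (1 / γ) with hκ
  refine ⟨12 * κ * M, min (1 / 2) (1 / (10 * M)), by positivity, by positivity, ?_⟩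
  intro p n hp hn μ _ hμ σ ε hσ hε0 hε1 hsmall β Q _
  have hPprob := isMarkovKernel_responseKernel β σ hε0 hε1 Q
  set P := μ ⊗ₘ responseKernel β σ ε Q with hP
  have hp' : (0 : ℝ) < p := by exact_mod_cast hp
  have hn' : (0 : ℝ) < n := by exact_mod_cast hn
  set ρ := Real.sqrt ((p : ℝ) / n) with hρ
  have hρ0 : 0 < ρ := Real.sqrt_pos.2 (by positivity)
  have hsmall1 : ρ + ε ≤ 1 / 2 := hsmall.trans (min_le_left _ _)
  have hsmall2 : ρ + ε ≤ 1 / (10 * M) := hsmall.trans (min_le_right _ _)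
  set ℓ := Real.log ((n : ℝ) * ε ^ 2 / p + Real.exp 1) with hℓ
  have hℓ1 : 1 ≤ ℓ := one_le_log_add_exp_one (by positivity)
  have hℓ0 : 0 < ℓ := by linarith
  set t := truncationLevel γ p n ε with ht
  have ht_eq : t = (ℓ / 3) ^ (1 / γ) := rfl
  have htκ : t * κ = ℓ ^ (1 / γ) := by
    rw [ht_eq, hκ, ← Real.mul_rpow (by positivity) (by norm_num)]
    congr 1
    field_simp
  have ht0 : 0 < t := by rw [ht_eq]; positivity
  have hℓγ : 1 ≤ ℓ ^ (1 / γ) := Real.one_le_rpow hℓ1 (by positivity)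
  set h := (generalizedGaussianReal γ).real (Set.Ici t) with hh
  have hhtail : c₁ * Real.exp (-ℓ / 2) ≤ h := by rw [hh, ht_eq]; exact htail ℓ hℓ1
  have hh0 : 0 < h := lt_of_lt_of_le (by positivity) hhtail
  set δ := K * ρ with hδ
  have hδ0 : 0 < δ := by positivity
  -- the deviation is negligible with respect to the tail
  have hδh : c₁ * δ ≤ K * (ε + 2 * ρ) * h := by
    have h1 := sqrt_mul_exp_half_log_le (p := p) (n := n) hp hn hε0
    calc c₁ * δ = K * c₁ * ρ := by rw [hδ]; ring
      _ ≤ K * c₁ * ((ε + 2 * ρ) * Real.exp (-ℓ / 2)) := by gcongr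
      _ = K * (ε + 2 * ρ) * (c₁ * Real.exp (-ℓ / 2)) := by ring
      _ ≤ _ := by gcongr
  -- The lowered threshold is strictly below t, costs at most δ of mass, and keeps at least half of
  -- t.
  set t' := max (t / 2) (t - Z * δ) with ht'
  have ht't : t' < t := by
    have : 0 < Z * δ := by positivity
    exact max_lt (by linarith) (by linarith)
  have ht'2 : t / 2 ≤ t' := le_max_left _ _
  set h' := (generalizedGaussianReal γ).real (Set.Ici t') with hh'
  have hh'le : h' ≤ h + δ := by
    refine (generalizedGaussianReal_Ici_le hγ ht't.le).trans ?_
    have h1 : t - t' ≤ δ * Z := by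
      have := le_max_right (t / 2) (t - Z * δ)
      linarith
    have : (t - t') / Z ≤ δ := by rwa [div_le_iff₀ hZ]
    linarith
  set r := errorRate γ p n σ ε with hr
  have hr_eq : r = σ * (ρ + ε / ℓ ^ (1 / γ)) := rfl
  set θ := 12 * κ * M * r with hθ
  have hr0 : 0 < r := by rw [hr_eq]; positivity
  have hθ0 : 0 < θ := by positivity
  set u := θ * t' / σ with hu
  have hu0 : 0 < u := by positivity
  have hσu : θ * t' = σ * u := by rw [hu]; field_simp
  -- κ converts t into ℓ^(1/γ), and t' ≥ t/2 turns 12 into 6. As 6 > 5, u/5 strictly exceeds M(ρ +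
  -- ε); when min(u, 1) = 1, the smallness condition takes over.
  have hu6 : 6 * M * (ρ + ε) ≤ u := by
    have h1 : ρ + ε ≤ ℓ ^ (1 / γ) * (ρ + ε / ℓ ^ (1 / γ)) := by
      rw [mul_add, mul_div_cancel₀ _ (by positivity)]
      have : ρ ≤ ℓ ^ (1 / γ) * ρ := le_mul_of_one_le_left hρ0.le hℓγ
      linarith
    have h2 : u = 12 * κ * M * (ρ + ε / ℓ ^ (1 / γ)) * t' := by
      rw [hu, hθ, hr_eq]; field_simp
    rw [h2]
    calc 6 * M * (ρ + ε) ≤ 6 * M * (ℓ ^ (1 / γ) * (ρ + ε / ℓ ^ (1 / γ))) := by gcongr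
      _ = 12 * κ * M * (ρ + ε / ℓ ^ (1 / γ)) * (t / 2) := by rw [← htκ]; ring
      _ ≤ _ := by gcongr
  set T := (gaussianReal 0 (Real.toNNReal (σ ^ 2))).real (Set.Ici (θ * t')) with hT
  have hTle : T ≤ 1 / 2 - min u 1 / 5 := by
    rw [hT, hσu]
    exact gaussianReal_Ici_le hσ hu0
  have hT0 : 0 ≤ T := measureReal_nonneg
  have hmin : M * (ε + ρ) < min u 1 / 5 := by
    have hρε : 0 < ρ + ε := by linarith
    have h1 : M * (ρ + ε) ≤ 1 / 10 := by
      calc M * (ρ + ε) ≤ M * (1 / (10 * M)) := by gcongr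
        _ = 1 / 10 := by field_simp
    rcases min_choice u 1 with hm | hm <;> rw [hm]
    · have : 0 < M * (ρ + ε) := by positivity
      linarith
    · linarith
  -- the population gap dominates the deviations
  have hgap : ((1 - ε) * T + ε) * h' + δ < (1 - ε) / 2 * h - δ := by
    refine contamination_gap (m := M * (ε + ρ)) (y := K / c₁ * (ε + 2 * ρ)) hε0 (by linarith) hT0
      (by linarith) (by positivity) hh0 hh'le hδ0.le ?_ ?_
    · rw [div_mul_eq_mul_div, div_mul_eq_mul_div, le_div_iff₀ hc₁]
      linarith
    · have h8 : 0 < K / c₁ := by positivity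
      have h9 : M * (ε + ρ) / 2 = ε + ρ + 6 * (K / c₁ * ε) + 6 * (K / c₁ * ρ) := by
        rw [hM]; ring
      have h10 : 0 ≤ K / c₁ * ε := by positivity
      rw [h9]
      linarith
  have : Nonempty (Fin p) := ⟨⟨0, hp⟩⟩
  have : Nonempty (Metric.sphere (0 : EuclideanSpace ℝ (Fin p)) 1) :=
    (NormedSpace.sphere_nonempty.2 zero_le_one).to_subtype
  let w : ℕ → Metric.sphere (0 : EuclideanSpace ℝ (Fin p)) 1 := TopologicalSpace.denseSeq _
  have hwn : ∀ j, ‖(w j : EuclideanSpace ℝ (Fin p))‖ = 1 := fun j =>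
    mem_sphere_zero_iff_norm.1 (w j).2
  let bad : ℝ → ℝ → ℝ → Set (Fin n → EuclideanSpace ℝ (Fin p) × ℝ) := fun s τ ξ =>
    {d | ∃ j, δ < |empiricalFreq d (orientedEvent β s τ ξ (w j))
        - P.real (orientedEvent β s τ ξ (w j))|}
  have hbad : ∀ s τ ξ, adaptiveModel n μ β σ ε Q (bad s τ ξ) ≤ ENNReal.ofReal (α / 4) := by
    intro s τ ξ
    refine (measure_exists_orientedEvent_deviation_le hp hn P β s τ ξ (fun j => w j) hδ0).trans
      (ENNReal.ofReal_le_ofReal (le_of_eq ?_))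
    change 252 * ρ / (K * ρ) = α / 4
    rw [mul_div_mul_right _ _ hρ0.ne', hK]
    field_simp
    norm_num
  have hsub : {d | ¬ ∀ b, IsTruncatedDepthEstimate d t b → ‖b - β‖ ≤ θ}
      ⊆ (bad 1 t 0 ∪ bad (-1) t 0) ∪ (bad 1 t' θ ∪ bad (-1) t' θ) := by
    intro d hd
    by_contra hgood
    simp only [Set.mem_union, not_or] at hgood
    obtain ⟨⟨g1, g2⟩, g3, g4⟩ := hgood
    have hdev : ∀ {s τ ξ}, d ∉ bad s τ ξ → ∀ j,
        |empiricalFreq d (orientedEvent β s τ ξ (w j))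
          - P.real (orientedEvent β s τ ξ (w j))| ≤ δ := by
      intro s τ ξ hb j
      by_contra hlt
      exact hb ⟨j, not_le.1 hlt⟩
    refine hd fun b hb => norm_sub_le_of_empiricalFreq_bounds hp
      (TopologicalSpace.denseRange_denseSeq _) (w := w) ht0 ht't hθ0.le ?_ ?_ hgap hb
    · intro s hs j
      have h1 : |empiricalFreq d (orientedEvent β s t 0 (w j))
          - P.real (orientedEvent β s t 0 (w j))| ≤ δ := by
        rcases hs with rfl | rfl
        · exact hdev g1 j
        · exact hdev g2 j
      have h2 := le_measureReal_orientedEvent (σ := σ) hγ hμ hε0 hε1 β Q hs t (hwn j)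
      have h3 := (abs_le.1 h1).1
      linarith
    · intro s hs j
      have h1 : |empiricalFreq d (orientedEvent β s t' θ (w j))
          - P.real (orientedEvent β s t' θ (w j))| ≤ δ := by
        rcases hs with rfl | rfl
        · exact hdev g3 j
        · exact hdev g4 j
      have h2 := measureReal_orientedEvent_le (σ := σ) hγ hμ hε0 hε1 β Q hs hθ0.le (τ := t')
        (hwn j)
      have h3 := (abs_le.1 h1).2
      linarith
  refine (measure_mono hsub).trans ((measure_union_le _ _).trans ?_)
  refine (add_le_add ((measure_union_le _ _).trans (add_le_add (hbad _ _ _) (hbad _ _ _)))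
    ((measure_union_le _ _).trans (add_le_add (hbad _ _ _) (hbad _ _ _)))).trans (le_of_eq ?_)
  rw [← ENNReal.ofReal_add (by positivity) (by positivity),
    ← ENNReal.ofReal_add (by positivity) (by positivity)]
  congr 1
  ring

end UpperBound

/-! ### Testing many hypotheses by truncated second moments -/

section Testing

variable {Ω : Type*} [MeasurableSpace Ω]

theorem lintegral_pi_prod_eq_prod {n : ℕ} (P : Measure Ω) [IsProbabilityMeasure P]
    {f : Fin n → Ω → ℝ≥0∞} (hf : ∀ i, Measurable (f i)) :
    ∫⁻ z, ∏ i, f i (z i) ∂(Measure.pi fun _ : Fin n => P) = ∏ i, ∫⁻ x, f i x ∂P := by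
  have hind : iIndepFun (fun i (z : Fin n → Ω) => f i (z i)) (Measure.pi fun _ : Fin n => P) :=
    iIndepFun_pi (μ := fun _ : Fin n => P) fun i => (hf i).aemeasurable
  rw [lintegral_prod_eq_prod_lintegral_of_indepFun _ _ hind
    fun i => (hf i).comp (measurable_pi_apply i)]
  refine Finset.prod_congr rfl fun i _ => ?_
  exact (measurePreserving_eval (fun _ : Fin n => P) i).lintegral_comp (hf i)

theorem pi_withDensity {n : ℕ} (P : Measure Ω) [IsProbabilityMeasure P] {f : Ω → ℝ≥0∞}
    (hf : Measurable f) [IsProbabilityMeasure (P.withDensity f)] :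
    (Measure.pi fun _ : Fin n => P.withDensity f)
      = (Measure.pi fun _ : Fin n => P).withDensity fun z => ∏ i, f (z i) := by
  refine Measure.pi_eq fun s hs => ?_
  rw [withDensity_apply _ (MeasurableSet.univ_pi hs), ← lintegral_indicator
    (MeasurableSet.univ_pi hs)]
  have h1 : ∀ z : Fin n → Ω, (Set.univ.pi s).indicator (fun z => ∏ i, f (z i)) z
      = ∏ i, (s i).indicator f (z i) := fun z => by
    by_cases hz : z ∈ Set.univ.pi s
    · rw [Set.indicator_of_mem hz]
      exact Finset.prod_congr rfl fun i _ => (Set.indicator_of_mem (hz i trivial) f).symm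
    · rw [Set.indicator_of_notMem hz]
      obtain ⟨i, hi⟩ : ∃ i, z i ∉ s i := by simpa [Set.mem_pi] using hz
      exact (Finset.prod_eq_zero (Finset.mem_univ i) (Set.indicator_of_notMem hi f)).symm
  simp_rw [h1]
  rw [lintegral_pi_prod_eq_prod P fun i => hf.indicator (hs i)]
  refine Finset.prod_congr rfl fun i _ => ?_
  rw [lintegral_indicator (hs i), withDensity_apply _ (hs i)]

/-- Bound for the probability of an event under `n` observations with density `ℓ`, on the event
where the exponent `∑ s` of the second moment of the likelihood ratio is at most `a`. -/
theorem pi_withDensity_inter_le {n : ℕ} (P : Measure Ω) [IsProbabilityMeasure P] {ℓ s : Ω → ℝ}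
    (hℓ : Measurable ℓ) (hs : Measurable s) (hℓ0 : ∀ x, 0 ≤ ℓ x)
    [IsProbabilityMeasure (P.withDensity fun x => ENNReal.ofReal (ℓ x))]
    (hchi : ∫⁻ x, ENNReal.ofReal (ℓ x ^ 2 * Real.exp (-s x)) ∂P ≤ 1) (a : ℝ) {c : ℝ} (hc : 0 < c)
    {E : Set (Fin n → Ω)} (hE : MeasurableSet E) :
    (Measure.pi fun _ : Fin n => P.withDensity fun x => ENNReal.ofReal (ℓ x))
        (E ∩ {z | ∑ i, s (z i) ≤ a})
      ≤ ENNReal.ofReal (c / 2) * (Measure.pi fun _ : Fin n => P) E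
        + ENNReal.ofReal (Real.exp a / (2 * c)) := by
  have hS : Measurable fun z : Fin n → Ω => ∑ i, s (z i) :=
    Finset.measurable_sum _ fun i _ => hs.comp (measurable_pi_apply i)
  have hB : MeasurableSet (E ∩ {z : Fin n → Ω | ∑ i, s (z i) ≤ a}) :=
    hE.inter (measurableSet_le hS measurable_const)
  have hmW : ∀ _i : Fin n, Measurable fun x => ENNReal.ofReal (ℓ x ^ 2 * Real.exp (-s x)) :=
    fun _ => ((hℓ.pow_const 2).mul hs.neg.exp).ennreal_ofReal
  rw [pi_withDensity P hℓ.ennreal_ofReal, withDensity_apply _ hB]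
  calc ∫⁻ z in E ∩ {z : Fin n → Ω | ∑ i, s (z i) ≤ a}, ∏ i, ENNReal.ofReal (ℓ (z i))
        ∂(Measure.pi fun _ : Fin n => P)
      ≤ ∫⁻ z in E ∩ {z : Fin n → Ω | ∑ i, s (z i) ≤ a}, (ENNReal.ofReal (c / 2)
          + ENNReal.ofReal (Real.exp a / (2 * c))
            * ∏ i, ENNReal.ofReal (ℓ (z i) ^ 2 * Real.exp (-s (z i))))
        ∂(Measure.pi fun _ : Fin n => P) := by
        refine setLIntegral_mono' hB fun z hz => ?_
        rw [← ENNReal.ofReal_prod_of_nonneg fun i _ => hℓ0 _,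
          ← ENNReal.ofReal_prod_of_nonneg fun i _ => by positivity,
          ← ENNReal.ofReal_mul (by positivity),
          ← ENNReal.ofReal_add (by positivity) (mul_nonneg (by positivity)
            (Finset.prod_nonneg fun i _ => by positivity))]
        refine ENNReal.ofReal_le_ofReal ?_
        rw [Finset.prod_mul_distrib, Finset.prod_pow, ← Real.exp_sum, Finset.sum_neg_distrib]
        set Λ := ∏ i, ℓ (z i)
        have h1 : 1 ≤ Real.exp a * Real.exp (-∑ i, s (z i)) := by
          rw [← Real.exp_add]
          exact Real.one_le_exp (by linarith [hz.2.out])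
        -- Young's inequality bounds the likelihood ratio by its square. On the event the factor
        -- exp(a - ∑ s) is at least one and supplies the weight that makes the second moment
        -- integrable.
        calc Λ ≤ c / 2 + Λ ^ 2 / (2 * c) * 1 := by
              rw [mul_one, div_add_div _ _ (by norm_num) (by positivity),
                le_div_iff₀ (by positivity)]
              nlinarith [sq_nonneg (Λ - c)]
          _ ≤ c / 2 + Λ ^ 2 / (2 * c) * (Real.exp a * Real.exp (-∑ i, s (z i))) := by gcongr
          _ = _ := by ring
    _ = ENNReal.ofReal (c / 2) * (Measure.pi fun _ : Fin n => P)
          (E ∩ {z : Fin n → Ω | ∑ i, s (z i) ≤ a})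
        + ∫⁻ z in E ∩ {z : Fin n → Ω | ∑ i, s (z i) ≤ a},
            ENNReal.ofReal (Real.exp a / (2 * c))
            * ∏ i, ENNReal.ofReal (ℓ (z i) ^ 2 * Real.exp (-s (z i)))
          ∂(Measure.pi fun _ : Fin n => P) := by
        rw [lintegral_add_left measurable_const, setLIntegral_const]
    _ ≤ ENNReal.ofReal (c / 2) * (Measure.pi fun _ : Fin n => P) E
        + ∫⁻ z, ENNReal.ofReal (Real.exp a / (2 * c))
            * ∏ i, ENNReal.ofReal (ℓ (z i) ^ 2 * Real.exp (-s (z i)))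
          ∂(Measure.pi fun _ : Fin n => P) := by
        gcongr
        · exact Set.inter_subset_left
        · exact Measure.restrict_le_self
    _ ≤ _ := by
        gcongr
        rw [lintegral_const_mul' _ _ ENNReal.ofReal_ne_top, lintegral_pi_prod_eq_prod P hmW,
          Finset.prod_const]
        exact (mul_le_mul_right (pow_le_one₀ zero_le hchi) _).trans (mul_one _).le

/-- If many hypotheses have likelihood ratios of small truncated second moment, then for disjoint
acceptance regions some hypothesis is accepted with probability at most one half. -/
theorem exists_pi_withDensity_le_half {n : ℕ} {ι : Type*} (W : Finset ι) (P : Measure Ω)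
    [IsProbabilityMeasure P] {ℓ s : ι → Ω → ℝ} (hℓ : ∀ j, Measurable (ℓ j))
    (hs : ∀ j, Measurable (s j)) (hℓ0 : ∀ j x, 0 ≤ ℓ j x)
    (hprob : ∀ j, IsProbabilityMeasure (P.withDensity fun x => ENNReal.ofReal (ℓ j x)))
    (hchi : ∀ j, ∫⁻ x, ENNReal.ofReal (ℓ j x ^ 2 * Real.exp (-s j x)) ∂P ≤ 1) {a : ℝ}
    (hW : 16 * Real.exp a ≤ W.card)
    (htail : ∀ j ∈ W, (Measure.pi fun _ : Fin n => P.withDensity fun x => ENNReal.ofReal (ℓ j x))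
      {z | a < ∑ i, s j (z i)} ≤ ENNReal.ofReal (1 / 4))
    {E : ι → Set (Fin n → Ω)} (hE : ∀ j, MeasurableSet (E j))
    (hdisj : (W : Set ι).PairwiseDisjoint E) :
    ∃ j ∈ W, (Measure.pi fun _ : Fin n => P.withDensity fun x => ENNReal.ofReal (ℓ j x)) (E j)
      ≤ 1 / 2 := by
  have hWpos : (0 : ℝ) < W.card := lt_of_lt_of_le (by positivity) hW
  have hWne : W.Nonempty := Finset.card_pos.1 (by exact_mod_cast hWpos)
  set N : ℝ := (W.card : ℝ) with hN
  -- Disjointness gives total reference mass at most one, so the N probabilities sum to at most N/8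
  -- + N(1/8 + 1/4) = N/2.
  have hc : 0 < N / 4 := by positivity
  have hone : ∀ j ∈ W,
      (Measure.pi fun _ : Fin n => P.withDensity fun x => ENNReal.ofReal (ℓ j x)) (E j)
      ≤ ENNReal.ofReal (N / 4 / 2) * (Measure.pi fun _ : Fin n => P) (E j)
        + ENNReal.ofReal (3 / 8) := by
    intro j hj
    have := hprob j
    have hsub : E j ⊆ (E j ∩ {z | ∑ i, s j (z i) ≤ a}) ∪ {z | a < ∑ i, s j (z i)} := by
      intro z hz
      rcases le_or_gt (∑ i, s j (z i)) a with h | h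
      · exact Or.inl ⟨hz, h⟩
      · exact Or.inr h
    refine (measure_mono hsub).trans ((measure_union_le _ _).trans ((add_le_add
      (pi_withDensity_inter_le P (hℓ j) (hs j) (hℓ0 j) (hchi j) a hc (hE j)) (htail j hj)).trans ?_))
    rw [add_assoc, ← ENNReal.ofReal_add (by positivity) (by norm_num)]
    gcongr
    have : Real.exp a / (2 * (N / 4)) ≤ 1 / 8 := by
      rw [div_le_iff₀ (by positivity)]
      linarith
    linarith
  by_contra hcon
  push Not at hcon
  refine absurd (ENNReal.sum_lt_sum_of_nonempty hWne hcon) (not_lt.2 ?_)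
  refine (Finset.sum_le_sum hone).trans ?_
  rw [Finset.sum_add_distrib, ← Finset.mul_sum,
    ← measure_biUnion_finset hdisj fun j _ => hE j, Finset.sum_const, Finset.sum_const]
  refine (add_le_add_left (mul_le_mul_right prob_le_one _) _).trans ?_
  simp only [nsmul_eq_mul, mul_one]
  have h1 : (W.card : ℝ≥0∞) = ENNReal.ofReal N := by rw [hN, ENNReal.ofReal_natCast]
  have h2 : (1 / 2 : ℝ≥0∞) = ENNReal.ofReal (1 / 2) := by
    rw [ENNReal.ofReal_div_of_pos (by norm_num), ENNReal.ofReal_one, ENNReal.ofReal_ofNat]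
  rw [h1, h2, ← ENNReal.ofReal_mul hWpos.le, ← ENNReal.ofReal_mul hWpos.le,
    ← ENNReal.ofReal_add (by positivity) (by positivity)]
  refine ENNReal.ofReal_le_ofReal (le_of_eq ?_)
  ring

end Testing

/-! ### Packing the unit ball -/

section Packing

/-- The unit ball of a `p`-dimensional space contains `k ^ p` points at mutual distance at least
`1 / k`. -/
theorem exists_separated_finset (p k : ℕ) (hk : 0 < k) :
    ∃ W : Finset (EuclideanSpace ℝ (Fin p)), W.card = k ^ p ∧ (∀ w ∈ W, ‖w‖ ≤ 1) ∧
      ∀ w ∈ W, ∀ w' ∈ W, w ≠ w' → 1 / (k : ℝ) ≤ ‖w - w'‖ := by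
  classical
  suffices h : ∀ m ≤ k ^ p, ∃ W : Finset (EuclideanSpace ℝ (Fin p)), W.card = m ∧
      (∀ w ∈ W, ‖w‖ ≤ 1) ∧ ∀ w ∈ W, ∀ w' ∈ W, w ≠ w' → 1 / (k : ℝ) ≤ ‖w - w'‖ from
    h _ le_rfl
  have hk' : (0 : ℝ) < k := by exact_mod_cast hk
  intro m
  induction m with
  | zero => exact fun _ => ⟨∅, by simp⟩
  | succ m ih =>
    intro hm
    obtain ⟨W, hcard, hball, hsep⟩ := ih (by omega)
    -- Otherwise m balls of radius 1/k cover the unit ball, and comparing volumes gives m ≥ k^p.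
    obtain ⟨u, hu, huW⟩ : ∃ u ∈ Metric.ball (0 : EuclideanSpace ℝ (Fin p)) 1,
        ∀ w ∈ W, u ∉ Metric.ball w (1 / (k : ℝ)) := by
      by_contra hcon
      push Not at hcon
      have hsub : Metric.ball (0 : EuclideanSpace ℝ (Fin p)) 1
          ⊆ ⋃ w ∈ W, Metric.ball w (1 / (k : ℝ)) := fun u hu => by
        obtain ⟨w, hw, huw⟩ := hcon u hu
        exact Set.mem_biUnion hw huw
      set V := volume (Metric.ball (0 : EuclideanSpace ℝ (Fin p)) 1) with hV
      have hV0 : V ≠ 0 := (Metric.measure_ball_pos _ _ zero_lt_one).ne'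
      have hVtop : V ≠ ∞ := measure_ball_lt_top.ne
      have h1 : V ≤ m * (ENNReal.ofReal ((1 / (k : ℝ)) ^ p) * V) := by
        refine (measure_mono hsub).trans ((measure_biUnion_finset_le _ _).trans ?_)
        refine (Finset.sum_le_card_nsmul W _ _ fun w _ => le_of_eq ?_).trans
          (by rw [hcard, nsmul_eq_mul])
        rw [Measure.addHaar_ball_of_pos volume w (by positivity), finrank_euclideanSpace_fin]
      rw [← mul_assoc] at h1
      have h2 : (1 : ℝ≥0∞) ≤ m * ENNReal.ofReal ((1 / (k : ℝ)) ^ p) := by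
        rwa [← ENNReal.mul_le_mul_iff_left hV0 hVtop, one_mul]
      rw [← ENNReal.ofReal_natCast, ← ENNReal.ofReal_mul (by positivity), ENNReal.one_le_ofReal,
        one_div, inv_pow, ← div_eq_mul_inv, le_div_iff₀ (by positivity), one_mul] at h2
      have h3 : k ^ p ≤ m := by exact_mod_cast h2
      omega
    have huW' : u ∉ W := fun h => huW u h (Metric.mem_ball_self (by positivity))
    have hdist : ∀ w ∈ W, 1 / (k : ℝ) ≤ ‖u - w‖ := fun w hw => by
      have := huW w hw
      rwa [Metric.mem_ball, not_lt, dist_eq_norm] at this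
    refine ⟨insert u W, by rw [Finset.card_insert_of_notMem huW', hcard], fun w hw => ?_,
      fun w hw w' hw' hne => ?_⟩
    · rcases Finset.mem_insert.1 hw with rfl | h
      · exact (mem_ball_zero_iff.1 hu).le
      · exact hball w h
    · rcases Finset.mem_insert.1 hw with h | h <;> rcases Finset.mem_insert.1 hw' with h' | h'
      · exact absurd (h.trans h'.symm) hne
      · rw [h]; exact hdist w' h'
      · rw [h', norm_sub_rev]; exact hdist w h
      · exact hsep w h w' h' hne

end Packing

/-! ### Least favorable contamination -/

section LeastFavorable

theorem toNNReal_sq_ne_zero {σ : ℝ} (hσ : 0 < σ) : Real.toNNReal (σ ^ 2) ≠ 0 := by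
  rw [ne_eq, Real.toNNReal_eq_zero, not_le]
  positivity

theorem gaussianPDFReal_sq_eq {σ : ℝ} (m y : ℝ) :
    gaussianPDFReal m (Real.toNNReal (σ ^ 2)) y
      = (Real.sqrt (2 * Real.pi * σ ^ 2))⁻¹ * Real.exp (-(y - m) ^ 2 / (2 * σ ^ 2)) := by
  rw [gaussianPDFReal, Real.coe_toNNReal _ (sq_nonneg σ)]

theorem gaussianPDFReal_eq_exp_mul {σ : ℝ} (hσ : 0 < σ) (m y : ℝ) :
    gaussianPDFReal m (Real.toNNReal (σ ^ 2)) y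
      = Real.exp (m * y / σ ^ 2 - m ^ 2 / (2 * σ ^ 2))
        * gaussianPDFReal 0 (Real.toNNReal (σ ^ 2)) y := by
  rw [gaussianPDFReal_sq_eq, gaussianPDFReal_sq_eq, mul_left_comm, ← Real.exp_add]
  congr 2
  field_simp
  ring

theorem gaussianPDFReal_sq_mul {σ : ℝ} (hσ : 0 < σ) (m c y : ℝ) :
    gaussianPDFReal m (Real.toNNReal (σ ^ 2)) y ^ 2
      = Real.exp (((m - c) / σ) ^ 2) * gaussianPDFReal (2 * m - c) (Real.toNNReal (σ ^ 2)) y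
        * gaussianPDFReal c (Real.toNNReal (σ ^ 2)) y := by
  simp only [gaussianPDFReal_sq_eq]
  have key : Real.exp (-(y - m) ^ 2 / (2 * σ ^ 2)) ^ 2 = Real.exp (((m - c) / σ) ^ 2)
      * Real.exp (-(y - (2 * m - c)) ^ 2 / (2 * σ ^ 2))
      * Real.exp (-(y - c) ^ 2 / (2 * σ ^ 2)) := by
    rw [← Real.exp_nat_mul, ← Real.exp_add, ← Real.exp_add]
    congr 1
    push_cast
    field_simp
    ring
  rw [mul_pow, key]
  ring

/-- The unnormalised density `y ↦ e^{η |y| / σ} φ(y)`, which dominates all the normal densities with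
mean at most `η σ` in absolute value. -/
noncomputable def tiltedPDF (σ η y : ℝ) : ℝ :=
  Real.exp (η * |y| / σ) * gaussianPDFReal 0 (Real.toNNReal (σ ^ 2)) y

theorem measurable_tiltedPDF (σ η : ℝ) : Measurable (tiltedPDF σ η) := by
  have := measurable_gaussianPDFReal 0 (Real.toNNReal (σ ^ 2))
  unfold tiltedPDF
  fun_prop

theorem tiltedPDF_pos {σ : ℝ} (hσ : 0 < σ) (η y : ℝ) : 0 < tiltedPDF σ η y :=
  mul_pos (Real.exp_pos _) (gaussianPDFReal_pos _ _ _ (toNNReal_sq_ne_zero hσ))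

theorem gaussianPDFReal_le_tiltedPDF {σ η m : ℝ} (hσ : 0 < σ) (hm : |m| ≤ η * σ) (y : ℝ) :
    gaussianPDFReal m (Real.toNNReal (σ ^ 2)) y ≤ tiltedPDF σ η y := by
  rw [gaussianPDFReal_eq_exp_mul hσ, tiltedPDF]
  refine mul_le_mul_of_nonneg_right (Real.exp_le_exp.2 ?_) (gaussianPDFReal_nonneg _ _ _)
  have h1 : m * y ≤ η * σ * |y| :=
    (le_abs_self _).trans (by rw [abs_mul]; gcongr)
  have h2 : m * y / σ ^ 2 ≤ η * σ * |y| / σ ^ 2 := by gcongr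
  have h3 : η * σ * |y| / σ ^ 2 = η * |y| / σ := by field_simp
  have h4 : 0 ≤ m ^ 2 / (2 * σ ^ 2) := by positivity
  linarith

/-- Convexity of exp in η reduces to η = 1, where exp(|y|/σ) ≤ exp(y/σ) + exp(-y/σ), and each tilt
is √e times a shift of the normal density by ±σ. -/
theorem tiltedPDF_le {σ η : ℝ} (hσ : 0 < σ) (h0 : 0 ≤ η) (h1 : η ≤ 1) (y : ℝ) :
    tiltedPDF σ η y ≤ (1 - η) * gaussianPDFReal 0 (Real.toNNReal (σ ^ 2)) y
      + η * (Real.exp (1 / 2) * (gaussianPDFReal σ (Real.toNNReal (σ ^ 2)) y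
        + gaussianPDFReal (-σ) (Real.toNNReal (σ ^ 2)) y)) := by
  have hconv := convexOn_exp.2 (Set.mem_univ (0 : ℝ)) (Set.mem_univ (|y| / σ))
    (by linarith : 0 ≤ 1 - η) h0 (by ring)
  simp only [smul_eq_mul, mul_zero, zero_add, Real.exp_zero, mul_one] at hconv
  have hexp : Real.exp (|y| / σ) ≤ Real.exp (y / σ) + Real.exp (-y / σ) := by
    rcases abs_cases y with ⟨h, _⟩ | ⟨h, _⟩
    · rw [h]; linarith [Real.exp_pos (-y / σ)]
    · rw [h]; linarith [Real.exp_pos (y / σ)]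
  have e1 : Real.exp (1 / 2) * Real.exp (σ * y / σ ^ 2 - σ ^ 2 / (2 * σ ^ 2))
      = Real.exp (y / σ) := by
    rw [← Real.exp_add]
    congr 1
    field_simp
    ring
  have e2 : Real.exp (1 / 2) * Real.exp (-σ * y / σ ^ 2 - (-σ) ^ 2 / (2 * σ ^ 2))
      = Real.exp (-y / σ) := by
    rw [← Real.exp_add]
    congr 1
    field_simp
    ring
  rw [gaussianPDFReal_eq_exp_mul hσ σ, gaussianPDFReal_eq_exp_mul hσ (-σ), ← add_mul,
    ← mul_assoc (Real.exp (1 / 2)), mul_add (Real.exp (1 / 2)), e1, e2, tiltedPDF, ← mul_assoc,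
    ← add_mul]
  refine mul_le_mul_of_nonneg_right ?_ (gaussianPDFReal_nonneg _ _ _)
  rw [mul_div_assoc]
  refine hconv.trans ?_
  gcongr

theorem integrable_tiltedPDF {σ η : ℝ} (hσ : 0 < σ) (h0 : 0 ≤ η) (h1 : η ≤ 1) :
    Integrable (tiltedPDF σ η) := by
  refine Integrable.mono' (((integrable_gaussianPDFReal 0 (Real.toNNReal (σ ^ 2))).const_mul
    (1 - η)).add ((((integrable_gaussianPDFReal σ (Real.toNNReal (σ ^ 2))).add
    (integrable_gaussianPDFReal (-σ) (Real.toNNReal (σ ^ 2)))).const_mul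
    (Real.exp (1 / 2))).const_mul η)) (measurable_tiltedPDF σ η).aestronglyMeasurable
    (Filter.Eventually.of_forall fun y => ?_)
  rw [Real.norm_of_nonneg (tiltedPDF_pos hσ η y).le]
  exact tiltedPDF_le hσ h0 h1 y

theorem integral_tiltedPDF_le {σ η : ℝ} (hσ : 0 < σ) (h0 : 0 ≤ η) (h1 : η ≤ 1) :
    ∫ y, tiltedPDF σ η y ≤ 1 + 4 * η := by
  have hv := toNNReal_sq_ne_zero hσ
  have i0 := (integrable_gaussianPDFReal 0 (Real.toNNReal (σ ^ 2))).const_mul (1 - η)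
  have i1 := integrable_gaussianPDFReal σ (Real.toNNReal (σ ^ 2))
  have i2 := integrable_gaussianPDFReal (-σ) (Real.toNNReal (σ ^ 2))
  have i3 := ((i1.add i2).const_mul (Real.exp (1 / 2))).const_mul η
  have h := integral_mono (integrable_tiltedPDF hσ h0 h1) (i0.add i3) (tiltedPDF_le hσ h0 h1)
  have heq : ∫ y, ((fun y => (1 - η) * gaussianPDFReal 0 (Real.toNNReal (σ ^ 2)) y)
      + fun y => η * (Real.exp (1 / 2) * (gaussianPDFReal σ (Real.toNNReal (σ ^ 2))
        + gaussianPDFReal (-σ) (Real.toNNReal (σ ^ 2))) y)) y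
      = (1 - η) + η * (Real.exp (1 / 2) * 2) := by
    rw [integral_add' i0 i3, integral_const_mul, integral_const_mul, integral_const_mul,
      integral_add' i1 i2, integral_gaussianPDFReal_eq_one _ hv,
      integral_gaussianPDFReal_eq_one _ hv, integral_gaussianPDFReal_eq_one _ hv]
    ring
  refine h.trans (heq.le.trans ?_)
  have he : Real.exp (1 / 2) ≤ 2 := by
    have h5 := Real.exp_one_lt_d9
    have h6 : Real.exp (1 / 2 : ℝ) ^ 2 = Real.exp 1 := by
      rw [← Real.exp_nat_mul]; norm_num
    nlinarith [Real.exp_pos (1 / 2 : ℝ)]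
  nlinarith

/-- The mean `m` truncated to `[-ησ, ησ]`. -/
noncomputable def clampMean (σ η m : ℝ) : ℝ := max (-(η * σ)) (min (η * σ) m)

theorem abs_clampMean_le {σ η : ℝ} (h : 0 ≤ η * σ) (m : ℝ) : |clampMean σ η m| ≤ η * σ :=
  abs_le.2 ⟨le_max_left _ _, max_le (by linarith) (min_le_left _ _)⟩

/-- The normalised tilted density. -/
noncomputable def referencePDF (σ η y : ℝ) : ℝ := tiltedPDF σ η y / ∫ z, tiltedPDF σ η z

/-- The density of the contaminated response with mean `m`. -/
noncomputable def contaminatedPDF (σ η ε m y : ℝ) : ℝ :=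
  referencePDF σ η y + (1 - ε) * (gaussianPDFReal m (Real.toNNReal (σ ^ 2)) y
    - gaussianPDFReal (clampMean σ η m) (Real.toNNReal (σ ^ 2)) y)

theorem measurable_referencePDF (σ η : ℝ) : Measurable (referencePDF σ η) :=
  (measurable_tiltedPDF σ η).div_const _

theorem measurable_uncurry_contaminatedPDF (σ η ε : ℝ) :
    Measurable fun q : ℝ × ℝ => contaminatedPDF σ η ε q.1 q.2 := by
  have h1 := measurable_uncurry_gaussianPDFReal
  have h2 : Measurable fun q : ℝ × ℝ => gaussianPDFReal q.1 (Real.toNNReal (σ ^ 2)) q.2 :=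
    h1.comp (f := fun q : ℝ × ℝ => (q.1, Real.toNNReal (σ ^ 2), q.2)) (by fun_prop)
  have h3 : Measurable fun q : ℝ × ℝ =>
      gaussianPDFReal (clampMean σ η q.1) (Real.toNNReal (σ ^ 2)) q.2 :=
    h2.comp (f := fun q : ℝ × ℝ => (clampMean σ η q.1, q.2)) (by unfold clampMean; fun_prop)
  exact ((measurable_referencePDF σ η).comp measurable_snd).add ((h2.sub h3).const_mul _)

variable {σ ε : ℝ}

theorem integral_tiltedPDF_pos (hσ : 0 < σ) {η : ℝ} (h0 : 0 ≤ η) (h1 : η ≤ 1) :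
    0 < ∫ y, tiltedPDF σ η y := by
  have h := integral_mono (integrable_gaussianPDFReal 0 (Real.toNNReal (σ ^ 2)))
    (integrable_tiltedPDF hσ h0 h1)
    fun y => gaussianPDFReal_le_tiltedPDF hσ (by rw [abs_zero]; positivity) y
  rw [integral_gaussianPDFReal_eq_one _ (toNNReal_sq_ne_zero hσ)] at h
  linarith

theorem referencePDF_pos (hσ : 0 < σ) {η : ℝ} (h0 : 0 ≤ η) (h1 : η ≤ 1) (y : ℝ) :
    0 < referencePDF σ η y :=
  div_pos (tiltedPDF_pos hσ η y) (integral_tiltedPDF_pos hσ h0 h1)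

theorem integrable_referencePDF (hσ : 0 < σ) {η : ℝ} (h0 : 0 ≤ η) (h1 : η ≤ 1) :
    Integrable (referencePDF σ η) :=
  (integrable_tiltedPDF hσ h0 h1).div_const _

theorem integral_referencePDF (hσ : 0 < σ) {η : ℝ} (h0 : 0 ≤ η) (h1 : η ≤ 1) :
    ∫ y, referencePDF σ η y = 1 := by
  unfold referencePDF
  rw [integral_div, div_self (integral_tiltedPDF_pos hσ h0 h1).ne']

/-- This leaves room for a nonnegative contamination density. The choice η = ε/4 makes the
normalizing constant at most 1 + ε, and (1 - ε)(1 + ε) ≤ 1. -/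
theorem mul_gaussianPDFReal_clampMean_le (hσ : 0 < σ) (h0 : 0 ≤ ε) (h1 : ε ≤ 1) (m y : ℝ) :
    (1 - ε) * gaussianPDFReal (clampMean σ (ε / 4) m) (Real.toNNReal (σ ^ 2)) y
      ≤ referencePDF σ (ε / 4) y := by
  have hη0 : 0 ≤ ε / 4 := by linarith
  have hη1 : ε / 4 ≤ 1 := by linarith
  have hZ := integral_tiltedPDF_pos hσ hη0 hη1
  rw [referencePDF, le_div_iff₀ hZ]
  have h2 := gaussianPDFReal_le_tiltedPDF hσ
    (abs_clampMean_le (σ := σ) (η := ε / 4) (by positivity) m) y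
  have h3 := gaussianPDFReal_nonneg (clampMean σ (ε / 4) m) (Real.toNNReal (σ ^ 2)) y
  have h4 := integral_tiltedPDF_le hσ hη0 hη1
  have h5 : (1 - ε) * ∫ y, tiltedPDF σ (ε / 4) y ≤ 1 := by
    have := mul_le_mul_of_nonneg_left h4 (by linarith : 0 ≤ 1 - ε)
    nlinarith
  calc _ = ((1 - ε) * ∫ y, tiltedPDF σ (ε / 4) y)
        * gaussianPDFReal (clampMean σ (ε / 4) m) (Real.toNNReal (σ ^ 2)) y := by ring
    _ ≤ 1 * gaussianPDFReal (clampMean σ (ε / 4) m) (Real.toNNReal (σ ^ 2)) y := by gcongr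
    _ ≤ _ := by rwa [one_mul]

theorem contaminatedPDF_nonneg (hσ : 0 < σ) (h0 : 0 ≤ ε) (h1 : ε ≤ 1) (m y : ℝ) :
    0 ≤ contaminatedPDF σ (ε / 4) ε m y := by
  have h2 := mul_gaussianPDFReal_clampMean_le hσ h0 h1 m y
  have h3 := mul_nonneg (by linarith : 0 ≤ 1 - ε)
    (gaussianPDFReal_nonneg m (Real.toNNReal (σ ^ 2)) y)
  rw [contaminatedPDF]
  linarith

/-- Because the reference dominates (1 - ε) times the clamped normal, the quadratic term of the
expansion is at most (1 - ε) times the χ² integrand of two normals with means m and c. Integrating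
leaves ε + (1 - ε)A ≤ A. -/
theorem lintegral_contaminatedPDF_sq_div_le (hσ : 0 < σ) (h0 : 0 ≤ ε) (h1 : ε ≤ 1) (m : ℝ) :
    ∫⁻ y, ENNReal.ofReal (contaminatedPDF σ (ε / 4) ε m y ^ 2 / referencePDF σ (ε / 4) y)
      ≤ ENNReal.ofReal (Real.exp (((m - clampMean σ (ε / 4) m) / σ) ^ 2)) := by
  have hη0 : 0 ≤ ε / 4 := by linarith
  have hη1 : ε / 4 ≤ 1 := by linarith
  have hv := toNNReal_sq_ne_zero hσ
  set v := Real.toNNReal (σ ^ 2) with hvdef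
  set c := clampMean σ (ε / 4) m with hc
  set A := Real.exp (((m - c) / σ) ^ 2) with hA
  have hA1 : 1 ≤ A := Real.one_le_exp (sq_nonneg _)
  let R : ℝ → ℝ := fun y => (referencePDF σ (ε / 4) y - (1 - ε) * gaussianPDFReal c v y)
    + (1 - ε) * (A * gaussianPDFReal (2 * m - c) v y)
  have hpt : ∀ y, contaminatedPDF σ (ε / 4) ε m y ^ 2 / referencePDF σ (ε / 4) y ≤ R y := by
    intro y
    have hg := referencePDF_pos hσ hη0 hη1 y
    have hdom := mul_gaussianPDFReal_clampMean_le hσ h0 h1 m y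
    have hsq := gaussianPDFReal_sq_mul hσ m c y
    have hcpos := gaussianPDFReal_pos c v y hv
    rw [div_le_iff₀ hg, contaminatedPDF]
    simp only [R]
    rw [← hvdef, ← hc] at *
    set g := referencePDF σ (ε / 4) y
    set a := gaussianPDFReal m v y
    set b := gaussianPDFReal c v y
    set X := A * gaussianPDFReal (2 * m - c) v y
    have hX : X = b + 2 * (a - b) + (a - b) ^ 2 / b := by
      have : X * b = a ^ 2 := hsq.symm
      field_simp
      linarith
    have hX' : (a - b) ^ 2 = (a - b) ^ 2 / b * b := by field_simp
    set Y := (a - b) ^ 2 / b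
    rw [hX]
    have h5 : (1 - ε) ^ 2 * (a - b) ^ 2 ≤ (1 - ε) * g * Y := by
      rw [hX']
      calc (1 - ε) ^ 2 * (Y * b) = (1 - ε) * Y * ((1 - ε) * b) := by ring
        _ ≤ (1 - ε) * Y * g := by gcongr
        _ = _ := by ring
    nlinarith
  have hRnn : ∀ y, 0 ≤ R y := fun y =>
    (div_nonneg (sq_nonneg _) (referencePDF_pos hσ hη0 hη1 y).le).trans (hpt y)
  have i1 := integrable_referencePDF hσ hη0 hη1
  have i2 := (integrable_gaussianPDFReal c v).const_mul (1 - ε)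
  have i3 := ((integrable_gaussianPDFReal (2 * m - c) v).const_mul A).const_mul (1 - ε)
  calc _ ≤ ∫⁻ y, ENNReal.ofReal (R y) :=
        lintegral_mono fun y => ENNReal.ofReal_le_ofReal (hpt y)
    _ = ENNReal.ofReal (∫ y, R y) := (ofReal_integral_eq_lintegral_ofReal ((i1.sub i2).add i3)
        (Filter.Eventually.of_forall hRnn)).symm
    _ ≤ _ := by
        refine ENNReal.ofReal_le_ofReal ?_
        have : ∫ y, R y = 1 - (1 - ε) + (1 - ε) * A := by
          have i12 : Integrable fun y => referencePDF σ (ε / 4) y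
              - (1 - ε) * gaussianPDFReal c v y := i1.sub i2
          simp only [R]
          rw [integral_add i12 i3, integral_sub i1 i2, integral_const_mul,
            integral_const_mul, integral_const_mul, integral_referencePDF hσ hη0 hη1,
            integral_gaussianPDFReal_eq_one _ hv, integral_gaussianPDFReal_eq_one _ hv]
          ring
        rw [this]
        nlinarith

/-- The least favorable reference law of the response. -/
noncomputable def referenceMeasure (σ η : ℝ) : Measure ℝ :=
  volume.withDensity fun y => ENNReal.ofReal (referencePDF σ η y)

theorem isProbabilityMeasure_referenceMeasure (hσ : 0 < σ) {η : ℝ} (h0 : 0 ≤ η) (h1 : η ≤ 1) :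
    IsProbabilityMeasure (referenceMeasure σ η) := by
  refine ⟨?_⟩
  rw [referenceMeasure, withDensity_apply _ MeasurableSet.univ, Measure.restrict_univ,
    ← ofReal_integral_eq_lintegral_ofReal (integrable_referencePDF hσ h0 h1)
      (Filter.Eventually.of_forall fun y => (referencePDF_pos hσ h0 h1 y).le),
    integral_referencePDF hσ h0 h1, ENNReal.ofReal_one]

variable {p : ℕ}

/-- The contamination kernel which makes the responses as uninformative as possible. -/
theorem exists_kernel_contaminatedPDF (hσ : 0 < σ) (h0 : 0 ≤ ε) (h1 : ε ≤ 1)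
    (β : EuclideanSpace ℝ (Fin p)) :
    ∃ Q : Kernel (EuclideanSpace ℝ (Fin p)) ℝ, IsMarkovKernel Q ∧
      ∀ x, responseKernel β σ ε Q x = volume.withDensity fun y =>
        ENNReal.ofReal (contaminatedPDF σ (ε / 4) ε (inner ℝ x β) y) := by
  have hη0 : 0 ≤ ε / 4 := by linarith
  have hη1 : ε / 4 ≤ 1 := by linarith
  have hv := toNNReal_sq_ne_zero hσ
  set v := Real.toNNReal (σ ^ 2) with hvdef
  have hresp : ∀ (Q : Kernel (EuclideanSpace ℝ (Fin p)) ℝ) x, responseKernel β σ ε Q x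
      = ENNReal.ofReal (1 - ε) • gaussianReal (inner ℝ x β) v + ENNReal.ofReal ε • Q x :=
    fun _ _ => rfl
  rcases h0.eq_or_lt with rfl | hε
  -- For ε = 0 there is nothing to divide by. Any kernel serves, because the tilt is trivial and the
  -- clamped mean is zero.
  · refine ⟨Kernel.const _ (Measure.dirac 0), inferInstance, fun x => ?_⟩
    rw [hresp]
    simp only [sub_zero, ENNReal.ofReal_one, one_smul, ENNReal.ofReal_zero, zero_smul, add_zero]
    rw [gaussianReal_of_var_ne_zero _ hv]
    congr 1
    funext y
    have hz : ∀ y, tiltedPDF σ (0 / 4) y = gaussianPDFReal 0 v y := fun y => by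
      simp [tiltedPDF, hvdef]
    have hcl : clampMean σ (0 / 4) (inner ℝ x β) = 0 := by
      simp [clampMean]
    rw [contaminatedPDF, referencePDF, hcl]
    simp_rw [hz]
    rw [integral_gaussianPDFReal_eq_one _ hv, gaussianPDF]
    congr 1
    ring
  -- The contamination fills in the part of the reference density not covered by the clamped normal.
  · let q : EuclideanSpace ℝ (Fin p) → ℝ → ℝ := fun x y =>
      (referencePDF σ (ε / 4) y
        - (1 - ε) * gaussianPDFReal (clampMean σ (ε / 4) (inner ℝ x β)) v y) / ε
    have hq0 : ∀ x y, 0 ≤ q x y := fun x y =>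
      div_nonneg (sub_nonneg.2 (mul_gaussianPDFReal_clampMean_le hσ h0 h1 _ y)) hε.le
    have hqm : Measurable (Function.uncurry fun x y => ENNReal.ofReal (q x y)) := by
      have h2 : Measurable fun z : EuclideanSpace ℝ (Fin p) × ℝ =>
          gaussianPDFReal (clampMean σ (ε / 4) (inner ℝ z.1 β)) v z.2 :=
        measurable_uncurry_gaussianPDFReal.comp
          (f := fun z : EuclideanSpace ℝ (Fin p) × ℝ =>
            (clampMean σ (ε / 4) (inner ℝ z.1 β), v, z.2)) (by unfold clampMean; fun_prop)
      exact ((((measurable_referencePDF σ (ε / 4)).comp measurable_snd).sub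
        (h2.const_mul _)).div_const _).ennreal_ofReal
    let Q : Kernel (EuclideanSpace ℝ (Fin p)) ℝ :=
      (Kernel.const _ (volume : Measure ℝ)).withDensity fun x y => ENNReal.ofReal (q x y)
    have hQ : ∀ x, Q x = volume.withDensity fun y => ENNReal.ofReal (q x y) := fun x => by
      rw [Kernel.withDensity_apply _ hqm, Kernel.const_apply]
    refine ⟨Q, ⟨fun x => ⟨?_⟩⟩, fun x => ?_⟩
    · rw [hQ, withDensity_apply _ MeasurableSet.univ, Measure.restrict_univ]
      have i1 := integrable_referencePDF hσ hη0 hη1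
      have i2 := (integrable_gaussianPDFReal (clampMean σ (ε / 4) (inner ℝ x β)) v).const_mul
        (1 - ε)
      have iq : Integrable (q x) := (i1.sub i2).div_const ε
      rw [← ofReal_integral_eq_lintegral_ofReal iq (Filter.Eventually.of_forall (hq0 x))]
      simp only [q]
      rw [integral_div, integral_sub i1 i2, integral_const_mul,
        integral_referencePDF hσ hη0 hη1, integral_gaussianPDFReal_eq_one _ hv,
        ← ENNReal.ofReal_one]
      congr 1
      field_simp
      ring
    · rw [hresp, hQ, gaussianReal_of_var_ne_zero _ hv, ← withDensity_smul _
        (measurable_gaussianPDF _ _), ← withDensity_smul _ hqm.of_uncurry_left,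
        ← withDensity_add_left ((measurable_gaussianPDF _ _).const_smul _)]
      congr 1
      funext y
      simp only [Pi.add_apply, Pi.smul_apply, smul_eq_mul, gaussianPDF]
      rw [← ENNReal.ofReal_mul (by linarith), ← ENNReal.ofReal_mul h0,
        ← ENNReal.ofReal_add (mul_nonneg (by linarith) (gaussianPDFReal_nonneg _ _ _))
          (mul_nonneg h0 (hq0 x y))]
      congr 1
      simp only [q, contaminatedPDF]
      field_simp
      ring

/-- The likelihood ratio of the contaminated model with respect to the reference law. -/
noncomputable def contaminatedRatio (σ ε : ℝ) (β : EuclideanSpace ℝ (Fin p))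
    (z : EuclideanSpace ℝ (Fin p) × ℝ) : ℝ :=
  contaminatedPDF σ (ε / 4) ε (inner ℝ z.1 β) z.2 / referencePDF σ (ε / 4) z.2

theorem measurable_contaminatedRatio (σ ε : ℝ) (β : EuclideanSpace ℝ (Fin p)) :
    Measurable (contaminatedRatio σ ε β) := by
  have h1 : Measurable fun z : EuclideanSpace ℝ (Fin p) × ℝ =>
      contaminatedPDF σ (ε / 4) ε (inner ℝ z.1 β) z.2 :=
    (measurable_uncurry_contaminatedPDF σ (ε / 4) ε).comp
      (f := fun z : EuclideanSpace ℝ (Fin p) × ℝ => (inner ℝ z.1 β, z.2)) (by fun_prop)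
  exact h1.div ((measurable_referencePDF σ (ε / 4)).comp measurable_snd)

theorem contaminatedRatio_nonneg (hσ : 0 < σ) (h0 : 0 ≤ ε) (h1 : ε ≤ 1)
    (β : EuclideanSpace ℝ (Fin p)) (z : EuclideanSpace ℝ (Fin p) × ℝ) :
    0 ≤ contaminatedRatio σ ε β z :=
  div_nonneg (contaminatedPDF_nonneg hσ h0 h1 _ _)
    (referencePDF_pos hσ (by linarith) (by linarith) _).le

theorem compProd_eq_withDensity_contaminatedRatio (hσ : 0 < σ) (h0 : 0 ≤ ε) (h1 : ε ≤ 1)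
    {β : EuclideanSpace ℝ (Fin p)} {Q : Kernel (EuclideanSpace ℝ (Fin p)) ℝ} [IsMarkovKernel Q]
    (hQ : ∀ x, responseKernel β σ ε Q x = volume.withDensity fun y =>
        ENNReal.ofReal (contaminatedPDF σ (ε / 4) ε (inner ℝ x β) y))
    (μ : Measure (EuclideanSpace ℝ (Fin p))) [IsProbabilityMeasure μ] :
    μ ⊗ₘ responseKernel β σ ε Q = (μ.prod (referenceMeasure σ (ε / 4))).withDensity
      fun z => ENNReal.ofReal (contaminatedRatio σ ε β z) := by
  have hη0 : 0 ≤ ε / 4 := by linarith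
  have hη1 : ε / 4 ≤ 1 := by linarith
  have := isProbabilityMeasure_referenceMeasure hσ hη0 hη1
  have hM := isMarkovKernel_responseKernel β σ h0 h1 Q
  have hm : Measurable (Function.uncurry fun (x : EuclideanSpace ℝ (Fin p)) (y : ℝ) =>
      ENNReal.ofReal (contaminatedRatio σ ε β (x, y))) :=
    (measurable_contaminatedRatio σ ε β).ennreal_ofReal
  have hker : responseKernel β σ ε Q = (Kernel.const _ (referenceMeasure σ (ε / 4))).withDensity
      fun x y => ENNReal.ofReal (contaminatedRatio σ ε β (x, y)) := by
    ext1 x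
    rw [hQ, Kernel.withDensity_apply _ hm, Kernel.const_apply, referenceMeasure,
      ← withDensity_mul _ (measurable_referencePDF σ (ε / 4)).ennreal_ofReal hm.of_uncurry_left]
    congr 1
    funext y
    have hg := referencePDF_pos hσ hη0 hη1 y
    rw [Pi.mul_apply, ← ENNReal.ofReal_mul hg.le, contaminatedRatio,
      mul_div_cancel₀ _ hg.ne']
  rw [hker] at hM ⊢
  rw [Measure.compProd_withDensity hm, Measure.compProd_const]

theorem lintegral_contaminatedRatio_sq_le (hσ : 0 < σ) (h0 : 0 ≤ ε) (h1 : ε ≤ 1)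
    (β : EuclideanSpace ℝ (Fin p)) (μ : Measure (EuclideanSpace ℝ (Fin p)))
    [IsProbabilityMeasure μ] :
    ∫⁻ z, ENNReal.ofReal (contaminatedRatio σ ε β z ^ 2
        * Real.exp (-((inner ℝ z.1 β - clampMean σ (ε / 4) (inner ℝ z.1 β)) / σ) ^ 2))
      ∂(μ.prod (referenceMeasure σ (ε / 4))) ≤ 1 := by
  have hη0 : 0 ≤ ε / 4 := by linarith
  have hη1 : ε / 4 ≤ 1 := by linarith
  have := isProbabilityMeasure_referenceMeasure hσ hη0 hη1
  have hmr := measurable_contaminatedRatio σ ε β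
  have hm : Measurable fun z : EuclideanSpace ℝ (Fin p) × ℝ =>
      ENNReal.ofReal (contaminatedRatio σ ε β z ^ 2
        * Real.exp (-((inner ℝ z.1 β - clampMean σ (ε / 4) (inner ℝ z.1 β)) / σ) ^ 2)) := by
    unfold clampMean
    fun_prop
  rw [lintegral_prod _ hm.aemeasurable]
  calc _ ≤ ∫⁻ _x, (1 : ℝ≥0∞) ∂μ := ?_
    _ = 1 := by simp
  refine lintegral_mono fun x => ?_
  set D := ((inner ℝ x β - clampMean σ (ε / 4) (inner ℝ x β)) / σ) ^ 2 with hD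
  have hmy : Measurable fun y => ENNReal.ofReal (contaminatedRatio σ ε β (x, y) ^ 2) :=
    ((hmr.comp measurable_prodMk_left).pow_const 2).ennreal_ofReal
  calc ∫⁻ y, ENNReal.ofReal (contaminatedRatio σ ε β (x, y) ^ 2 * Real.exp (-D))
        ∂(referenceMeasure σ (ε / 4))
      = (∫⁻ y, ENNReal.ofReal (contaminatedRatio σ ε β (x, y) ^ 2)
          ∂(referenceMeasure σ (ε / 4))) * ENNReal.ofReal (Real.exp (-D)) := by
        rw [← lintegral_mul_const _ hmy]
        exact lintegral_congr fun y => ENNReal.ofReal_mul (sq_nonneg _)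
    _ = (∫⁻ y, ENNReal.ofReal (contaminatedPDF σ (ε / 4) ε (inner ℝ x β) y ^ 2
          / referencePDF σ (ε / 4) y)) * ENNReal.ofReal (Real.exp (-D)) := by
        rw [referenceMeasure, lintegral_withDensity_eq_lintegral_mul _
          (measurable_referencePDF σ (ε / 4)).ennreal_ofReal hmy]
        congr 1
        refine lintegral_congr fun y => ?_
        have hg := referencePDF_pos hσ hη0 hη1 y
        rw [Pi.mul_apply, ← ENNReal.ofReal_mul hg.le, contaminatedRatio]
        congr 1
        field_simp
    _ ≤ ENNReal.ofReal (Real.exp D) * ENNReal.ofReal (Real.exp (-D)) := by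
        gcongr
        exact lintegral_contaminatedPDF_sq_div_le hσ h0 h1 _
    _ = 1 := by
        rw [← ENNReal.ofReal_mul (Real.exp_pos _).le, ← Real.exp_add, add_neg_cancel,
          Real.exp_zero, ENNReal.ofReal_one]

end LeastFavorable

/-! ### The minimax lower bound -/

section LowerBound

variable {p n : ℕ} {γ σ ε : ℝ}

theorem exists_lintegral_sq_mul_exp_le (hγ : 0 < γ) :
    ∃ K : ℝ, 0 < K ∧ ∫⁻ s, ENNReal.ofReal (|s| ^ 2 * Real.exp (|s| ^ γ / 4))
      ∂(generalizedGaussianReal γ) ≤ ENNReal.ofReal K := by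
  set Z := ∫ s : ℝ, Real.exp (-|s| ^ γ / 2) with hZdef
  have hint := (integrable_pow_mul_exp_neg_abs_rpow hγ 2 (b := 1 / 4) (by norm_num)).div_const Z
  refine ⟨(∫ s : ℝ, |s| ^ 2 * Real.exp (-(1 / 4) * |s| ^ γ) / Z) + 1, ?_, ?_⟩
  · have : 0 ≤ ∫ s : ℝ, |s| ^ 2 * Real.exp (-(1 / 4) * |s| ^ γ) / Z :=
      integral_nonneg fun s => by positivity
    linarith
  · rw [generalizedGaussianReal, lintegral_withDensity_eq_lintegral_mul _ (by fun_prop)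
      (by fun_prop)]
    calc _ = ∫⁻ s : ℝ, ENNReal.ofReal (|s| ^ 2 * Real.exp (-(1 / 4) * |s| ^ γ) / Z) := by
          refine lintegral_congr fun s => ?_
          rw [Pi.mul_apply, ← ENNReal.ofReal_mul (by positivity)]
          congr 1
          rw [← hZdef, div_mul_eq_mul_div, mul_left_comm, ← Real.exp_add]
          congr 3
          ring
      _ = ENNReal.ofReal (∫ s : ℝ, |s| ^ 2 * Real.exp (-(1 / 4) * |s| ^ γ) / Z) :=
          (ofReal_integral_eq_lintegral_ofReal hint
            (Filter.Eventually.of_forall fun s => by positivity)).symm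
      _ ≤ _ := ENNReal.ofReal_le_ofReal (by linarith)

theorem abs_sub_clampMean_le {η : ℝ} (h : 0 ≤ η * σ) (m : ℝ) :
    |m - clampMean σ η m| ≤ max (|m| - η * σ) 0 := by
  unfold clampMean
  rcases le_total m (η * σ) with h1 | h1
  · rw [min_eq_right h1]
    rcases le_total (-(η * σ)) m with h2 | h2
    · rw [max_eq_right h2, sub_self, abs_zero]
      exact le_max_right _ _
    · rw [max_eq_left h2, abs_of_nonpos (by linarith), abs_of_nonpos (by linarith)]
      exact le_max_of_le_left (by linarith)
  · rw [min_eq_left h1, max_eq_right (by linarith), abs_of_nonneg (by linarith),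
      abs_of_nonneg (by linarith)]
    exact le_max_left _ _

/-- Split the mean bound into a sampling part A and a contamination part B. If B ≤ ε/4 clamping
absorbs B. Otherwise |u|^γ ≥ 4ℓ, and the exponential weight compensates ε²/ρ², so B² ≤ A²E. -/
theorem clampMean_excess_sq_le (hγ : 0 < γ) (hσ : 0 < σ) (hε : 0 ≤ ε) {ρ ℓ κ u m : ℝ}
    (hρ : 0 ≤ ρ) (hℓ : 1 ≤ ℓ) (hερ : ε ^ 2 ≤ ρ ^ 2 * Real.exp ℓ) (hκ : 0 < κ)
    (hκγ : (4 * κ) ^ γ ≤ 1 / 4) (hm : |m| ≤ κ * (σ * (ρ + ε / ℓ ^ (1 / γ))) * |u|) :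
    ((m - clampMean σ (ε / 4) m) / σ) ^ 2
      ≤ 4 * κ ^ 2 * ρ ^ 2 * (|u| ^ 2 * Real.exp (|u| ^ γ / 4)) := by
  set lam := ℓ ^ (1 / γ) with hlam
  have hℓ0 : 0 ≤ ℓ := by linarith
  have hlam1 : 1 ≤ lam := Real.one_le_rpow hℓ (by positivity)
  have hlam0 : 0 < lam := by linarith
  set A := κ * ρ * |u| with hA
  set B := κ * ε * |u| / lam with hB
  have hA0 : 0 ≤ A := by positivity
  have hB0 : 0 ≤ B := by positivity
  set E := Real.exp (|u| ^ γ / 4) with hE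
  have hE1 : 1 ≤ E := Real.one_le_exp (by positivity)
  have hmAB : |m| ≤ σ * (A + B) := hm.trans (le_of_eq (by rw [hA, hB]; ring))
  have hexc : |(m - clampMean σ (ε / 4) m) / σ| ≤ max (A + B - ε / 4) 0 := by
    rw [abs_div, abs_of_pos hσ, div_le_iff₀ hσ]
    refine (abs_sub_clampMean_le (η := ε / 4) (by positivity) m).trans (max_le ?_ ?_)
    · have h1 := mul_le_mul_of_nonneg_right (le_max_left (A + B - ε / 4) 0) hσ.le
      linarith
    · exact mul_nonneg (le_max_right _ _) hσ.le
  rw [← sq_abs]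
  have hgoal : 4 * κ ^ 2 * ρ ^ 2 * (|u| ^ 2 * E) = 4 * (A ^ 2 * E) := by rw [hA]; ring
  rw [hgoal]
  rcases le_or_gt B (ε / 4) with h | h
  · have h1 : |(m - clampMean σ (ε / 4) m) / σ| ≤ A :=
      hexc.trans (max_le (by linarith) hA0)
    have h2 := pow_le_pow_left₀ (abs_nonneg _) h1 2
    nlinarith [sq_nonneg A]
  · have h1 : |(m - clampMean σ (ε / 4) m) / σ| ≤ A + B :=
      hexc.trans (max_le (by linarith) (by positivity))
    have h2 := pow_le_pow_left₀ (abs_nonneg _) h1 2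
    have hu : lam ≤ 4 * κ * |u| := by
      rw [hB, div_lt_div_iff₀ (by norm_num) hlam0] at h
      nlinarith
    have huγ : 4 * ℓ ≤ |u| ^ γ := by
      have h3 := Real.rpow_le_rpow hlam0.le hu hγ.le
      rw [hlam, ← Real.rpow_mul hℓ0, one_div_mul_cancel hγ.ne', Real.rpow_one,
        Real.mul_rpow (by positivity) (abs_nonneg u)] at h3
      have h4 : (4 * κ) ^ γ * |u| ^ γ ≤ 1 / 4 * |u| ^ γ := by gcongr
      linarith
    have hεE : ε ^ 2 ≤ ρ ^ 2 * E := by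
      refine hερ.trans (mul_le_mul_of_nonneg_left (Real.exp_le_exp.2 (by linarith)) (sq_nonneg ρ))
    have hBE : B ^ 2 ≤ A ^ 2 * E := by
      have h5 : B ≤ κ * ε * |u| := div_le_self (by positivity) hlam1
      calc B ^ 2 ≤ (κ * ε * |u|) ^ 2 := pow_le_pow_left₀ hB0 h5 2
        _ = κ ^ 2 * |u| ^ 2 * ε ^ 2 := by ring
        _ ≤ κ ^ 2 * |u| ^ 2 * (ρ ^ 2 * E) := by gcongr
        _ = A ^ 2 * E := by rw [hA]; ring
    nlinarith [sq_nonneg (A - B)]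

theorem exists_unit_smul (hp : 0 < p) (w : EuclideanSpace ℝ (Fin p)) :
    ∃ v : EuclideanSpace ℝ (Fin p), ‖v‖ = 1 ∧ w = ‖w‖ • v := by
  by_cases hw : w = 0
  · have : Nonempty (Fin p) := ⟨⟨0, hp⟩⟩
    obtain ⟨v, hv⟩ := (NormedSpace.sphere_nonempty (x := (0 : EuclideanSpace ℝ (Fin p)))
      (r := 1)).2 zero_le_one
    exact ⟨v, mem_sphere_zero_iff_norm.1 hv, by simp [hw]⟩
  · have h : ‖w‖ ≠ 0 := norm_ne_zero_iff.2 hw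
    exact ⟨‖w‖⁻¹ • w, by rw [norm_smul, norm_inv, norm_norm, inv_mul_cancel₀ h],
      by rw [smul_smul, mul_inv_cancel₀ h, one_smul]⟩

theorem lintegral_excess_le (hγ : 0 < γ) (hp : 0 < p) (hn : 0 < n) (hσ : 0 < σ)
    (h0 : 0 ≤ ε) {μ : Measure (EuclideanSpace ℝ (Fin p))}
    (hμ : IsSphericalGeneralizedGaussian γ μ) {K κ : ℝ}
    (hK : ∫⁻ s, ENNReal.ofReal (|s| ^ 2 * Real.exp (|s| ^ γ / 4))
      ∂(generalizedGaussianReal γ) ≤ ENNReal.ofReal K)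
    (hκ : 0 < κ) (hκγ : (4 * κ) ^ γ ≤ 1 / 4)
    {β : EuclideanSpace ℝ (Fin p)} (hβ : ‖β‖ ≤ κ * errorRate γ p n σ ε) :
    ∫⁻ x, ENNReal.ofReal (((inner ℝ x β - clampMean σ (ε / 4) (inner ℝ x β)) / σ) ^ 2) ∂μ
      ≤ ENNReal.ofReal (4 * κ ^ 2 * (p / n) * K) := by
  have hp' : (0 : ℝ) < p := by exact_mod_cast hp
  have hn' : (0 : ℝ) < n := by exact_mod_cast hn
  obtain ⟨v, hv, hβv⟩ := exists_unit_smul hp β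
  set ρ := Real.sqrt ((p : ℝ) / n) with hρ
  have hρ2 : ρ ^ 2 = p / n := Real.sq_sqrt (by positivity)
  set ℓ := Real.log ((n : ℝ) * ε ^ 2 / p + Real.exp 1) with hℓ
  have hℓ1 : 1 ≤ ℓ := one_le_log_add_exp_one (by positivity)
  have hr : errorRate γ p n σ ε = σ * (ρ + ε / ℓ ^ (1 / γ)) := rfl
  rw [hr] at hβ
  have hερ : ε ^ 2 ≤ ρ ^ 2 * Real.exp ℓ := by
    rw [hℓ, Real.exp_log (by positivity), hρ2, mul_add]
    have : (p : ℝ) / n * (n * ε ^ 2 / p) = ε ^ 2 := by field_simp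
    rw [this]
    have : 0 ≤ (p : ℝ) / n * Real.exp 1 := by positivity
    linarith
  have hψ : Measurable fun t : ℝ =>
      ENNReal.ofReal (|t| ^ 2 * Real.exp (|t| ^ γ / 4)) := by fun_prop
  rw [← hρ2]
  calc _ ≤ ∫⁻ x, ENNReal.ofReal (4 * κ ^ 2 * ρ ^ 2) * ENNReal.ofReal (|inner ℝ v x| ^ 2
          * Real.exp (|inner ℝ v x| ^ γ / 4)) ∂μ := by
        refine lintegral_mono fun x => ?_
        rw [← ENNReal.ofReal_mul (by positivity)]
        refine ENNReal.ofReal_le_ofReal (clampMean_excess_sq_le hγ hσ h0 (Real.sqrt_nonneg _)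
          hℓ1 hερ hκ hκγ ?_)
        have hin : |inner ℝ x β| = ‖β‖ * |inner ℝ v x| := by
          conv_lhs => rw [hβv]
          rw [inner_smul_right, abs_mul, abs_norm, real_inner_comm]
        rw [hin]
        exact mul_le_mul_of_nonneg_right hβ (abs_nonneg _)
    _ = ENNReal.ofReal (4 * κ ^ 2 * ρ ^ 2) * ∫⁻ t, ENNReal.ofReal (|t| ^ 2
          * Real.exp (|t| ^ γ / 4)) ∂(generalizedGaussianReal γ) := by
        rw [lintegral_const_mul' _ _ ENNReal.ofReal_ne_top, ← hμ v hv,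
          lintegral_map hψ (by fun_prop)]
    _ ≤ ENNReal.ofReal (4 * κ ^ 2 * ρ ^ 2) * ENNReal.ofReal K := by gcongr
    _ = _ := (ENNReal.ofReal_mul (by positivity)).symm

/-- Markov's inequality for a sum of a nonnegative function of the covariates. -/
theorem adaptiveModel_sum_gt_le (hp : 0 < p) (h0 : 0 ≤ ε) (h1 : ε ≤ 1)
    {μ : Measure (EuclideanSpace ℝ (Fin p))} [IsProbabilityMeasure μ]
    (β : EuclideanSpace ℝ (Fin p)) (Q : Kernel (EuclideanSpace ℝ (Fin p)) ℝ) [IsMarkovKernel Q]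
    {s : EuclideanSpace ℝ (Fin p) → ℝ} (hs0 : ∀ x, 0 ≤ s x) (hsm : Measurable s) {c : ℝ}
    (hs : ∫⁻ x, ENNReal.ofReal (s x) ∂μ ≤ ENNReal.ofReal c) :
    adaptiveModel n μ β σ ε Q {d | (p : ℝ) < ∑ i, s (d i).1} ≤ ENNReal.ofReal (n * c / p) := by
  have hp' : (0 : ℝ) < p := by exact_mod_cast hp
  have hM := isMarkovKernel_responseKernel β σ h0 h1 Q
  have hsm' : Measurable fun z : EuclideanSpace ℝ (Fin p) × ℝ => ENNReal.ofReal (s z.1) :=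
    (hsm.comp measurable_fst).ennreal_ofReal
  have hms : ∀ i : Fin n, Measurable fun d : Fin n → EuclideanSpace ℝ (Fin p) × ℝ =>
      ENNReal.ofReal (s (d i).1) := fun i => hsm'.comp (measurable_pi_apply i)
  have hcoord : ∀ i : Fin n, ∫⁻ d, ENNReal.ofReal (s (d i).1) ∂(adaptiveModel n μ β σ ε Q)
      ≤ ENNReal.ofReal c := fun i => by
    have h2 := (measurePreserving_eval
      (fun _ : Fin n => μ ⊗ₘ responseKernel β σ ε Q) i).lintegral_comp hsm'
    refine (Eq.le h2).trans ?_
    rw [Measure.lintegral_compProd hsm']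
    simpa using hs
  have htot : ∫⁻ d, ∑ i, ENNReal.ofReal (s (d i).1) ∂(adaptiveModel n μ β σ ε Q)
      ≤ ENNReal.ofReal (n * c) := by
    rw [lintegral_finsetSum _ fun i _ => hms i]
    refine (Finset.sum_le_sum fun i _ => hcoord i).trans (le_of_eq ?_)
    rw [Finset.sum_const, Finset.card_univ, Fintype.card_fin, nsmul_eq_mul,
      ENNReal.ofReal_mul n.cast_nonneg, ENNReal.ofReal_natCast]
  have hSm : Measurable fun d : Fin n → EuclideanSpace ℝ (Fin p) × ℝ =>
      ∑ i, ENNReal.ofReal (s (d i).1) := Finset.measurable_sum _ fun i _ => hms i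
  refine (measure_mono (t := {d | ENNReal.ofReal p ≤ ∑ i, ENNReal.ofReal (s (d i).1)})
    fun d hd => ?_).trans
    ((meas_ge_le_lintegral_div hSm.aemeasurable (ENNReal.ofReal_pos.2 hp').ne'
      ENNReal.ofReal_ne_top).trans ((ENNReal.div_le_div_right htot _).trans ?_))
  · change ENNReal.ofReal p ≤ ∑ i, ENNReal.ofReal (s (d i).1)
    rw [← ENNReal.ofReal_sum_of_nonneg fun i _ => hs0 _]
    exact ENNReal.ofReal_le_ofReal (le_of_lt hd)
  · rw [← ENNReal.ofReal_div_of_pos hp']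

/-- Tail bound for the exponent of the second moment of the likelihood ratio. -/
theorem adaptiveModel_excess_tail_le (hγ : 0 < γ) (hp : 0 < p) (hn : 0 < n) (hσ : 0 < σ)
    (h0 : 0 ≤ ε) (h1 : ε ≤ 1) {μ : Measure (EuclideanSpace ℝ (Fin p))} [IsProbabilityMeasure μ]
    (hμ : IsSphericalGeneralizedGaussian γ μ) {K κ : ℝ}
    (hK : ∫⁻ s, ENNReal.ofReal (|s| ^ 2 * Real.exp (|s| ^ γ / 4))
      ∂(generalizedGaussianReal γ) ≤ ENNReal.ofReal K)
    (hκ : 0 < κ) (hκγ : (4 * κ) ^ γ ≤ 1 / 4) (hκK : 16 * κ ^ 2 * K ≤ 1)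
    {β : EuclideanSpace ℝ (Fin p)} (hβ : ‖β‖ ≤ κ * errorRate γ p n σ ε)
    (Q : Kernel (EuclideanSpace ℝ (Fin p)) ℝ) [IsMarkovKernel Q] :
    adaptiveModel n μ β σ ε Q {d | (p : ℝ) < ∑ i,
      ((inner ℝ (d i).1 β - clampMean σ (ε / 4) (inner ℝ (d i).1 β)) / σ) ^ 2}
      ≤ ENNReal.ofReal (1 / 4) := by
  have hp' : (0 : ℝ) < p := by exact_mod_cast hp
  have hn' : (0 : ℝ) < n := by exact_mod_cast hn
  refine (adaptiveModel_sum_gt_le hp h0 h1 β Q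
    (s := fun x => ((inner ℝ x β - clampMean σ (ε / 4) (inner ℝ x β)) / σ) ^ 2)
    (fun x => sq_nonneg _) (by unfold clampMean; fun_prop)
    (lintegral_excess_le hγ hp hn hσ h0 hμ hK hκ hκγ hβ)).trans (ENNReal.ofReal_le_ofReal ?_)
  have heq : (n : ℝ) * (4 * κ ^ 2 * (p / n) * K) / p = 16 * κ ^ 2 * K / 4 := by
    field_simp
    ring
  rw [heq]
  linarith

theorem minimax_lower_bound (hγ : 0 < γ) :
    ∃ C' : ℝ, 0 < C' ∧
      ∀ (p n : ℕ), 0 < p → 0 < n →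
      ∀ (μ : Measure (EuclideanSpace ℝ (Fin p))) [IsProbabilityMeasure μ],
      IsSphericalGeneralizedGaussian γ μ →
      ∀ σ ε : ℝ, 0 < σ → 0 ≤ ε → ε ≤ 1 →
      ∀ est : (Fin n → EuclideanSpace ℝ (Fin p) × ℝ) → EuclideanSpace ℝ (Fin p),
        Measurable est →
        ∃ (β : EuclideanSpace ℝ (Fin p)) (Q : Kernel (EuclideanSpace ℝ (Fin p)) ℝ),
          IsMarkovKernel Q ∧ (1 / 2 : ℝ≥0∞) ≤ adaptiveModel n μ β σ ε Q
            {d | C' * errorRate γ p n σ ε ≤ ‖est d - β‖} := by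
  obtain ⟨K, hK0, hK⟩ := exists_lintegral_sq_mul_exp_le hγ
  -- The first term forces |u|^γ ≥ 4ℓ in the tail case; the second brings the Markov bound 4κ²K down
  -- to 1/4.
  set κ := min ((1 / 4 : ℝ) ^ (1 / γ) / 4) (Real.sqrt (1 / (16 * K))) with hκdef
  have hκ : 0 < κ := lt_min (by positivity) (Real.sqrt_pos.2 (by positivity))
  have hκγ : (4 * κ) ^ γ ≤ 1 / 4 := by
    have h1 : 4 * κ ≤ (1 / 4 : ℝ) ^ (1 / γ) := by
      have := min_le_left ((1 / 4 : ℝ) ^ (1 / γ) / 4) (Real.sqrt (1 / (16 * K)))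
      linarith
    calc (4 * κ) ^ γ ≤ ((1 / 4 : ℝ) ^ (1 / γ)) ^ γ := by gcongr
      _ = 1 / 4 := by
        rw [← Real.rpow_mul (by norm_num), one_div_mul_cancel hγ.ne', Real.rpow_one]
  have hκK : 16 * κ ^ 2 * K ≤ 1 := by
    have h1 : κ ^ 2 ≤ 1 / (16 * K) := by
      rw [← Real.sq_sqrt (by positivity : 0 ≤ 1 / (16 * K))]
      exact pow_le_pow_left₀ hκ.le (min_le_right _ _) 2
    rw [le_div_iff₀ (by positivity)] at h1
    linarith
  refine ⟨κ / 96, by positivity, ?_⟩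
  intro p n hp hn μ _ hμ σ ε hσ h0 h1 est hest
  have hp' : (0 : ℝ) < p := by exact_mod_cast hp
  have hn' : (0 : ℝ) < n := by exact_mod_cast hn
  set r := errorRate γ p n σ ε with hr
  have hr0 : 0 < r := by
    have hℓ1 : 1 ≤ Real.log ((n : ℝ) * ε ^ 2 / p + Real.exp 1) :=
      one_le_log_add_exp_one (by positivity)
    have hℓ0 : 0 ≤ Real.log ((n : ℝ) * ε ^ 2 / p + Real.exp 1) ^ (1 / γ) :=
      Real.rpow_nonneg (by linarith) _
    have : 0 < Real.sqrt ((p : ℝ) / n) := Real.sqrt_pos.2 (by positivity)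
    rw [hr, errorRate]
    positivity
  have hGprob := isProbabilityMeasure_referenceMeasure hσ (by linarith : 0 ≤ ε / 4)
    (by linarith : ε / 4 ≤ 1)
  -- 48 = 16 · 3 gives 48^p ≥ 16·exp(p), matching the excess level p. The parameters are then κr/48
  -- apart, so balls of radius κr/96 are disjoint.
  obtain ⟨W, hWcard, hWball, hWsep⟩ := exists_separated_finset p 48 (by norm_num)
  let B : EuclideanSpace ℝ (Fin p) → EuclideanSpace ℝ (Fin p) := fun w => (κ * r) • w
  choose Q hQm hQ using fun w => exists_kernel_contaminatedPDF hσ h0 h1 (B w)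
  have hlaw : ∀ w, μ ⊗ₘ responseKernel (B w) σ ε (Q w)
      = (μ.prod (referenceMeasure σ (ε / 4))).withDensity
        fun z => ENNReal.ofReal (contaminatedRatio σ ε (B w) z) := fun w => by
    have := hQm w
    exact compProd_eq_withDensity_contaminatedRatio hσ h0 h1 (hQ w) μ
  have hprob : ∀ w, IsProbabilityMeasure ((μ.prod (referenceMeasure σ (ε / 4))).withDensity
      fun z => ENNReal.ofReal (contaminatedRatio σ ε (B w) z)) := fun w => by
    have := hQm w
    have := isMarkovKernel_responseKernel (B w) σ h0 h1 (Q w)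
    rw [← hlaw]
    infer_instance
  have hmodel : ∀ w, adaptiveModel n μ (B w) σ ε (Q w) = Measure.pi fun _ : Fin n =>
      (μ.prod (referenceMeasure σ (ε / 4))).withDensity
        fun z => ENNReal.ofReal (contaminatedRatio σ ε (B w) z) := fun w => by
    rw [adaptiveModel, hlaw]
  let E : EuclideanSpace ℝ (Fin p) → Set (Fin n → EuclideanSpace ℝ (Fin p) × ℝ) := fun w =>
    {d | ‖est d - B w‖ < κ / 96 * r}
  have hE : ∀ w, MeasurableSet (E w) := fun w =>
    measurableSet_lt (by fun_prop) measurable_const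
  have hdisj : (W : Set (EuclideanSpace ℝ (Fin p))).PairwiseDisjoint E := by
    intro w hw w' hw' hne
    refine Set.disjoint_left.2 fun d hd hd' => ?_
    have h2 : κ * r * (1 / 48) ≤ ‖B w - B w'‖ := by
      simp only [B]
      rw [← smul_sub, norm_smul, Real.norm_of_nonneg (by positivity)]
      have := hWsep w hw w' hw' hne
      push_cast at this
      gcongr
    have h3 : ‖B w - B w'‖ ≤ ‖est d - B w'‖ + ‖est d - B w‖ := by
      have := norm_sub_le (est d - B w') (est d - B w)
      rwa [sub_sub_sub_cancel_left] at this
    have h4 : ‖est d - B w‖ < κ / 96 * r := hd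
    have h5 : ‖est d - B w'‖ < κ / 96 * r := hd'
    linarith
  have hWexp : 16 * Real.exp (p : ℝ) ≤ (W.card : ℝ) := by
    rw [hWcard]
    push_cast
    have he : Real.exp 1 ≤ 3 := by linarith [Real.exp_one_lt_d9]
    calc 16 * Real.exp (p : ℝ) ≤ 16 ^ p * Real.exp 1 ^ p := by
          rw [← Real.exp_nat_mul, mul_one]
          gcongr
          exact le_self_pow₀ (by norm_num) hp.ne'
      _ = (16 * Real.exp 1) ^ p := (mul_pow _ _ _).symm
      _ ≤ 48 ^ p := by
          gcongr
          linarith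
  obtain ⟨w, _, hw⟩ := exists_pi_withDensity_le_half (n := n) W
    (μ.prod (referenceMeasure σ (ε / 4)))
    (ℓ := fun w => contaminatedRatio σ ε (B w))
    (s := fun w z => ((inner ℝ z.1 (B w) - clampMean σ (ε / 4) (inner ℝ z.1 (B w))) / σ) ^ 2)
    (fun w => measurable_contaminatedRatio σ ε (B w))
    (fun w => by unfold clampMean; fun_prop)
    (fun w z => contaminatedRatio_nonneg hσ h0 h1 (B w) z) hprob
    (fun w => lintegral_contaminatedRatio_sq_le hσ h0 h1 (B w) μ) hWexp
    (fun w hw => by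
      have := hQm w
      rw [← hmodel]
      refine adaptiveModel_excess_tail_le hγ hp hn hσ h0 h1 hμ hK hκ hκγ hκK ?_ (Q w)
      simp only [B]
      rw [norm_smul, Real.norm_of_nonneg (by positivity)]
      exact mul_le_of_le_one_right (by positivity) (hWball w hw)) hE hdisj
  refine ⟨B w, Q w, hQm w, ?_⟩
  have := hprob w
  have hcompl : {d | κ / 96 * r ≤ ‖est d - B w‖} = (E w)ᶜ := by
    ext d
    simp [E]
  rw [hcompl, hmodel, prob_compl_eq_one_sub (hE w)]
  calc (1 / 2 : ℝ≥0∞) = 1 - 1 / 2 := by rw [one_div, ENNReal.one_sub_inv_two]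
    _ ≤ _ := tsub_le_tsub_left hw 1

end LowerBound

end RobustRegression

open RobustRegression in
/-- Minimax rate under adaptive contamination of the responses with generalized Gaussian design.
The first conjunct is the upper bound for (every choice of) the truncated-depth estimator, which
always exists; the second is the minimax lower bound over all measurable estimators. -/
theorem theorem5p1 (γ : ℝ) (hγ : 0 < γ) :
    (∀ α : ℝ, 0 < α → α < 1 →
      ∃ C c : ℝ, 0 < C ∧ 0 < c ∧
        ∀ (p n : ℕ), 0 < p → 0 < n →
        ∀ (μ : Measure (EuclideanSpace ℝ (Fin p))) [IsProbabilityMeasure μ],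
        IsSphericalGeneralizedGaussian γ μ →
        ∀ σ ε : ℝ, 0 < σ → 0 ≤ ε → ε ≤ 1 → Real.sqrt ((p : ℝ) / (n : ℝ)) + ε ≤ c →
          (∀ d : Fin n → EuclideanSpace ℝ (Fin p) × ℝ,
            ∃ b, IsTruncatedDepthEstimate d (truncationLevel γ p n ε) b) ∧
          ∀ (β : EuclideanSpace ℝ (Fin p)) (Q : Kernel (EuclideanSpace ℝ (Fin p)) ℝ)
            [IsMarkovKernel Q],
            adaptiveModel n μ β σ ε Q
              {d | ¬ ∀ b, IsTruncatedDepthEstimate d (truncationLevel γ p n ε) b →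
                ‖b - β‖ ≤ C * errorRate γ p n σ ε} ≤ ENNReal.ofReal α) ∧
    (∃ C' : ℝ, 0 < C' ∧
      ∀ (p n : ℕ), 0 < p → 0 < n →
      ∀ (μ : Measure (EuclideanSpace ℝ (Fin p))) [IsProbabilityMeasure μ],
      IsSphericalGeneralizedGaussian γ μ →
      ∀ σ ε : ℝ, 0 < σ → 0 ≤ ε → ε ≤ 1 →
        (1 / 2 : ℝ≥0∞) ≤
          ⨅ (est : (Fin n → EuclideanSpace ℝ (Fin p) × ℝ) → EuclideanSpace ℝ (Fin p))
            (_ : Measurable est),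
          ⨆ (β : EuclideanSpace ℝ (Fin p)) (Q : Kernel (EuclideanSpace ℝ (Fin p)) ℝ)
            (_ : IsMarkovKernel Q),
            adaptiveModel n μ β σ ε Q {d | C' * errorRate γ p n σ ε ≤ ‖est d - β‖}) := by
  refine ⟨fun α hα _ => ?_, ?_⟩
  · obtain ⟨C, c, hC, hc, h⟩ := truncatedDepth_upper_bound hγ hα
    exact ⟨C, c, hC, hc, fun p n hp hn μ _ hμ σ ε hσ h0 h1 hsmall =>
      ⟨fun d => exists_isTruncatedDepthEstimate hp d _,
        h p n hp hn μ hμ σ ε hσ h0 h1 hsmall⟩⟩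
  · obtain ⟨C', hC', h⟩ := minimax_lower_bound hγ
    refine ⟨C', hC', fun p n hp hn μ _ hμ σ ε hσ h0 h1 => le_iInf₂ fun est hest => ?_⟩
    obtain ⟨β, Q, hQ, hle⟩ := h p n hp hn μ hμ σ ε hσ h0 h1 est hest
    exact le_iSup_of_le β (le_iSup_of_le Q (le_iSup_of_le hQ hle))
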